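/- **Setting.** Let $\gamma>0$ and consider $n$-qubit circuits of depth $d$ with uniform noise, $$\mathcal C\{\rho\}=\mathcal D\{U_1\,\mathcal D\{\cdots U_d\,\mathcal D\{\rho\}\,U_d^\dagger\cdots\}\,U_1^\dagger\},$$ where each $U_t$ is a product of arbitrary two-qubit unitary gates on pairwise disjoint pairs of qubits, and $\mathcal D=\bigotimes_j\mathcal D_j$ with $\mathcal D_j\{A\}=e^{-\gamma}A+(1-e^{-\gamma})\,\mathrm{tr}_j(A)\otimes\tfrac{\mathbb 1}{2}$. Write $\|A\|_F^2=2^{-n}\mathrm{tr}(A^\dagger A)$. For a Pauli operator $P$ let $w[P]$ be its number of non-identity letters. For a Pauli path $\vec P=(P_0,\dots,P_d)$ put $w[\vec P]=\sum_t w[P_t]$ and $a^{(t)}_{PQ}=2^{-n}\mathrm{tr}(QU_t^\dagger PU_t)$. For a threshold $\ell\in\mathbb N$ let $$\tilde O_\ell=\sum_{\vec P:\,w[\vec P]\le \ell}e^{-\gamma w[\vec P]}\,\frac{\mathrm{tr}(OP_0)}{2^n}\Big(\prod_{t=1}^d a^{(t)}_{P_{t-1}P_t}\Big)P_d .$$ A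 finite family of states $\rho_1,\dots,\rho_N$ ($N\ge1$) is *low-average with purity $c$* if $\|\frac1N\sum_i\rho_i\|_\infty\le c/2^n$. **Machine model.** A random-access machine with natural-number registers and arrays (addition, truncated subtraction, comparison) and complex registers and arrays (exact $+,-,\times,\div$, conjugation, comparison of real parts), each operation taking one step. The input is read by queries; a query takes $\tau\ge1$ steps plus the length of the query word. The queries return $n$, $d$, $\gamma$, $e^{-\gamma}$, $\varepsilon$, the positions and matrix entries of the gates, the Pauli coefficients $\mathrm{tr}(\rho P)$, and, for the observable, either a list of $m$ terms $(P_i,\alpha_i)$ with $O=\sum_{i=1}^m\alpha_iP_i$, or, for general $O$, the Pauli coefficients $2^{-n}\mathrm{tr}(OP)$. **Theorem.** (1) *Accuracy.* For all $n$, $\gamma>0$, every circuit of depth $d$, every Hermitian $O$ and every $\ell\ge d$, $$\|\mathcal C^\dagger\{O\}-\tilde O_\ell\|_F^2\le\binom{\ell}{d}e^{-2\gamma(\ell+1)}\|O\|_F^2 .$$ (2) *Algorithm.* There are a threshold function $\ell=\ell(d,\gamma,\varepsilon)$, two fixed programs (one for each way in which $O$ is given) and an absolute constant $C$ such that the following holds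 for all $n\ge1$, $\gamma>0$, $0<\varepsilon\le1$, every circuit of depth $d\ge1$ and every Hermitian $O$ with $\|O\|_F=1$. Put $g=\min(\gamma,\tfrac12)$. On every input state $\rho$ the programs halt with output exactly $\mathrm{tr}(\rho\,\tilde O_\ell)$. For every $c$ and every low-average ensemble with purity $c$, the root-mean-square over the ensemble of $\mathrm{tr}(\mathcal C\{\rho\}O)-\mathrm{tr}(\rho\,\tilde O_\ell)$ is at most $\sqrt c\,\varepsilon$. The number of steps is at most $$\tau\cdot C\,m\,n^{C}\,(1/\varepsilon)^{C\log(1/g)/g^2}$$ if $O$ is given as a sum of $m$ Pauli operators (so $\mathrm{poly}(n)\,(1/\varepsilon)^{O(\log(1/\gamma)/\gamma^2)}$ for $m,\tau=\mathrm{poly}(n)$), and at most $$\tau\cdot C\,n^{\,C\log(1/g)/g+C\log(1/\varepsilon)/(g d)}\,(1/\varepsilon)^{C\log(1/g)/g^2}$$ for general $O$. -/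

import Mathlib

open Matrix
open scoped ComplexOrder

noncomputable section

namespace NoisyCircuit

/-! ## Qubits, Pauli operators, norms -/

/-- Operators on `n` qubits, as matrices in the computational basis. -/
abbrev Op (n : ℕ) : Type := Matrix (Fin n → Fin 2) (Fin n → Fin 2) ℂ

/-- The single-qubit Pauli matrices `1, X, Y, Z`, numbered `0, 1, 2, 3`. -/
def pauli1 : Fin 4 → Matrix (Fin 2) (Fin 2) ℂ :=
  ![1, !![0, 1; 1, 0], !![0, -Complex.I; Complex.I, 0], !![1, 0; 0, -1]]

/-- An `n`-qubit Pauli operator, given by its letters. -/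
abbrev PauliString (n : ℕ) : Type := Fin n → Fin 4

/-- The operator of a Pauli string: the tensor product of its letters. -/
def PauliString.toOp {n : ℕ} (P : PauliString n) : Op n :=
  Matrix.of fun x y => ∏ j, pauli1 (P j) (x j) (y j)

/-- The number of non-identity letters. -/
def PauliString.weight {n : ℕ} (P : PauliString n) : ℕ :=
  (Finset.univ.filter fun j => P j ≠ 0).card

/-- The Pauli coefficient `tr(O P) / 2^n` of an operator. -/
def pauliCoeff {n : ℕ} (O : Op n) (P : PauliString n) : ℂ :=
  Matrix.trace (O * P.toOp) / 2 ^ n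

/-- The square of the normalized Frobenius norm, `tr(A† A) / 2^n`. -/
def frobSq {n : ℕ} (A : Op n) : ℝ := (Matrix.trace (Aᴴ * A)).re / 2 ^ n

/-- Quantum states. -/
def IsDensity {n : ℕ} (ρ : Op n) : Prop := ρ.PosSemidef ∧ ρ.trace = 1

/-- A finite ensemble of states (uniformly weighted) is low-average with purity `c`: the operator
norm of its mixture is at most `c / 2^n`. -/
def IsLowAverage {n N : ℕ} (c : ℝ) (ρ : Fin N → Op n) : Prop :=
  ‖Matrix.toEuclideanCLM (𝕜 := ℂ) ((N : ℂ)⁻¹ • ∑ i, ρ i)‖ ≤ c / 2 ^ n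

/-! ## Circuits with uniform depolarizing noise -/

/-- An arbitrary two-qubit gate acting on two distinct qubits. -/
structure Gate (n : ℕ) where
  q₁ : Fin n
  q₂ : Fin n
  ne : q₁ ≠ q₂
  mat : Matrix (Fin 2 × Fin 2) (Fin 2 × Fin 2) ℂ
  unitary : mat ∈ Matrix.unitaryGroup (Fin 2 × Fin 2) ℂ

/-- The gate as an operator on all `n` qubits (identity on the other qubits). -/
def Gate.toOp {n : ℕ} (g : Gate n) : Op n :=
  Matrix.of fun x y =>
    if ∀ j, j ≠ g.q₁ → j ≠ g.q₂ → x j = y j then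
      g.mat (x g.q₁, x g.q₂) (y g.q₁, y g.q₂)
    else 0

/-- A circuit layer: two-qubit gates on pairwise disjoint pairs of qubits. -/
structure Layer (n : ℕ) where
  gates : List (Gate n)
  disjoint : gates.Pairwise fun g h =>
    Disjoint ({g.q₁, g.q₂} : Finset (Fin n)) {h.q₁, h.q₂}

/-- The depth-1 unitary of a layer (its gates commute). -/
def Layer.toOp {n : ℕ} (U : Layer n) : Op n := (U.gates.map Gate.toOp).prod

/-- A circuit `[U_1, ..., U_d]`; the layers are indexed in reverse order of time, so `U_d` acts
first and `U_1` last. Its depth is the length of the list. -/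
abbrev Circuit (n : ℕ) : Type := List (Layer n)

/-- Discard qubit `j` and replace it by the maximally mixed state. -/
def mixQubit {n : ℕ} (j : Fin n) (A : Op n) : Op n :=
  Matrix.of fun x y =>
    if x j = y j then
      (1 / 2 : ℂ) * ∑ b : Fin 2, A (Function.update x j b) (Function.update y j b)
    else 0

/-- The local depolarizing channel of strength `γ` on qubit `j`. -/
def depolarizeQubit {n : ℕ} (γ : ℝ) (j : Fin n) (A : Op n) : Op n :=
  (Real.exp (-γ) : ℂ) • A + (1 - Real.exp (-γ) : ℂ) • mixQubit j A

/-- Uniform noise: the local depolarizing channel on every qubit. -/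
def depolarize {n : ℕ} (γ : ℝ) (A : Op n) : Op n :=
  (List.finRange n).foldr (depolarizeQubit γ) A

/-- The noisy circuit `𝒞{ρ} = 𝒟{U_1 𝒟{... U_d 𝒟{ρ} U_d† ...} U_1†}`. -/
def channel {n : ℕ} (γ : ℝ) : Circuit n → Op n → Op n
  | [], ρ => depolarize γ ρ
  | U :: L, ρ => depolarize γ (U.toOp * channel γ L ρ * U.toOpᴴ)

/-- The Heisenberg-evolved observable `𝒞†{O} = 𝒟{U_d† ... 𝒟{U_1† 𝒟{O} U_1} ... U_d}`
(the depolarizing channel is its own adjoint). -/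
def heisenberg {n : ℕ} (γ : ℝ) : Circuit n → Op n → Op n
  | [], O => depolarize γ O
  | U :: L, O => heisenberg γ L (U.toOpᴴ * depolarize γ O * U.toOp)

/-- The transition amplitude `a_{PQ} = tr(Q U† P U) / 2^n` of a layer. -/
def amplitude {n : ℕ} (U : Layer n) (P Q : PauliString n) : ℂ :=
  Matrix.trace (Q.toOp * U.toOpᴴ * P.toOp * U.toOp) / 2 ^ n

/-- A Pauli path `(P_0, ..., P_d)` through a circuit of depth `d`. -/
abbrev PauliPath (n d : ℕ) : Type := Fin (d + 1) → PauliString n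

/-- The total weight of a Pauli path. -/
def PauliPath.weight {n d : ℕ} (P : PauliPath n d) : ℕ := ∑ t, PauliString.weight (P t)

/-- The sum over the Pauli paths of total weight at most `ℓ`: the approximation `Õ` of `𝒞†{O}`. -/
def truncated {n : ℕ} (γ : ℝ) (ℓ : ℕ) (L : Circuit n) (O : Op n) : Op n :=
  ∑ P : PauliPath n L.length with P.weight ≤ ℓ,
    ((Real.exp (-γ * P.weight) : ℂ) * pauliCoeff O (P 0) *
      ∏ t : Fin L.length, amplitude (L.get t) (P t.castSucc) (P t.succ)) •
        (P (Fin.last L.length)).toOp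

/-! ## The classical machine

A random-access machine with unit-cost exact arithmetic. It has natural-number registers and arrays
(with addition, truncated subtraction and comparison, but without multiplication, so that numbers
have length at most linear in the running time), and scalar registers and arrays that hold complex
numbers (with field operations, conjugation, and comparison of real parts, but without rounding).
The input is read by queries, which are words of natural numbers. -/

/-- An input: the answers to the two kinds of queries. -/
structure Input where
  nat : List ℕ → ℕ
  scalar : List ℕ → ℂ

/-- A memory configuration. -/
structure State where
  reg : ℕ → ℕ
  arr : ℕ → ℕ → ℕ
  sreg : ℕ → ℂ
  sarr : ℕ → ℕ → ℂ

/-- The blank memory. -/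
def State.blank : State := ⟨fun _ => 0, fun _ _ => 0, fun _ => 0, fun _ _ => 0⟩

/-- Store a natural number in a register. -/
def State.setReg (s : State) (i v : ℕ) : State := { s with reg := Function.update s.reg i v }

/-- Store a scalar in a register. -/
def State.setSreg (s : State) (i : ℕ) (v : ℂ) : State :=
  { s with sreg := Function.update s.sreg i v }

/-- Store a natural number in cell `a` of array `k`. -/
def State.setArr (s : State) (k a v : ℕ) : State :=
  { s with arr := Function.update s.arr k (Function.update (s.arr k) a v) }

/-- Store a scalar in cell `a` of scalar array `k`. -/
def State.setSarr (s : State) (k a : ℕ) (v : ℂ) : State :=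
  { s with sarr := Function.update s.sarr k (Function.update (s.sarr k) a v) }

/-- The word in the first `len` cells of array `k`. -/
def State.word (s : State) (k len : ℕ) : List ℕ := (List.range len).map (s.arr k)

/-- Elementary instructions. The destination is always named first; registers and arrays are named
by constants of the program, array cells are addressed by the content of a register. -/
inductive Instr where
  | const (i c : ℕ)
  | add (i j k : ℕ)
  | sub (i j k : ℕ)
  | load (i k a : ℕ)
  | store (k a j : ℕ)
  | sconst (i : ℕ) (re im : ℚ)
  | sadd (i j k : ℕ)
  | ssub (i j k : ℕ)
  | smul (i j k : ℕ)
  | sdiv (i j k : ℕ)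
  | sconj (i j : ℕ)
  | sload (i k a : ℕ)
  | sstore (k a j : ℕ)
  | query (i k len : ℕ)
  | squery (i k len : ℕ)

/-- The effect of an instruction. -/
def Instr.exec (I : Input) (s : State) : Instr → State
  | .const i c => s.setReg i c
  | .add i j k => s.setReg i (s.reg j + s.reg k)
  | .sub i j k => s.setReg i (s.reg j - s.reg k)
  | .load i k a => s.setReg i (s.arr k (s.reg a))
  | .store k a j => s.setArr k (s.reg a) (s.reg j)
  | .sconst i p q => s.setSreg i ((p : ℂ) + (q : ℂ) * Complex.I)
  | .sadd i j k => s.setSreg i (s.sreg j + s.sreg k)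
  | .ssub i j k => s.setSreg i (s.sreg j - s.sreg k)
  | .smul i j k => s.setSreg i (s.sreg j * s.sreg k)
  | .sdiv i j k => s.setSreg i (s.sreg j / s.sreg k)
  | .sconj i j => s.setSreg i (star (s.sreg j))
  | .sload i k a => s.setSreg i (s.sarr k (s.reg a))
  | .sstore k a j => s.setSarr k (s.reg a) (s.sreg j)
  | .query i k len => s.setReg i (I.nat (s.word k (s.reg len)))
  | .squery i k len => s.setSreg i (I.scalar (s.word k (s.reg len)))

/-- The time taken by an instruction: a query costs `τ` plus the length of the query word, and
everything else costs one step. -/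
def Instr.cost (τ : ℕ) (s : State) : Instr → ℕ
  | .query _ _ len => τ + s.reg len
  | .squery _ _ len => τ + s.reg len
  | _ => 1

/-- Tests. -/
inductive Test where
  | lt (i j : ℕ)
  | eq (i j : ℕ)
  | slt (i j : ℕ)

/-- The truth value of a test; scalars are compared by their real parts. -/
def Test.holds (s : State) : Test → Prop
  | .lt i j => s.reg i < s.reg j
  | .eq i j => s.reg i = s.reg j
  | .slt i j => (s.sreg i).re < (s.sreg j).re

/-- Programs. -/
inductive Program where
  | skip
  | step (c : Instr)
  | seq (p q : Program)
  | branch (b : Test) (p q : Program)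
  | loop (b : Test) (p : Program)

/-- `Exec I τ p s s' T`: on input `I`, with query cost `τ`, the program `p` started in the memory
`s` halts in the memory `s'` after exactly `T` steps. A test costs one step. -/
inductive Exec (I : Input) (τ : ℕ) : Program → State → State → ℕ → Prop where
  | skip (s : State) : Exec I τ .skip s s 0
  | step (c : Instr) (s : State) : Exec I τ (.step c) s (c.exec I s) (c.cost τ s)
  | seq {p q : Program} {s s' s'' : State} {T T' : ℕ} :
      Exec I τ p s s' T → Exec I τ q s' s'' T' → Exec I τ (.seq p q) s s'' (T + T')
  | branch_true {b : Test} {p q : Program} {s s' : State} {T : ℕ} :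
      b.holds s → Exec I τ p s s' T → Exec I τ (.branch b p q) s s' (T + 1)
  | branch_false {b : Test} {p q : Program} {s s' : State} {T : ℕ} :
      ¬ b.holds s → Exec I τ q s s' T → Exec I τ (.branch b p q) s s' (T + 1)
  | loop_done {b : Test} {p : Program} {s : State} :
      ¬ b.holds s → Exec I τ (.loop b p) s s 1
  | loop_next {b : Test} {p : Program} {s s' s'' : State} {T T' : ℕ} :
      b.holds s → Exec I τ p s s' T → Exec I τ (.loop b p) s' s'' T' →
        Exec I τ (.loop b p) s s'' (T + T' + 1)

/-- On input `I`, with query cost `τ`, the program halts with output `v` (in scalar register `0`)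
after exactly `T` steps. -/
def Program.Outputs (p : Program) (I : Input) (τ : ℕ) (v : ℂ) (T : ℕ) : Prop :=
  ∃ s : State, Exec I τ p State.blank s T ∧ s.sreg 0 = v

/-! ## How the simulation problem is presented to the machine -/

/-- Gate number `g` of layer number `t` (counted from `0`, so layer number `t` is `U_{t+1}`). -/
def gateAt {n : ℕ} (L : Circuit n) (t g : ℕ) : Option (Gate n) :=
  L[t]?.bind fun U => U.gates[g]?

/-- The description of a circuit: number of qubits, depth, number of gates in a layer, and
the two qubits of a gate. -/
def circuitNat {n : ℕ} (L : Circuit n) : List ℕ → ℕ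
  | [0] => n
  | [1] => L.length
  | [2, t] => (L[t]?.map fun U => U.gates.length).getD 0
  | [3, t, g] => ((gateAt L t g).map fun G => (G.q₁ : ℕ)).getD 0
  | [4, t, g] => ((gateAt L t g).map fun G => (G.q₂ : ℕ)).getD 0
  | _ => 0

/-- The Pauli string whose letters are the entries of a word. -/
def decodePauli (n : ℕ) (w : List ℕ) : PauliString n := fun j => Fin.ofNat 4 (w.getD j 0)

/-- The noise strength `γ` together with `e^{-γ}`, the target accuracy `ε`, the entries of the
gates, and the Pauli coefficients `tr(ρ P)` of the input state. -/
def circuitScalar {n : ℕ} (γ ε : ℝ) (L : Circuit n) (ρ : Op n) : List ℕ → ℂ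
  | [0] => (γ : ℂ)
  | [1] => (Real.exp (-γ) : ℂ)
  | [2] => (ε : ℂ)
  | [3, t, g, a, b, a', b'] =>
      ((gateAt L t g).map fun G =>
        G.mat (Fin.ofNat 2 a, Fin.ofNat 2 b) (Fin.ofNat 2 a', Fin.ofNat 2 b')).getD 0
  | 4 :: w => Matrix.trace (ρ * (decodePauli n w).toOp)
  | _ => 0

/-- The input when the observable is given by its Pauli coefficients `tr(O P) / 2^n`. -/
def generalInput {n : ℕ} (γ ε : ℝ) (L : Circuit n) (ρ O : Op n) : Input where
  nat := circuitNat L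
  scalar
    | 5 :: w => pauliCoeff O (decodePauli n w)
    | w => circuitScalar γ ε L ρ w

/-- The observable with the given list of Pauli terms. -/
def sumOfPaulis {n : ℕ} (terms : List (PauliString n × ℂ)) : Op n :=
  (terms.map fun p => p.2 • p.1.toOp).sum

/-- The input when the observable is given by a list of Pauli terms: their number, their letters
and their coefficients. -/
def sparseInput {n : ℕ} (γ ε : ℝ) (L : Circuit n) (ρ : Op n)
    (terms : List (PauliString n × ℂ)) : Input where
  nat
    | [5] => terms.length
    | [6, i, j] =>
        (terms[i]?.map fun p => if h : j < n then (p.1 ⟨j, h⟩ : ℕ) else 0).getD 0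
    | w => circuitNat L w
  scalar
    | [5, i] => (terms[i]?.map fun p => p.2).getD 0
    | w => circuitScalar γ ε L ρ w

end NoisyCircuit

end

noncomputable section

namespace NoisyCircuit

/-! ## The Pauli basis -/

/-! Accuracy. In the Pauli basis the noise is diagonal with entries e^{-γ w[P]}, while a layer
preserves the Frobenius norm and fixes the identity coefficient. The bound is proved by induction on
the depth, splitting O by the weight k of the first string of a path. The identity component is
evolved without error. The component of weight k is damped by e^{-γk} and then meets a shorter
circuit with the remaining budget ℓ - k. A path that starts off the identity never returns to it, so
a shorter circuit of depth d asks for weight at least d + 1; once the budget is at most d, nothing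
of the truncation is left, and the error is the full evolution, damped by e^{-γ} in every round of
noise. Hence all k ≥ ℓ - d form a single class. The classes do not stay orthogonal, so their errors
are combined by a weighted Cauchy-Schwarz inequality, and the hockey-stick identity ∑ C(ℓ-k, d) =
C(ℓ, d+1) reproduces the binomial coefficient (`frobSq_errorLin_le`). For an ensemble, |tr(ρE)|² ≤
tr(E†ρE) is linear in ρ on the right, so only the operator norm of the mixture matters
(`rms_error_le`).

Threshold. With x = e^{-γ}, the error bound contains x^{ℓ+1} twice. One copy absorbs C(ℓ, d) at the
price (1/(1-x))^{d+1}; the other is made small by taking ℓ minimal (`choose_mul_pow_le`). If x^{d+1}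
≤ ε already, the identity component suffices: the threshold is 0 and the circuit may be replaced by
the empty one. Otherwise d + 1 is at most of order log(1/ε)/γ, which keeps the depth out of the
running time (`timeBounds`).

Enumeration. A gate acts on a string by changing two letters, with 16 possible outcomes, and does
nothing if both letters are identities. As gates of a layer are disjoint, at most w[P] of them act
on P. A path is therefore described by its entry at one position t together with one base-16 choice
for each acting gate, met while propagating from t to both ends. Paths of weight at most ℓ need at
most 2ℓ choices, so the numbers below 256^ℓ, read as tapes of digits, exhaust them; requiring that
the tape be used up counts every path once (`sum_foldl_stageStep`, `sum_tapeValue`). For a sum of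
Pauli operators one starts at t = 0 from every term. For general O one uses that some entry has
weight at most ℓ/(d+1), starts from all strings that are so light, and makes t the first such entry
by discarding light strings while going backwards (`sum_tapeValue_low`). Light strings are listed by
a mixed-radix code with a factor 4n per non-identity letter (`sum_decode`).

Machine. The programs carry out exactly these folds. Total correctness with time bounds is derived
from rules for `Halts`, and everything a program does not overwrite is carried along by the frame
relation `Agree`, which is read off the program text. Division by repeated subtraction takes time
linear in the tape, so the number of tapes enters squared; this only changes constants in the
exponents. The bounds follow from ℓ ≤ 4A and d + 1 ≤ e^A for the depth d of the circuit actually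
simulated, where A = log(1/ε) log(1/g)/g². -/

theorem pauli1_completeness (x y z w : Fin 2) :
    ∑ a, pauli1 a x y * pauli1 a z w = if x = w ∧ y = z then 2 else 0 := by
  fin_cases x <;> fin_cases y <;> fin_cases z <;> fin_cases w <;>
    simp [pauli1, Fin.sum_univ_four] <;> norm_num

theorem pauli1_orthogonality (a b : Fin 4) :
    ∑ x, ∑ y, pauli1 a x y * pauli1 b y x = if a = b then 2 else 0 := by
  fin_cases a <;> fin_cases b <;> simp [pauli1, Fin.sum_univ_two] <;> norm_num

theorem star_pauli1 (a : Fin 4) (x y : Fin 2) : star (pauli1 a x y) = pauli1 a y x := by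
  fin_cases a <;> fin_cases x <;> fin_cases y <;> simp [pauli1]

theorem pauli1_zero_apply (x y : Fin 2) : pauli1 0 x y = if x = y then 1 else 0 := by
  simp [pauli1, Matrix.one_apply]

theorem PauliString.toOp_apply {n : ℕ} (P : PauliString n) (x y : Fin n → Fin 2) :
    P.toOp x y = ∏ j, pauli1 (P j) (x j) (y j) := rfl

theorem PauliString.toOp_zero {n : ℕ} : PauliString.toOp (0 : PauliString n) = 1 := by
  ext x y
  simp only [PauliString.toOp_apply, Pi.zero_apply, pauli1_zero_apply, Matrix.one_apply,
    Finset.prod_ite_zero, Finset.prod_const_one]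
  simp [funext_iff]

theorem PauliString.conjTranspose_toOp {n : ℕ} (P : PauliString n) : P.toOpᴴ = P.toOp := by
  ext x y
  simp only [Matrix.conjTranspose_apply, PauliString.toOp_apply]
  rw [star_prod]
  exact Finset.prod_congr rfl fun j _ => star_pauli1 _ _ _

/-- The trace of a product of tensor products factorizes over the qubits, so the single-qubit case
suffices. -/
theorem PauliString.trace_toOp_mul {n : ℕ} (P Q : PauliString n) :
    Matrix.trace (P.toOp * Q.toOp) = if P = Q then 2 ^ n else 0 := by
  have h : ∀ x y : Fin n → Fin 2, P.toOp x y * Q.toOp y x =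
      ∏ j, pauli1 (P j) (x j) (y j) * pauli1 (Q j) (y j) (x j) := fun x y => by
    simp only [PauliString.toOp_apply, Finset.prod_mul_distrib]
  simp only [Matrix.trace, Matrix.diag_apply, Matrix.mul_apply, h]
  have h2 : ∀ x : Fin n → Fin 2,
      ∑ y : Fin n → Fin 2, ∏ j, pauli1 (P j) (x j) (y j) * pauli1 (Q j) (y j) (x j) =
      ∏ j, ∑ b, pauli1 (P j) (x j) b * pauli1 (Q j) b (x j) := fun x =>
    (Fintype.prod_sum fun j b => pauli1 (P j) (x j) b * pauli1 (Q j) b (x j)).symm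
  simp only [h2]
  rw [← Fintype.prod_sum fun j c => ∑ b, pauli1 (P j) c b * pauli1 (Q j) b c]
  simp only [pauli1_orthogonality, Finset.prod_ite_zero, Finset.prod_const]
  simp [funext_iff]

/-- Completeness also factorizes over the qubits. This entrywise form is what makes every operator
the sum of its Pauli components. -/
theorem sum_toOp_mul_toOp {n : ℕ} (x y z w : Fin n → Fin 2) :
    ∑ P : PauliString n, P.toOp x y * P.toOp z w = if x = w ∧ y = z then 2 ^ n else 0 := by
  have h : ∀ P : PauliString n, P.toOp x y * P.toOp z w =
      ∏ j, pauli1 (P j) (x j) (y j) * pauli1 (P j) (z j) (w j) := fun P => by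
    simp only [PauliString.toOp_apply, Finset.prod_mul_distrib]
  simp only [h]
  rw [← Fintype.prod_sum fun j a => pauli1 a (x j) (y j) * pauli1 a (z j) (w j)]
  simp only [pauli1_completeness, Finset.prod_ite_zero, Finset.prod_const]
  simp [funext_iff, forall_and]

theorem sum_pauliCoeff_smul {n : ℕ} (A : Op n) :
    ∑ P : PauliString n, pauliCoeff A P • P.toOp = A := by
  ext z w
  simp only [Matrix.sum_apply, Matrix.smul_apply, smul_eq_mul, pauliCoeff, Matrix.trace,
    Matrix.diag_apply, Matrix.mul_apply]
  have h : ∀ P : PauliString n, (∑ x, ∑ y, A x y * P.toOp y x) / 2 ^ n * P.toOp z w =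
      ∑ x, ∑ y, A x y / 2 ^ n * (P.toOp y x * P.toOp z w) := fun P => by
    rw [div_mul_eq_mul_div, Finset.sum_mul, Finset.sum_div]
    refine Finset.sum_congr rfl fun x _ => ?_
    rw [Finset.sum_mul, Finset.sum_div]
    exact Finset.sum_congr rfl fun y _ => by ring
  simp only [h]
  rw [Finset.sum_comm]
  have h2 : ∀ x : Fin n → Fin 2,
      ∑ P : PauliString n, ∑ y, A x y / 2 ^ n * (P.toOp y x * P.toOp z w) =
      ∑ y, A x y / 2 ^ n * if y = w ∧ x = z then 2 ^ n else 0 := fun x => by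
    rw [Finset.sum_comm]
    exact Finset.sum_congr rfl fun y _ => by rw [← Finset.mul_sum, sum_toOp_mul_toOp]
  simp only [h2]
  rw [Finset.sum_eq_single z, Finset.sum_eq_single w] <;> simp +contextual

theorem pauliCoeff_add {n : ℕ} (A B : Op n) (P : PauliString n) :
    pauliCoeff (A + B) P = pauliCoeff A P + pauliCoeff B P := by
  simp [pauliCoeff, add_mul, add_div]

theorem pauliCoeff_smul {n : ℕ} (c : ℂ) (A : Op n) (P : PauliString n) :
    pauliCoeff (c • A) P = c * pauliCoeff A P := by
  simp [pauliCoeff, mul_div_assoc]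

theorem pauliCoeff_toOp {n : ℕ} (P Q : PauliString n) :
    pauliCoeff P.toOp Q = if P = Q then 1 else 0 := by
  rw [pauliCoeff, PauliString.trace_toOp_mul]
  split_ifs <;> simp

/-- The Pauli coefficients as a linear map into a Euclidean space. -/
def coeffVec (n : ℕ) : Op n →ₗ[ℂ] EuclideanSpace ℂ (PauliString n) where
  toFun A := WithLp.toLp 2 fun P => pauliCoeff A P
  map_add' A B := by ext P; simp [pauliCoeff_add]
  map_smul' c A := by ext P; simp [pauliCoeff_smul]

@[simp] theorem coeffVec_apply {n : ℕ} (A : Op n) (P : PauliString n) :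
    coeffVec n A P = pauliCoeff A P := rfl

theorem op_ext {n : ℕ} {A B : Op n} (h : ∀ P, pauliCoeff A P = pauliCoeff B P) : A = B := by
  rw [← sum_pauliCoeff_smul A, ← sum_pauliCoeff_smul B]
  simp [h]

theorem pauliCoeff_sum {n : ℕ} {ι : Type*} (s : Finset ι) (A : ι → Op n) (P : PauliString n) :
    pauliCoeff (∑ i ∈ s, A i) P = ∑ i ∈ s, pauliCoeff (A i) P := by
  simp only [pauliCoeff, Finset.sum_mul, Matrix.trace_sum, Finset.sum_div]

/-- Parseval's identity: the Pauli strings are Hermitian and orthogonal. All norm estimates are made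
on coefficients through it. -/
theorem trace_conjTranspose_mul {n : ℕ} (A B : Op n) :
    Matrix.trace (Aᴴ * B) = 2 ^ n * ∑ P, star (pauliCoeff A P) * pauliCoeff B P := by
  conv_lhs => rw [← sum_pauliCoeff_smul A, ← sum_pauliCoeff_smul B]
  rw [Matrix.conjTranspose_sum, Finset.sum_mul, Matrix.trace_sum, Finset.mul_sum]
  refine Finset.sum_congr rfl fun P _ => ?_
  rw [Finset.mul_sum, Matrix.trace_sum, Finset.sum_eq_single P]
  · rw [Matrix.conjTranspose_smul, PauliString.conjTranspose_toOp, smul_mul_smul_comm,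
      Matrix.trace_smul, PauliString.trace_toOp_mul, if_pos rfl, smul_eq_mul, mul_comm]
  · intro Q _ hQ
    rw [Matrix.conjTranspose_smul, PauliString.conjTranspose_toOp, smul_mul_smul_comm,
      Matrix.trace_smul, PauliString.trace_toOp_mul, if_neg (Ne.symm hQ), smul_zero]
  · simp

theorem frobSq_eq_sum {n : ℕ} (A : Op n) : frobSq A = ∑ P, ‖pauliCoeff A P‖ ^ 2 := by
  have h : Matrix.trace (Aᴴ * A) = ((2 ^ n * ∑ P, ‖pauliCoeff A P‖ ^ 2 : ℝ) : ℂ) := by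
    rw [trace_conjTranspose_mul]
    push_cast
    congr 1
    refine Finset.sum_congr rfl fun P _ => ?_
    exact RCLike.conj_mul _
  rw [frobSq, h, Complex.ofReal_re, mul_div_cancel_left₀ _ (by positivity)]

theorem frobSq_eq_norm_sq {n : ℕ} (A : Op n) : frobSq A = ‖coeffVec n A‖ ^ 2 := by
  rw [frobSq_eq_sum, EuclideanSpace.norm_sq_eq]
  rfl

theorem frobSq_nonneg {n : ℕ} (A : Op n) : 0 ≤ frobSq A := by
  rw [frobSq_eq_norm_sq]; positivity

/-! ## Noise -/

theorem depolarizeQubit_add {n : ℕ} (γ : ℝ) (j : Fin n) (A B : Op n) :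
    depolarizeQubit γ j (A + B) = depolarizeQubit γ j A + depolarizeQubit γ j B := by
  ext x y
  simp only [depolarizeQubit, mixQubit, Matrix.add_apply, Matrix.smul_apply, Matrix.of_apply,
    smul_eq_mul, Finset.sum_add_distrib]
  split_ifs <;> ring

theorem depolarizeQubit_smul {n : ℕ} (γ : ℝ) (j : Fin n) (c : ℂ) (A : Op n) :
    depolarizeQubit γ j (c • A) = c • depolarizeQubit γ j A := by
  ext x y
  simp only [depolarizeQubit, mixQubit, Matrix.add_apply, Matrix.smul_apply, Matrix.of_apply,
    smul_eq_mul, ← Finset.mul_sum]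
  split_ifs <;> ring

theorem pauli1_trace (a : Fin 4) :
    pauli1 a 0 0 + pauli1 a 1 1 = if a = 0 then 2 else 0 := by
  fin_cases a <;> simp [pauli1] <;> norm_num

/-- The partial trace sees only the letter at `j`, and the letters other than the identity are
traceless. -/
theorem mixQubit_toOp {n : ℕ} (j : Fin n) (P : PauliString n) :
    mixQubit j P.toOp = if P j = 0 then P.toOp else 0 := by
  ext x y
  have key : ∀ b : Fin 2, P.toOp (Function.update x j b) (Function.update y j b) =
      pauli1 (P j) b b * ∏ i ∈ Finset.univ.erase j, pauli1 (P i) (x i) (y i) := fun b => by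
    rw [PauliString.toOp_apply, ← Finset.mul_prod_erase _ _ (Finset.mem_univ j)]
    simp only [Function.update_self]
    congr 1
    refine Finset.prod_congr rfl fun i hi => ?_
    rw [Function.update_of_ne (Finset.ne_of_mem_erase hi),
      Function.update_of_ne (Finset.ne_of_mem_erase hi)]
  simp only [mixQubit, Matrix.of_apply, key, Fin.sum_univ_two, ← add_mul, pauli1_trace]
  by_cases hP : P j = 0
  · rw [if_pos hP, if_pos hP, PauliString.toOp_apply,
      ← Finset.mul_prod_erase _ _ (Finset.mem_univ j), hP, pauli1_zero_apply]
    split_ifs <;> ring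
  · simp [hP]

theorem depolarizeQubit_toOp {n : ℕ} (γ : ℝ) (j : Fin n) (P : PauliString n) :
    depolarizeQubit γ j P.toOp = (if P j = 0 then 1 else (Real.exp (-γ) : ℂ)) • P.toOp := by
  rw [depolarizeQubit, mixQubit_toOp]
  split_ifs
  · rw [← add_smul]; congr 1; ring
  · rw [smul_zero, add_zero]

/-- The noise as a linear map. -/
def depolarizeLin {n : ℕ} (γ : ℝ) : Op n →ₗ[ℂ] Op n where
  toFun := depolarize γ
  map_add' A B := by
    unfold depolarize
    induction List.finRange n with
    | nil => rfl
    | cons j l ih => rw [List.foldr_cons, ih, depolarizeQubit_add]; rfl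
  map_smul' c A := by
    unfold depolarize
    induction List.finRange n with
    | nil => rfl
    | cons j l ih => rw [List.foldr_cons, ih, depolarizeQubit_smul]; rfl

@[simp] theorem depolarizeLin_apply {n : ℕ} (γ : ℝ) (A : Op n) :
    depolarizeLin γ A = depolarize γ A := rfl

/-- Each non-identity letter contributes one factor e^{-γ}. The noise is used later only in this
diagonal form. -/
theorem depolarize_toOp {n : ℕ} (γ : ℝ) (P : PauliString n) :
    depolarize γ P.toOp = (Real.exp (-γ * P.weight) : ℂ) • P.toOp := by
  have h : ∀ l : List (Fin n), l.foldr (depolarizeQubit γ) P.toOp =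
      (l.map fun j => if P j = 0 then (1 : ℂ) else (Real.exp (-γ) : ℂ)).prod • P.toOp := by
    intro l
    induction l with
    | nil => simp
    | cons j l ih =>
      rw [List.foldr_cons, ih, depolarizeQubit_smul, depolarizeQubit_toOp, smul_smul,
        List.map_cons, List.prod_cons, mul_comm]
  rw [depolarize, h]
  congr 1
  rw [← List.ofFn_eq_map, List.prod_ofFn, Finset.prod_ite, Finset.prod_const_one, one_mul,
    Finset.prod_const, ← Complex.ofReal_pow, ← Real.exp_nat_mul, PauliString.weight]
  congr 2
  ring

theorem pauliCoeff_depolarize {n : ℕ} (γ : ℝ) (A : Op n) (P : PauliString n) :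
    pauliCoeff (depolarize γ A) P = (Real.exp (-γ * P.weight) : ℂ) * pauliCoeff A P := by
  conv_lhs => rw [← sum_pauliCoeff_smul A, ← depolarizeLin_apply, map_sum]
  rw [pauliCoeff_sum, Finset.sum_eq_single P]
  · rw [map_smul, depolarizeLin_apply, depolarize_toOp, pauliCoeff_smul, pauliCoeff_smul,
      pauliCoeff_toOp, if_pos rfl]
    ring
  · intro Q _ hQ
    rw [map_smul, depolarizeLin_apply, depolarize_toOp, pauliCoeff_smul, pauliCoeff_smul,
      pauliCoeff_toOp, if_neg hQ]
    ring
  · simp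

/-! ## Gates and layers -/

/-- Basis states that agree with `x` off the two qubits are parametrized by their two bits there,
which reduces products with a gate to sums over four indices. -/
theorem sum_gate_block {n : ℕ} {i j : Fin n} (hij : i ≠ j) (x : Fin n → Fin 2)
    (f : (Fin n → Fin 2) → ℂ) :
    (∑ z, if (∀ k, k ≠ i → k ≠ j → z k = x k) then f z else 0) =
      ∑ b : Fin 2 × Fin 2, f (Function.update (Function.update x i b.1) j b.2) := by
  rw [← Finset.sum_filter]
  refine Finset.sum_bij' (fun z _ => (z i, z j))
    (fun b _ => Function.update (Function.update x i b.1) j b.2) ?_ ?_ ?_ ?_ ?_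
  · simp
  · intro b _
    simp only [Finset.mem_filter, Finset.mem_univ, true_and]
    intro k hki hkj
    rw [Function.update_of_ne hkj, Function.update_of_ne hki]
  · intro z hz
    simp only [Finset.mem_filter, Finset.mem_univ, true_and] at hz
    funext k
    by_cases hkj : k = j
    · subst hkj; simp
    · by_cases hki : k = i
      · subst hki; simp [hkj]
      · rw [Function.update_of_ne hkj, Function.update_of_ne hki, hz k hki hkj]
  · intro b _
    simp [Function.update_of_ne hij]
  · intro z hz
    simp only [Finset.mem_filter, Finset.mem_univ, true_and] at hz
    congr 1
    funext k
    by_cases hkj : k = j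
    · subst hkj; simp
    · by_cases hki : k = i
      · subst hki; simp [hkj]
      · rw [Function.update_of_ne hkj, Function.update_of_ne hki, hz k hki hkj]

/-- The two-qubit Pauli operator with the given letters. -/
def pauli2 (a : Fin 4 × Fin 4) : Matrix (Fin 2 × Fin 2) (Fin 2 × Fin 2) ℂ :=
  Matrix.of fun x y => pauli1 a.1 x.1 y.1 * pauli1 a.2 x.2 y.2

/-- The transition amplitude of a two-qubit gate. -/
def amplitude2 (V : Matrix (Fin 2 × Fin 2) (Fin 2 × Fin 2) ℂ) (a b : Fin 4 × Fin 4) : ℂ :=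
  Matrix.trace (pauli2 b * Vᴴ * pauli2 a * V) / 4

theorem sum_pauli2_smul (A : Matrix (Fin 2 × Fin 2) (Fin 2 × Fin 2) ℂ) :
    ∑ b, (Matrix.trace (pauli2 b * A) / 4) • pauli2 b = A := by
  have hc : ∀ x y z w : Fin 2 × Fin 2, ∑ b, pauli2 b x y * pauli2 b z w =
      if x = w ∧ y = z then 4 else 0 := fun x y z w => by
    have : ∀ b : Fin 4 × Fin 4, pauli2 b x y * pauli2 b z w =
        (pauli1 b.1 x.1 y.1 * pauli1 b.1 z.1 w.1) * (pauli1 b.2 x.2 y.2 * pauli1 b.2 z.2 w.2) :=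
      fun b => by simp only [pauli2, Matrix.of_apply]; ring
    simp only [this]
    rw [Fintype.sum_prod_type]
    simp only [← Finset.mul_sum, ← Finset.sum_mul, pauli1_completeness, Prod.ext_iff]
    by_cases h1 : x.1 = w.1 <;> by_cases h2 : y.1 = z.1 <;> by_cases h3 : x.2 = w.2 <;>
      by_cases h4 : y.2 = z.2 <;> simp [h1, h2, h3, h4] <;> norm_num
  ext z w
  simp only [Matrix.sum_apply, Matrix.smul_apply, smul_eq_mul, Matrix.trace, Matrix.diag_apply,
    Matrix.mul_apply]
  have h : ∀ b, (∑ x, ∑ y, pauli2 b x y * A y x) / 4 * pauli2 b z w =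
      ∑ x, ∑ y, A y x / 4 * (pauli2 b x y * pauli2 b z w) := fun b => by
    rw [div_mul_eq_mul_div, Finset.sum_mul, Finset.sum_div]
    refine Finset.sum_congr rfl fun x _ => ?_
    rw [Finset.sum_mul, Finset.sum_div]
    exact Finset.sum_congr rfl fun y _ => by ring
  simp only [h]
  rw [Finset.sum_comm]
  have h2 : ∀ x, ∑ b, ∑ y, A y x / 4 * (pauli2 b x y * pauli2 b z w) =
      ∑ y, A y x / 4 * if x = w ∧ y = z then 4 else 0 := fun x => by
    rw [Finset.sum_comm]
    exact Finset.sum_congr rfl fun y _ => by rw [← Finset.mul_sum, hc]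
  simp only [h2]
  rw [Finset.sum_eq_single w, Finset.sum_eq_single z] <;> simp +contextual

/-- Replace the letters of a Pauli string at two positions. -/
def PauliString.setPair {n : ℕ} (P : PauliString n) (i j : Fin n) (b : Fin 4 × Fin 4) :
    PauliString n :=
  Function.update (Function.update P i b.1) j b.2

theorem PauliString.setPair_apply_left {n : ℕ} (P : PauliString n) {i j : Fin n} (h : i ≠ j)
    (b : Fin 4 × Fin 4) : P.setPair i j b i = b.1 := by
  simp [PauliString.setPair, Function.update_of_ne h]

theorem PauliString.setPair_apply_right {n : ℕ} (P : PauliString n) (i j : Fin n)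
    (b : Fin 4 × Fin 4) : P.setPair i j b j = b.2 := by
  simp [PauliString.setPair]

theorem PauliString.setPair_apply_of_ne {n : ℕ} (P : PauliString n) {i j k : Fin n}
    (hi : k ≠ i) (hj : k ≠ j) (b : Fin 4 × Fin 4) : P.setPair i j b k = P k := by
  simp [PauliString.setPair, Function.update_of_ne hi, Function.update_of_ne hj]

theorem prod_eq_pair_mul {n : ℕ} {i j : Fin n} (hij : i ≠ j) (f : Fin n → ℂ) :
    ∏ k, f k = f i * f j * ∏ k ∈ (Finset.univ.erase i).erase j, f k := by
  rw [mul_assoc, Finset.mul_prod_erase _ _ (Finset.mem_erase.2 ⟨hij.symm, Finset.mem_univ j⟩),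
    Finset.mul_prod_erase _ _ (Finset.mem_univ i)]

theorem Gate.conjTranspose_toOp_apply {n : ℕ} (g : Gate n) (x y : Fin n → Fin 2) :
    g.toOpᴴ x y = if ∀ k, k ≠ g.q₁ → k ≠ g.q₂ → y k = x k then
      star (g.mat (y g.q₁, y g.q₂) (x g.q₁, x g.q₂)) else 0 := by
  rw [Matrix.conjTranspose_apply, Gate.toOp, Matrix.of_apply]
  split_ifs <;> simp

/-- The letters off the gate enter every matrix entry through the same factor `c`; what remains is
the expansion of a 4 × 4 matrix in the two-qubit Pauli basis. -/
theorem Gate.conj_toOp {n : ℕ} (g : Gate n) (P : PauliString n) :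
    g.toOpᴴ * P.toOp * g.toOp =
      ∑ b, amplitude2 g.mat (P g.q₁, P g.q₂) b • (P.setPair g.q₁ g.q₂ b).toOp := by
  ext x y
  set c : ℂ := ∏ k ∈ (Finset.univ.erase g.q₁).erase g.q₂, pauli1 (P k) (x k) (y k) with hc
  have hP : ∀ a b : Fin 2 × Fin 2,
      P.toOp (Function.update (Function.update x g.q₁ a.1) g.q₂ a.2)
        (Function.update (Function.update y g.q₁ b.1) g.q₂ b.2) =
      pauli2 (P g.q₁, P g.q₂) a b * c := fun a b => by
    rw [PauliString.toOp_apply, prod_eq_pair_mul g.ne]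
    simp only [Function.update_self, Function.update_of_ne g.ne, pauli2, Matrix.of_apply, hc]
    congr 1
    refine Finset.prod_congr rfl fun k hk => ?_
    simp only [Finset.mem_erase] at hk
    simp only [Function.update_of_ne hk.1, Function.update_of_ne hk.2.1]
  have hQ : ∀ b, (P.setPair g.q₁ g.q₂ b).toOp x y =
      pauli2 b (x g.q₁, x g.q₂) (y g.q₁, y g.q₂) * c := fun b => by
    rw [PauliString.toOp_apply, prod_eq_pair_mul g.ne, PauliString.setPair_apply_left _ g.ne,
      PauliString.setPair_apply_right]
    simp only [pauli2, Matrix.of_apply, hc]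
    congr 1
    refine Finset.prod_congr rfl fun k hk => ?_
    simp only [Finset.mem_erase] at hk
    rw [PauliString.setPair_apply_of_ne _ hk.2.1 hk.1]
  have hL : (g.toOpᴴ * P.toOp * g.toOp) x y =
      (g.matᴴ * pauli2 (P g.q₁, P g.q₂) * g.mat) (x g.q₁, x g.q₂) (y g.q₁, y g.q₂) * c := by
    simp only [Matrix.mul_apply, Gate.conjTranspose_toOp_apply, ite_mul, zero_mul]
    have h1 : ∀ w, (∑ z, if ∀ k, k ≠ g.q₁ → k ≠ g.q₂ → z k = x k then
        star (g.mat (z g.q₁, z g.q₂) (x g.q₁, x g.q₂)) * P.toOp z w else 0) * g.toOp w y =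
        if ∀ k, k ≠ g.q₁ → k ≠ g.q₂ → w k = y k then
          (∑ a : Fin 2 × Fin 2, star (g.mat a (x g.q₁, x g.q₂)) *
            P.toOp (Function.update (Function.update x g.q₁ a.1) g.q₂ a.2) w) *
            g.mat (w g.q₁, w g.q₂) (y g.q₁, y g.q₂) else 0 := fun w => by
      rw [sum_gate_block g.ne x fun z =>
        star (g.mat (z g.q₁, z g.q₂) (x g.q₁, x g.q₂)) * P.toOp z w, Gate.toOp, Matrix.of_apply]
      simp only [Function.update_self, Function.update_of_ne g.ne]
      split_ifs <;> simp
    simp only [h1]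
    rw [sum_gate_block g.ne y fun w => (∑ a : Fin 2 × Fin 2, star (g.mat a (x g.q₁, x g.q₂)) *
            P.toOp (Function.update (Function.update x g.q₁ a.1) g.q₂ a.2) w) *
            g.mat (w g.q₁, w g.q₂) (y g.q₁, y g.q₂)]
    simp only [Function.update_self, Function.update_of_ne g.ne, hP,
      Matrix.conjTranspose_apply, Finset.sum_mul]
    exact Finset.sum_congr rfl fun b _ => Finset.sum_congr rfl fun a _ => by ring
  rw [hL, Matrix.sum_apply]
  simp only [Matrix.smul_apply, smul_eq_mul, hQ, ← mul_assoc, ← Finset.sum_mul]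
  congr 1
  conv_lhs => rw [← sum_pauli2_smul (g.matᴴ * pauli2 (P g.q₁, P g.q₂) * g.mat)]
  rw [Matrix.sum_apply]
  exact Finset.sum_congr rfl fun b _ => by
    simp only [Matrix.smul_apply, smul_eq_mul, amplitude2, mul_assoc]

theorem pauli2_zero : pauli2 (0, 0) = 1 := by
  ext x y
  simp only [pauli2, Matrix.of_apply, pauli1_zero_apply, Matrix.one_apply, Prod.ext_iff]
  split_ifs <;> simp_all

theorem trace_pauli2 (b : Fin 4 × Fin 4) :
    Matrix.trace (pauli2 b) / 4 = if b = (0, 0) then 1 else 0 := by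
  simp only [Matrix.trace, Matrix.diag_apply, pauli2, Matrix.of_apply]
  rw [Fintype.sum_prod_type]
  simp only [← Finset.mul_sum, ← Finset.sum_mul, Fin.sum_univ_two, pauli1_trace, Prod.ext_iff]
  by_cases h1 : b.1 = 0 <;> by_cases h2 : b.2 = 0 <;> simp [h1, h2] <;> norm_num

/-- Unitarity fixes the identity. This is why a gate that meets two identity letters causes no
branching. -/
theorem Gate.amplitude2_zero {n : ℕ} (g : Gate n) (b : Fin 4 × Fin 4) :
    amplitude2 g.mat (0, 0) b = if b = (0, 0) then 1 else 0 := by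
  have h : g.matᴴ * g.mat = 1 := (Matrix.mem_unitaryGroup_iff').1 g.unitary
  rw [amplitude2, pauli2_zero, mul_one, mul_assoc, h, mul_one, trace_pauli2]

theorem PauliString.setPair_self {n : ℕ} (P : PauliString n) (i j : Fin n) :
    P.setPair i j (P i, P j) = P := by
  simp [PauliString.setPair]

theorem Gate.unitary_toOp {n : ℕ} (g : Gate n) : g.toOpᴴ * g.toOp = 1 := by
  -- For the identity string, the conjugation formula has a single nonzero amplitude, and so already
  -- expresses unitarity.
  have h := g.conj_toOp 0
  rw [PauliString.toOp_zero, mul_one] at h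
  rw [h]
  simp only [Pi.zero_apply, g.amplitude2_zero, ite_smul, one_smul, zero_smul,
    Finset.sum_ite_eq', Finset.mem_univ, if_true]
  exact (congrArg PauliString.toOp (PauliString.setPair_self 0 g.q₁ g.q₂)).trans
    PauliString.toOp_zero

theorem Layer.unitary_toOp {n : ℕ} (U : Layer n) : U.toOpᴴ * U.toOp = 1 := by
  unfold Layer.toOp
  induction U.gates with
  | nil => simp
  | cons g l ih =>
    rw [List.map_cons, List.prod_cons, Matrix.conjTranspose_mul, mul_assoc, ← mul_assoc g.toOpᴴ,
      g.unitary_toOp, one_mul, ih]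

/-! ## Heisenberg evolution in the Pauli basis -/

theorem Layer.toOp_unitary' {n : ℕ} (U : Layer n) : U.toOp * U.toOpᴴ = 1 :=
  mul_eq_one_comm.1 U.unitary_toOp

/-- Conjugation by the unitary of a layer. -/
def Layer.conj {n : ℕ} (U : Layer n) : Op n →ₗ[ℂ] Op n where
  toFun A := U.toOpᴴ * A * U.toOp
  map_add' A B := by rw [mul_add, add_mul]
  map_smul' c A := by simp

theorem Layer.conj_apply {n : ℕ} (U : Layer n) (A : Op n) :
    U.conj A = U.toOpᴴ * A * U.toOp := rfl

theorem Layer.conj_one {n : ℕ} (U : Layer n) : U.conj 1 = 1 := by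
  rw [U.conj_apply, mul_one, U.unitary_toOp]

theorem pauliCoeff_conj {n : ℕ} (U : Layer n) (P Q : PauliString n) :
    pauliCoeff (U.conj P.toOp) Q = amplitude U P Q := by
  rw [pauliCoeff, amplitude, U.conj_apply, Matrix.trace_mul_comm]
  simp only [mul_assoc]

theorem Layer.frobSq_conj {n : ℕ} (U : Layer n) (A : Op n) : frobSq (U.conj A) = frobSq A := by
  have : (U.conj A)ᴴ * U.conj A = U.toOpᴴ * (Aᴴ * A * U.toOp) := by
    rw [U.conj_apply]
    simp only [Matrix.conjTranspose_mul, Matrix.conjTranspose_conjTranspose, mul_assoc]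
    rw [← mul_assoc U.toOp U.toOpᴴ, U.toOp_unitary', one_mul]
  rw [frobSq, this, Matrix.trace_mul_comm, mul_assoc, U.toOp_unitary', mul_one, frobSq]

theorem pauliCoeff_zero {n : ℕ} (A : Op n) : pauliCoeff A 0 = Matrix.trace A / 2 ^ n := by
  rw [pauliCoeff, PauliString.toOp_zero, mul_one]

theorem Layer.pauliCoeff_conj_zero {n : ℕ} (U : Layer n) (A : Op n) :
    pauliCoeff (U.conj A) 0 = pauliCoeff A 0 := by
  rw [pauliCoeff_zero, pauliCoeff_zero, U.conj_apply, Matrix.trace_mul_comm, ← mul_assoc,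
    U.toOp_unitary', one_mul]

theorem PauliString.weight_eq_zero {n : ℕ} {P : PauliString n} : P.weight = 0 ↔ P = 0 := by
  rw [PauliString.weight, Finset.card_eq_zero, Finset.filter_eq_empty_iff]
  simp [funext_iff]

/-- The Heisenberg evolution as a linear map. -/
def heisenbergLin {n : ℕ} (γ : ℝ) : Circuit n → Op n →ₗ[ℂ] Op n
  | [] => depolarizeLin γ
  | U :: L => heisenbergLin γ L ∘ₗ U.conj ∘ₗ depolarizeLin γ

theorem heisenbergLin_apply {n : ℕ} (γ : ℝ) (L : Circuit n) (A : Op n) :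
    heisenbergLin γ L A = heisenberg γ L A := by
  induction L generalizing A with
  | nil => rfl
  | cons U L ih => exact ih _

theorem depolarize_one {n : ℕ} (γ : ℝ) : depolarize γ (1 : Op n) = 1 := by
  have h := depolarize_toOp γ (0 : PauliString n)
  rw [PauliString.toOp_zero, PauliString.weight_eq_zero.2 rfl] at h
  simpa using h

theorem heisenbergLin_one {n : ℕ} (γ : ℝ) (L : Circuit n) : heisenbergLin γ L 1 = 1 := by
  induction L with
  | nil => exact depolarize_one γ
  | cons U L ih =>
    rw [heisenbergLin, LinearMap.comp_apply, LinearMap.comp_apply, depolarizeLin_apply,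
      depolarize_one, U.conj_one, ih]

/-- Every coefficient that is present is damped by at least e^{-γk}. -/
theorem frobSq_depolarize_le {n : ℕ} {γ : ℝ} (hγ : 0 ≤ γ) (k : ℕ) (A : Op n)
    (hA : ∀ P, pauliCoeff A P ≠ 0 → k ≤ PauliString.weight P) :
    frobSq (depolarize γ A) ≤ Real.exp (-2 * γ * k) * frobSq A := by
  rw [frobSq_eq_sum, frobSq_eq_sum, Finset.mul_sum]
  refine Finset.sum_le_sum fun P _ => ?_
  rw [pauliCoeff_depolarize, norm_mul, mul_pow, Complex.norm_real, Real.norm_eq_abs, Real.abs_exp]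
  by_cases h : pauliCoeff A P = 0
  · simp [h]
  · refine mul_le_mul_of_nonneg_right ?_ (by positivity)
    rw [← Real.exp_nat_mul]
    apply Real.exp_le_exp.2
    have : (k : ℝ) ≤ P.weight := by exact_mod_cast hA P h
    push_cast
    nlinarith

theorem PauliString.one_le_weight {n : ℕ} {P : PauliString n} (h : P ≠ 0) : 1 ≤ P.weight :=
  Nat.one_le_iff_ne_zero.2 fun h' => h (PauliString.weight_eq_zero.1 h')

/-- Noise and layers keep a traceless operator traceless, so each round of noise acts on weights at
least one. There is one round more than there are layers. -/
theorem frobSq_heisenbergLin_le {n : ℕ} {γ : ℝ} (hγ : 0 ≤ γ) (L : Circuit n) (A : Op n)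
    (hA : pauliCoeff A 0 = 0) :
    frobSq (heisenbergLin γ L A) ≤ Real.exp (-2 * γ * (L.length + 1 : ℕ)) * frobSq A := by
  have hw : ∀ P, pauliCoeff A P ≠ 0 → 1 ≤ PauliString.weight P := fun P hP =>
    PauliString.one_le_weight fun h => hP (h ▸ hA)
  have h1 := frobSq_depolarize_le hγ 1 A hw
  induction L generalizing A with
  | nil => simpa [heisenbergLin] using h1
  | cons U L ih =>
    have h0 : pauliCoeff (U.conj (depolarize γ A)) 0 = 0 := by
      rw [U.pauliCoeff_conj_zero, pauliCoeff_depolarize, hA, mul_zero]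
    have hw' : ∀ P, pauliCoeff (U.conj (depolarize γ A)) P ≠ 0 → 1 ≤ PauliString.weight P :=
      fun P hP => PauliString.one_le_weight fun h => hP (h ▸ h0)
    have := ih _ h0 hw' (frobSq_depolarize_le hγ 1 _ hw')
    rw [U.frobSq_conj] at this
    refine (this.trans (mul_le_mul_of_nonneg_left h1 (Real.exp_nonneg _))).trans (le_of_eq ?_)
    rw [← mul_assoc, ← Real.exp_add, List.length_cons]
    congr 2
    push_cast
    ring

theorem exp_mul_eq (γ : ℝ) (a b : ℕ) :
    (Real.exp (-γ * (a + b : ℕ)) : ℂ) = (Real.exp (-γ * a) : ℂ) * (Real.exp (-γ * b) : ℂ) := by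
  rw [← Complex.ofReal_mul, ← Real.exp_add]
  congr 2
  push_cast
  ring

theorem truncated_nil {n : ℕ} (γ : ℝ) (ℓ : ℕ) (O : Op n) :
    truncated γ ℓ [] O = ∑ P : PauliString n with P.weight ≤ ℓ,
      ((Real.exp (-γ * P.weight) : ℂ) * pauliCoeff O P) • P.toOp := by
  rw [truncated, Finset.sum_filter, Finset.sum_filter]
  refine Fintype.sum_equiv (Equiv.funUnique (Fin 1) (PauliString n)) _ _ fun P => ?_
  have hw : PauliPath.weight P = PauliString.weight (P 0) := by simp [PauliPath.weight]
  simp [hw]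

theorem PauliPath.weight_cons {n d : ℕ} (P : PauliString n) (p : PauliPath n d) :
    PauliPath.weight (Fin.cons P p : PauliPath n (d + 1)) = P.weight + p.weight := by
  rw [PauliPath.weight, Fin.sum_univ_succ]
  rfl

/-- Splitting off the first string leaves a path through the remaining circuit whose budget is
reduced by the weight of that string. The error analysis is an induction along this recursion. -/
theorem truncated_cons {n : ℕ} (γ : ℝ) (ℓ : ℕ) (U : Layer n) (L : Circuit n) (O : Op n) :
    truncated γ ℓ (U :: L) O = ∑ P : PauliString n with P.weight ≤ ℓ,
      ((Real.exp (-γ * P.weight) : ℂ) * pauliCoeff O P) •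
        truncated γ (ℓ - P.weight) L (U.conj P.toOp) := by
  simp only [truncated, Finset.sum_filter, List.length_cons]
  rw [← (Fin.consEquiv (fun _ : Fin (L.length + 2) => PauliString n)).sum_comp,
    Fintype.sum_prod_type]
  refine Finset.sum_congr rfl fun P _ => ?_
  have hc : ∀ p : PauliPath n L.length,
      PauliPath.weight (Fin.consEquiv (fun _ : Fin (L.length + 2) => PauliString n) (P, p)) =
        P.weight + p.weight := fun p => PauliPath.weight_cons P p
  by_cases hP : P.weight ≤ ℓ
  · rw [if_pos hP, Finset.smul_sum]
    refine Finset.sum_congr rfl fun p _ => ?_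
    have hi : P.weight + PauliPath.weight p ≤ ℓ ↔ PauliPath.weight p ≤ ℓ - P.weight := by omega
    rw [hc p]
    simp only [hi, Fin.consEquiv_apply]
    by_cases hp : PauliPath.weight p ≤ ℓ - P.weight
    · rw [if_pos hp, if_pos hp, smul_smul, exp_mul_eq, pauliCoeff_conj,
        Fin.prod_univ_succ]
      congr 1
      simp only [Fin.cons_zero, Fin.castSucc_zero, Fin.cons_succ, Fin.castSucc_succ,
        List.get_cons_zero, Fin.succ_zero_eq_one]
      have h1 : (Fin.cons P p : PauliPath n (L.length + 1)) 1 = p 0 := rfl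
      rw [h1]
      simp only [List.get_eq_getElem, Fin.val_succ, List.getElem_cons_succ]
      ring
    · rw [if_neg hp, if_neg hp, smul_zero]
  · rw [if_neg hP]
    refine Finset.sum_eq_zero fun p _ => if_neg ?_
    rw [hc p]
    omega

/-- The truncated evolution as a linear map. -/
def truncatedLin {n : ℕ} (γ : ℝ) (ℓ : ℕ) (L : Circuit n) : Op n →ₗ[ℂ] Op n where
  toFun := truncated γ ℓ L
  map_add' A B := by
    simp only [truncated, pauliCoeff_add, ← Finset.sum_add_distrib, ← add_smul]
    exact Finset.sum_congr rfl fun P _ => by ring_nf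
  map_smul' c A := by
    simp only [truncated, pauliCoeff_smul, Finset.smul_sum, smul_smul, RingHom.id_apply]
    exact Finset.sum_congr rfl fun P _ => by ring_nf

theorem truncatedLin_apply {n : ℕ} (γ : ℝ) (ℓ : ℕ) (L : Circuit n) (A : Op n) :
    truncatedLin γ ℓ L A = truncated γ ℓ L A := rfl

/-- A contributing path would consist of non-identity strings only, one more than there are layers,
which exceeds the budget. -/
theorem truncated_eq_zero {n : ℕ} (γ : ℝ) {ℓ : ℕ} (L : Circuit n) (hℓ : ℓ ≤ L.length) (A : Op n)
    (hA : pauliCoeff A 0 = 0) : truncated γ ℓ L A = 0 := by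
  induction L generalizing ℓ A with
  | nil =>
    rw [truncated_nil]
    refine Finset.sum_eq_zero fun P hP => ?_
    have h0 : P = 0 := by
      simp only [Finset.mem_filter, Finset.mem_univ, true_and] at hP
      exact PauliString.weight_eq_zero.1 (Nat.le_zero.1 (hP.trans hℓ))
    rw [h0, hA, mul_zero, zero_smul]
  | cons U L ih =>
    rw [truncated_cons]
    refine Finset.sum_eq_zero fun P hP => ?_
    by_cases h0 : P = 0
    · rw [h0, hA, mul_zero, zero_smul]
    · rw [ih, smul_zero]
      · have := PauliString.one_le_weight h0
        rw [List.length_cons] at hℓ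
        omega
      · rw [U.pauliCoeff_conj_zero, pauliCoeff_toOp, if_neg h0]

theorem pauliCoeff_one {n : ℕ} (P : PauliString n) :
    pauliCoeff 1 P = if P = 0 then 1 else 0 := by
  rw [← PauliString.toOp_zero, pauliCoeff_toOp]
  simp only [eq_comm]

theorem truncated_one {n : ℕ} (γ : ℝ) (ℓ : ℕ) (L : Circuit n) : truncated γ ℓ L 1 = 1 := by
  induction L generalizing ℓ with
  | nil =>
    rw [truncated_nil, Finset.sum_eq_single 0]
    · simp [pauliCoeff_one, PauliString.weight_eq_zero.2, PauliString.toOp_zero]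
    · intro P _ hP
      rw [pauliCoeff_one, if_neg hP, mul_zero, zero_smul]
    · simp [PauliString.weight_eq_zero.2]
  | cons U L ih =>
    rw [truncated_cons, Finset.sum_eq_single 0]
    · simp [pauliCoeff_one, PauliString.weight_eq_zero.2, PauliString.toOp_zero, U.conj_one, ih]
    · intro P _ hP
      rw [pauliCoeff_one, if_neg hP, mul_zero, zero_smul]
    · simp [PauliString.weight_eq_zero.2]

/-- Only the path of identities has weight zero. The result is independent of the circuit, which
will allow replacing a deep circuit by the empty one. -/
theorem truncated_zero {n : ℕ} (γ : ℝ) (L : Circuit n) (O : Op n) :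
    truncated γ 0 L O = pauliCoeff O 0 • (1 : Op n) := by
  have h : O = pauliCoeff O 0 • 1 + (O - pauliCoeff O 0 • 1) := by abel
  have h0 : pauliCoeff (O - pauliCoeff O 0 • 1) 0 = 0 := by
    rw [sub_eq_add_neg, ← neg_smul, pauliCoeff_add, pauliCoeff_smul, pauliCoeff_one]
    simp
  conv_lhs => rw [h, ← truncatedLin_apply, map_add, map_smul, truncatedLin_apply,
    truncatedLin_apply, truncated_one, truncated_eq_zero γ L (Nat.zero_le _) _ h0, add_zero]

/-! ## Accuracy of the truncation -/

/-- The error of the truncation as a linear map. -/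
def errorLin {n : ℕ} (γ : ℝ) (ℓ : ℕ) (L : Circuit n) : Op n →ₗ[ℂ] Op n :=
  heisenbergLin γ L - truncatedLin γ ℓ L

theorem errorLin_apply {n : ℕ} (γ : ℝ) (ℓ : ℕ) (L : Circuit n) (A : Op n) :
    errorLin γ ℓ L A = heisenberg γ L A - truncated γ ℓ L A := by
  rw [errorLin, LinearMap.sub_apply, heisenbergLin_apply, truncatedLin_apply]

theorem errorLin_of_le {n : ℕ} (γ : ℝ) {ℓ : ℕ} (L : Circuit n) (hℓ : ℓ ≤ L.length) (A : Op n)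
    (hA : pauliCoeff A 0 = 0) : errorLin γ ℓ L A = heisenbergLin γ L A := by
  rw [errorLin, LinearMap.sub_apply, truncatedLin_apply, truncated_eq_zero γ L hℓ A hA, sub_zero]

theorem errorLin_one {n : ℕ} (γ : ℝ) (ℓ : ℕ) (L : Circuit n) : errorLin γ ℓ L 1 = 0 := by
  rw [errorLin, LinearMap.sub_apply, truncatedLin_apply, truncated_one, heisenbergLin_one, sub_self]

/-- The part of an operator on the Pauli strings satisfying `p`. -/
def pauliPart {n : ℕ} (p : PauliString n → Prop) [DecidablePred p] (A : Op n) : Op n :=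
  ∑ P with p P, pauliCoeff A P • P.toOp

theorem pauliCoeff_pauliPart {n : ℕ} (p : PauliString n → Prop) [DecidablePred p] (A : Op n)
    (Q : PauliString n) :
    pauliCoeff (pauliPart p A) Q = if p Q then pauliCoeff A Q else 0 := by
  rw [pauliPart, pauliCoeff_sum]
  simp only [pauliCoeff_smul, pauliCoeff_toOp, mul_ite, mul_one, mul_zero]
  rw [Finset.sum_ite_eq']
  simp

theorem frobSq_pauliPart {n : ℕ} (p : PauliString n → Prop) [DecidablePred p] (A : Op n) :
    frobSq (pauliPart p A) = ∑ P with p P, ‖pauliCoeff A P‖ ^ 2 := by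
  rw [frobSq_eq_sum, Finset.sum_filter]
  refine Finset.sum_congr rfl fun P _ => ?_
  rw [pauliCoeff_pauliPart]
  split_ifs <;> simp

/-- A first string heavier than the budget begins no retained path, so its whole evolution counts as
error. -/
theorem errorLin_cons {n : ℕ} (γ : ℝ) (ℓ : ℕ) (U : Layer n) (L : Circuit n) (O : Op n) :
    errorLin γ ℓ (U :: L) O = ∑ P, (Real.exp (-γ * P.weight) : ℂ) • pauliCoeff O P •
      (if P.weight ≤ ℓ then errorLin γ (ℓ - P.weight) L (U.conj P.toOp)
        else heisenbergLin γ L (U.conj P.toOp)) := by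
  have h1 : heisenbergLin γ (U :: L) O = ∑ P, (Real.exp (-γ * P.weight) : ℂ) •
      pauliCoeff O P • heisenbergLin γ L (U.conj P.toOp) := by
    conv_lhs => rw [← sum_pauliCoeff_smul O, map_sum]
    refine Finset.sum_congr rfl fun P _ => ?_
    rw [map_smul, heisenbergLin, LinearMap.comp_apply, LinearMap.comp_apply, depolarizeLin_apply,
      depolarize_toOp, map_smul, map_smul, smul_comm]
  rw [errorLin, LinearMap.sub_apply, h1, truncatedLin_apply, truncated_cons, Finset.sum_filter,
    ← Finset.sum_sub_distrib]
  refine Finset.sum_congr rfl fun P _ => ?_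
  split_ifs
  · rw [errorLin, LinearMap.sub_apply, smul_sub, smul_sub, smul_smul _ _ (truncatedLin _ _ _ _)]
    rfl
  · rw [sub_zero]

/-- A weighted Cauchy-Schwarz inequality that needs no orthogonality. In its use, `f` carries the
combinatorial constants and `g` the norms of the classes. -/
theorem norm_sq_sum_le {ι E : Type*} [SeminormedAddCommGroup E] (s : Finset ι) (x : ι → E)
    (f g : ι → ℝ) (hf : ∀ i ∈ s, 0 ≤ f i) (hg : ∀ i ∈ s, 0 ≤ g i)
    (h : ∀ i ∈ s, ‖x i‖ ^ 2 ≤ f i * g i) : ‖∑ i ∈ s, x i‖ ^ 2 ≤ (∑ i ∈ s, f i) * ∑ i ∈ s, g i :=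
  (pow_le_pow_left₀ (norm_nonneg _) (norm_sum_le _ _) 2).trans
    (Finset.sum_sq_le_sum_mul_sum_of_sq_le_mul s hf hg h)

/-- The hockey-stick identity, reflected by k ↦ ℓ - k. -/
theorem sum_choose_sub (ℓ d : ℕ) (h : d + 1 ≤ ℓ) :
    ∑ k ∈ Finset.Icc 1 (ℓ - d), (ℓ - k).choose d = ℓ.choose (d + 1) := by
  obtain ⟨m, rfl⟩ : ∃ m, ℓ = m + 1 := ⟨ℓ - 1, by omega⟩
  rw [← Nat.sum_Icc_choose]
  refine Finset.sum_nbij' (fun k => m + 1 - k) (fun k => m + 1 - k) ?_ ?_ ?_ ?_ ?_ <;>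
    simp only [Finset.mem_Icc] <;> intros <;> first | omega | trivial

theorem frobSq_errorLin_le {n : ℕ} {γ : ℝ} (hγ : 0 ≤ γ) (L : Circuit n) (ℓ : ℕ)
    (hℓ : L.length ≤ ℓ) (O : Op n) :
    frobSq (errorLin γ ℓ L O) ≤
      (ℓ.choose L.length : ℝ) * Real.exp (-2 * γ * (ℓ + 1)) * frobSq O := by
  induction L generalizing ℓ O with
  | nil =>
    -- Without layers, the error is the noise applied to the components of weight above `ℓ`.
    have h : errorLin γ ℓ [] O =
        depolarize γ (pauliPart (fun P => ℓ + 1 ≤ PauliString.weight P) O) := by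
      apply op_ext
      intro P
      have h0 : errorLin γ ℓ [] O + truncated γ ℓ [] O = depolarize γ O := by
        rw [errorLin_apply]; exact sub_add_cancel _ _
      have h1 := congrArg (fun A => pauliCoeff A P) h0
      simp only [pauliCoeff_add, pauliCoeff_depolarize, truncated_nil, pauliCoeff_sum,
        pauliCoeff_smul, pauliCoeff_toOp, mul_ite, mul_one, mul_zero] at h1
      rw [Finset.sum_ite_eq'] at h1
      rw [pauliCoeff_depolarize, pauliCoeff_pauliPart]
      simp only [Finset.mem_filter, Finset.mem_univ, true_and] at h1
      by_cases hP : P.weight ≤ ℓ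
      · rw [if_pos hP] at h1
        rw [if_neg (by omega)]
        simpa using h1
      · rw [if_neg hP] at h1
        rw [if_pos (by omega)]
        simpa using h1
    rw [h, List.length_nil, Nat.choose_zero_right, Nat.cast_one, one_mul]
    refine (frobSq_depolarize_le hγ (ℓ + 1) _ fun P hP => ?_).trans ?_
    · rw [pauliCoeff_pauliPart] at hP
      by_contra hc
      exact hP (if_neg hc)
    · push_cast
      refine mul_le_mul_of_nonneg_left ?_ (Real.exp_nonneg _)
      rw [frobSq_pauliPart, frobSq_eq_sum]
      exact Finset.sum_le_sum_of_subset_of_nonneg (Finset.filter_subset _ _)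
        fun _ _ _ => by positivity
  | cons U L ih =>
    rw [List.length_cons] at hℓ ⊢
    set d := L.length with hd
    set m := ℓ - d with hm
    -- All weights from `m` on are merged into one class: for them the budget left is at most the
    -- number of remaining layers, so the truncation retains nothing.
    set κ : PauliString n → ℕ := fun P => min P.weight m with hκ
    set X : PauliString n → Op n := fun P => (Real.exp (-γ * P.weight) : ℂ) • pauliCoeff O P •
      (if P.weight ≤ ℓ then errorLin γ (ℓ - P.weight) L (U.conj P.toOp)
        else heisenbergLin γ L (U.conj P.toOp)) with hX
    have hsplit : errorLin γ ℓ (U :: L) O = ∑ k ∈ Finset.Icc 1 m, ∑ P with κ P = k, X P := by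
      rw [errorLin_cons, ← Finset.sum_fiberwise_of_maps_to (s := Finset.univ)
        (t := Finset.range (m + 1)) (g := κ)
        (fun P _ => Finset.mem_range.2 (Nat.lt_succ_of_le (min_le_right _ _)))]
      symm
      refine Finset.sum_subset (fun k hk => ?_) fun k _ hk => ?_
      · simp only [Finset.mem_Icc] at hk
        simp only [Finset.mem_range]
        omega
      -- Here the class is 0, and `m` is positive, so the string is the identity, which is evolved
      -- without error.
      · refine Finset.sum_eq_zero fun P hP => ?_
        simp only [Finset.mem_filter, Finset.mem_univ, true_and, hκ] at hP
        simp only [Finset.mem_Icc] at hk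
        have h0 : P = 0 := PauliString.weight_eq_zero.1 (by omega)
        have hw : PauliString.weight (0 : PauliString n) = 0 := PauliString.weight_eq_zero.2 rfl
        simp only [hX, h0, hw, PauliString.toOp_zero, U.conj_one, errorLin_one, zero_le, if_true,
          smul_zero]
    have hpart : ∀ k ∈ Finset.Icc 1 m, ‖coeffVec n (∑ P with κ P = k, X P)‖ ^ 2 ≤
        ((ℓ - k).choose d * Real.exp (-2 * γ * (ℓ + 1))) *
          ∑ P with κ P = k, ‖pauliCoeff O P‖ ^ 2 := by
      intro k hk
      rw [Finset.mem_Icc] at hk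
      rw [← frobSq_eq_norm_sq, ← frobSq_pauliPart]
      -- Below `m` a class has one exact weight, and the induction hypothesis applies with the
      -- budget ℓ - k. The class `m` is estimated by the full evolution.
      rcases hk.2.lt_or_eq with hlt | heq
      · have he : ∑ P with κ P = k, X P = (Real.exp (-γ * k) : ℂ) •
            errorLin γ (ℓ - k) L (U.conj (pauliPart (fun P => κ P = k) O)) := by
          rw [pauliPart, map_sum, map_sum, Finset.smul_sum]
          refine Finset.sum_congr rfl fun P hP => ?_
          simp only [Finset.mem_filter, Finset.mem_univ, true_and, hκ] at hP
          have hw : P.weight = k := by omega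
          simp only [hX, hw]
          rw [if_pos (by omega), map_smul, map_smul]
        rw [he, frobSq_eq_norm_sq, map_smul, norm_smul, mul_pow, ← frobSq_eq_norm_sq,
          Complex.norm_real, Real.norm_eq_abs, Real.abs_exp, ← Real.exp_nat_mul]
        refine (mul_le_mul_of_nonneg_left (ih (ℓ - k) (by omega) _) (Real.exp_nonneg _)).trans
          (le_of_eq ?_)
        rw [U.frobSq_conj, ← mul_assoc, mul_left_comm, ← Real.exp_add]
        congr 3
        rw [Nat.cast_sub (by omega : k ≤ ℓ)]
        push_cast
        ring
      · have he : ∑ P with κ P = k, X P =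
            heisenbergLin γ L (U.conj (depolarize γ (pauliPart (fun P => κ P = k) O))) := by
          rw [pauliPart, ← depolarizeLin_apply, map_sum, map_sum, map_sum]
          refine Finset.sum_congr rfl fun P hP => ?_
          simp only [Finset.mem_filter, Finset.mem_univ, true_and, hκ] at hP
          have hw : m ≤ P.weight := by omega
          have h0 : pauliCoeff (U.conj P.toOp) 0 = 0 := by
            rw [U.pauliCoeff_conj_zero, pauliCoeff_toOp, if_neg]
            intro h
            have := PauliString.weight_eq_zero.2 h
            omega
          have hE : (if P.weight ≤ ℓ then errorLin γ (ℓ - P.weight) L (U.conj P.toOp)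
              else heisenbergLin γ L (U.conj P.toOp)) = heisenbergLin γ L (U.conj P.toOp) := by
            split_ifs
            · exact errorLin_of_le γ L (by omega) _ h0
            · rfl
          simp only [hX, hE]
          rw [map_smul, depolarizeLin_apply, depolarize_toOp, map_smul, map_smul, map_smul,
            map_smul, smul_comm]
        have hw : ∀ P, pauliCoeff (pauliPart (fun P => κ P = k) O) P ≠ 0 → k ≤ P.weight := by
          intro P hP
          rw [pauliCoeff_pauliPart] at hP
          have : κ P = k := by
            by_contra hc
            exact hP (if_neg hc)
          simp only [hκ] at this
          omega
        rw [he]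
        refine (frobSq_heisenbergLin_le hγ L _ ?_).trans ?_
        · rw [U.pauliCoeff_conj_zero, pauliCoeff_depolarize]
          by_contra hc
          have h := hw 0 (right_ne_zero_of_mul hc)
          rw [PauliString.weight_eq_zero.2 rfl] at h
          omega
        · rw [U.frobSq_conj]
          refine (mul_le_mul_of_nonneg_left (frobSq_depolarize_le hγ k _ hw)
            (Real.exp_nonneg _)).trans (le_of_eq ?_)
          -- The first noise damps by weight `k` and the later rounds by `d + 1`, in total ℓ + 1;
          -- the binomial coefficient demanded of this class is C(d, d) = 1.
          have hlk : ℓ - k = d := by omega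
          rw [← mul_assoc, ← Real.exp_add, hlk, Nat.choose_self, Nat.cast_one, one_mul]
          congr 2
          have : (ℓ : ℝ) = d + k := by
            have : ℓ = d + k := by omega
            exact_mod_cast this
          rw [this, ← hd]
          push_cast
          ring
    rw [hsplit, frobSq_eq_norm_sq, map_sum]
    refine (norm_sq_sum_le _ _ _ _ (fun k _ => by positivity)
      (fun k _ => Finset.sum_nonneg fun _ _ => by positivity) hpart).trans ?_
    rw [← Finset.sum_mul, ← Nat.cast_sum, sum_choose_sub ℓ d hℓ, frobSq_eq_sum]
    refine mul_le_mul_of_nonneg_left ?_ (by positivity)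
    rw [← Finset.sum_fiberwise_of_maps_to (s := Finset.univ)
        (t := Finset.range (m + 1)) (g := κ)
        (fun P _ => Finset.mem_range.2 (Nat.lt_succ_of_le (min_le_right _ _)))]
    refine Finset.sum_le_sum_of_subset_of_nonneg (fun k hk => ?_)
      fun _ _ _ => Finset.sum_nonneg fun _ _ => by positivity
    simp only [Finset.mem_Icc] at hk
    simp only [Finset.mem_range]
    omega

/-- Threshold zero keeps exactly the identity component, so the error is the evolution of the
traceless part. -/
theorem frobSq_errorLin_zero_le {n : ℕ} {γ : ℝ} (hγ : 0 ≤ γ) (L : Circuit n) (O : Op n) :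
    frobSq (errorLin γ 0 L O) ≤ Real.exp (-2 * γ * (L.length + 1 : ℕ)) * frobSq O := by
  have h : O = pauliCoeff O 0 • 1 + pauliPart (fun P => P ≠ 0) O := by
    apply op_ext
    intro P
    rw [pauliCoeff_add, pauliCoeff_smul, pauliCoeff_one, pauliCoeff_pauliPart]
    by_cases hP : P = 0 <;> simp [hP]
  have h0 : pauliCoeff (pauliPart (fun P => P ≠ 0) O) 0 = 0 := by
    rw [pauliCoeff_pauliPart]; simp
  have hE : errorLin γ 0 L O = heisenbergLin γ L (pauliPart (fun P => P ≠ 0) O) := by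
    conv_lhs => rw [h, map_add, map_smul, errorLin_one, smul_zero, zero_add,
      errorLin_of_le γ L (Nat.zero_le _) _ h0]
  rw [hE]
  refine (frobSq_heisenbergLin_le hγ L _ h0).trans
    (mul_le_mul_of_nonneg_left ?_ (Real.exp_nonneg _))
  rw [frobSq_pauliPart, frobSq_eq_sum]
  exact Finset.sum_le_sum_of_subset_of_nonneg (Finset.filter_subset _ _)
    fun _ _ _ => by positivity

/-! ## Root-mean-square error over a low-average ensemble -/

theorem trace_mul_eq_sum {n : ℕ} (A B : Op n) :
    Matrix.trace (A * B) = 2 ^ n * ∑ P, pauliCoeff A P * pauliCoeff B P := by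
  have h : ∀ P, star (pauliCoeff Aᴴ P) = pauliCoeff A P := fun P => by
    rw [pauliCoeff, pauliCoeff, star_div₀, ← Matrix.trace_conjTranspose,
      Matrix.conjTranspose_mul, Matrix.conjTranspose_conjTranspose,
      PauliString.conjTranspose_toOp, Matrix.trace_mul_comm]
    simp
  have := trace_conjTranspose_mul Aᴴ B
  rwa [Matrix.conjTranspose_conjTranspose, Finset.sum_congr rfl fun P _ => by rw [h P]] at this

/-- A map that is diagonal in the Pauli basis is self-adjoint for the trace form. -/
theorem trace_depolarize_mul {n : ℕ} (γ : ℝ) (A B : Op n) :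
    Matrix.trace (depolarize γ A * B) = Matrix.trace (A * depolarize γ B) := by
  rw [trace_mul_eq_sum, trace_mul_eq_sum]
  congr 1
  refine Finset.sum_congr rfl fun P _ => ?_
  rw [pauliCoeff_depolarize, pauliCoeff_depolarize]
  ring

theorem trace_channel_mul {n : ℕ} (γ : ℝ) (L : Circuit n) (ρ O : Op n) :
    Matrix.trace (channel γ L ρ * O) = Matrix.trace (ρ * heisenberg γ L O) := by
  induction L generalizing O with
  | nil => exact trace_depolarize_mul γ ρ O
  | cons U L ih =>
    rw [channel, heisenberg, trace_depolarize_mul, ← ih, mul_assoc, mul_assoc,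
        Matrix.trace_mul_comm]
    simp only [mul_assoc]

theorem norm_trace_conjTranspose_mul_sq_le {n : ℕ} (X Y : Op n) :
    ‖Matrix.trace (Xᴴ * Y)‖ ^ 2 ≤ (Matrix.trace (Xᴴ * X)).re * (Matrix.trace (Yᴴ * Y)).re := by
  have hr : ∀ Z : Op n, (Matrix.trace (Zᴴ * Z)).re = 2 ^ n * ‖coeffVec n Z‖ ^ 2 := fun Z => by
    rw [← frobSq_eq_norm_sq, frobSq, mul_div_cancel₀ _ (by positivity)]
  have hi : Matrix.trace (Xᴴ * Y) = 2 ^ n * inner ℂ (coeffVec n X) (coeffVec n Y) := by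
    rw [trace_conjTranspose_mul, PiLp.inner_apply]
    congr 1
    refine Finset.sum_congr rfl fun P _ => ?_
    simp [mul_comm]
  rw [hr, hr, hi, norm_mul, mul_pow, norm_pow, Complex.norm_ofNat]
  have := pow_le_pow_left₀ (norm_nonneg _) (norm_inner_le_norm (𝕜 := ℂ) (coeffVec n X) (coeffVec n
      Y)) 2
  calc _ ≤ ((2 : ℝ) ^ n) ^ 2 * (‖coeffVec n X‖ * ‖coeffVec n Y‖) ^ 2 := by gcongr
    _ = _ := by ring

open scoped MatrixOrder in
theorem exists_eq_conjTranspose_mul_self {n : ℕ} {A : Op n} (hA : A.PosSemidef) :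
    ∃ B : Op n, A = Bᴴ * B :=
  CStarAlgebra.nonneg_iff_eq_star_mul_self.1 (Matrix.nonneg_iff_posSemidef.2 hA)

/-- Cauchy-Schwarz for B and BE, where ρ = B†B has trace one. The right-hand side is linear in ρ, so
it can be averaged over an ensemble. -/
theorem IsDensity.norm_trace_mul_sq_le {n : ℕ} {ρ : Op n} (hρ : IsDensity ρ) (E : Op n) :
    ‖Matrix.trace (ρ * E)‖ ^ 2 ≤ (Matrix.trace (Eᴴ * ρ * E)).re := by
  obtain ⟨B, hB⟩ := exists_eq_conjTranspose_mul_self hρ.1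
  have h := norm_trace_conjTranspose_mul_sq_le B (B * E)
  rw [← mul_assoc, ← hB, hρ.2, Complex.one_re, one_mul, Matrix.conjTranspose_mul] at h
  rw [hB] at h ⊢
  simpa only [mul_assoc] using h

/-- The trace is the sum of the quadratic form of `A` over the columns of `E`, whose squared norms
add up to the unnormalized Frobenius norm. -/
theorem re_trace_conj_le {n : ℕ} (A E : Op n) :
    (Matrix.trace (Eᴴ * A * E)).re ≤
      ‖Matrix.toEuclideanCLM (𝕜 := ℂ) A‖ * (2 ^ n * frobSq E) := by
  set col : (Fin n → Fin 2) → EuclideanSpace ℂ (Fin n → Fin 2) :=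
    fun y => WithLp.toLp 2 fun x => E x y with hcol
  have h1 : ∀ y, (Eᴴ * A * E) y y =
      inner ℂ (col y) (Matrix.toEuclideanCLM (𝕜 := ℂ) A (col y)) := fun y => by
    rw [hcol, Matrix.toEuclideanCLM_toLp, PiLp.inner_apply, mul_assoc, Matrix.mul_apply]
    refine Finset.sum_congr rfl fun x _ => ?_
    simp only [Matrix.conjTranspose_apply, RCLike.inner_apply, Matrix.mulVec, dotProduct,
      Matrix.mul_apply]
    exact mul_comm _ _
  have h2 : 2 ^ n * frobSq E = ∑ y, ‖col y‖ ^ 2 := by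
    rw [frobSq, mul_div_cancel₀ _ (by positivity), Matrix.trace, Complex.re_sum]
    refine Finset.sum_congr rfl fun y _ => ?_
    rw [EuclideanSpace.norm_sq_eq, Matrix.diag_apply, Matrix.mul_apply, Complex.re_sum]
    refine Finset.sum_congr rfl fun x _ => ?_
    rw [Matrix.conjTranspose_apply]
    have : star (E x y) * E x y = ((‖E x y‖ ^ 2 : ℝ) : ℂ) := by
      push_cast
      exact RCLike.conj_mul _
    rw [this, Complex.ofReal_re]
  rw [h2, Matrix.trace, Complex.re_sum, Finset.mul_sum]
  refine Finset.sum_le_sum fun y _ => ?_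
  rw [Matrix.diag_apply, h1]
  refine ((Complex.re_le_norm _).trans (norm_inner_le_norm _ _)).trans ?_
  have := ContinuousLinearMap.le_opNorm (Matrix.toEuclideanCLM (𝕜 := ℂ) A) (col y)
  nlinarith [norm_nonneg (col y)]

theorem rms_error_le {n : ℕ} {γ ε : ℝ} {ℓ : ℕ} {L : Circuit n} {O : Op n} (hε : 0 ≤ ε)
    (hE : frobSq (errorLin γ ℓ L O) ≤ ε ^ 2) {c : ℝ} {N : ℕ} {ρ : Fin N → Op n}
    (hρ : ∀ i, IsDensity (ρ i)) (hc : IsLowAverage c ρ) :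
    Real.sqrt ((∑ i, ‖Matrix.trace (channel γ L (ρ i) * O) -
      Matrix.trace (ρ i * truncated γ ℓ L O)‖ ^ 2) / N) ≤ Real.sqrt c * ε := by
  set E := errorLin γ ℓ L O with hEdef
  have hdiff : ∀ i, Matrix.trace (channel γ L (ρ i) * O) -
      Matrix.trace (ρ i * truncated γ ℓ L O) = Matrix.trace (ρ i * E) := fun i => by
    rw [trace_channel_mul, ← Matrix.trace_sub, ← mul_sub, ← errorLin_apply]
  have hc' : ‖Matrix.toEuclideanCLM (𝕜 := ℂ) ((N : ℂ)⁻¹ • ∑ i, ρ i)‖ ≤ c / 2 ^ n := hc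
  -- Nonnegativity of the purity is implied, since it bounds an operator norm.
  have hc0 : 0 ≤ c := by
    have h := (norm_nonneg _).trans hc'
    have h2 : (0 : ℝ) < 2 ^ n := by positivity
    by_contra hneg
    exact absurd h (not_le.2 (div_neg_of_neg_of_pos (not_le.1 hneg) h2))
  have hsum : (∑ i, ‖Matrix.trace (ρ i * E)‖ ^ 2) / N ≤
      (Matrix.trace (Eᴴ * ((N : ℂ)⁻¹ • ∑ i, ρ i) * E)).re := by
    have : (Matrix.trace (Eᴴ * ((N : ℂ)⁻¹ • ∑ i, ρ i) * E)).re =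
        (∑ i, (Matrix.trace (Eᴴ * ρ i * E)).re) / N := by
      rw [Matrix.mul_smul, Matrix.smul_mul, Matrix.trace_smul, Finset.mul_sum, Finset.sum_mul,
        Matrix.trace_sum, smul_eq_mul, ← Complex.ofReal_natCast, ← Complex.ofReal_inv,
        Complex.re_ofReal_mul, Complex.re_sum, div_eq_inv_mul]
    rw [this]
    exact div_le_div_of_nonneg_right
      (Finset.sum_le_sum fun i _ => (hρ i).norm_trace_mul_sq_le E) (Nat.cast_nonneg _)
  simp only [hdiff]
  refine Real.sqrt_le_iff.2 ⟨mul_nonneg (Real.sqrt_nonneg _) hε, ?_⟩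
  rw [mul_pow, Real.sq_sqrt hc0]
  refine (hsum.trans (re_trace_conj_le _ E)).trans ?_
  calc _ ≤ c / 2 ^ n * (2 ^ n * ε ^ 2) := by
        refine mul_le_mul hc' (mul_le_mul_of_nonneg_left hE (by positivity)) ?_ (by positivity)
        exact mul_nonneg (by positivity) (frobSq_nonneg E)
    _ = c * ε ^ 2 := by field_simp

/-! ## Propagating Pauli strings through a list of gates -/

/-- The inverse of a gate. -/
def Gate.inv {n : ℕ} (g : Gate n) : Gate n where
  q₁ := g.q₁
  q₂ := g.q₂
  ne := g.ne
  mat := g.matᴴ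
  unitary := Unitary.star_mem g.unitary

theorem Gate.toOp_inv {n : ℕ} (g : Gate n) : g.inv.toOp = g.toOpᴴ := by
  ext x y
  rw [Gate.conjTranspose_toOp_apply, Gate.toOp, Matrix.of_apply]
  exact if_congr (by simp only [Gate.inv, eq_comm]) rfl rfl

/-- The amplitude with which a gate changes the letters `a` of its qubits into `b`, in the
Heisenberg picture (`fwd = true`) or in the reverse direction. -/
def Gate.stepAmp {n : ℕ} (g : Gate n) (fwd : Bool) (a b : Fin 4 × Fin 4) : ℂ :=
  if fwd then amplitude2 g.mat a b else amplitude2 g.mat b a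

/-- By cyclicity of the trace, an amplitude read backwards is the amplitude of the inverse gate read
forwards. Both directions of propagation thus share one theory. -/
theorem Gate.stepAmp_false {n : ℕ} (g : Gate n) (a b : Fin 4 × Fin 4) :
    g.stepAmp false a b = g.inv.stepAmp true a b := by
  simp only [Gate.stepAmp, Bool.false_eq_true, if_false, if_true, amplitude2, Gate.inv,
    Matrix.conjTranspose_conjTranspose]
  rw [mul_assoc, mul_assoc, Matrix.trace_mul_comm]
  simp only [mul_assoc]
  rw [Matrix.trace_mul_comm]
  simp only [mul_assoc]

theorem Gate.stepAmp_zero {n : ℕ} (g : Gate n) (fwd : Bool) (b : Fin 4 × Fin 4) :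
    g.stepAmp fwd (0, 0) b = if b = (0, 0) then 1 else 0 := by
  cases fwd
  · rw [g.stepAmp_false]
    exact g.inv.amplitude2_zero b
  · exact g.amplitude2_zero b

/-- The transition amplitude of a list of gates. -/
def gatesAmp {n : ℕ} (fwd : Bool) : List (Gate n) → PauliString n → PauliString n → ℂ
  | [], P, Q => if P = Q then 1 else 0
  | g :: gs, P, Q => ∑ b, g.stepAmp fwd (P g.q₁, P g.q₂) b *
      gatesAmp fwd gs (P.setPair g.q₁ g.q₂ b) Q

/-- In (gW)†P(gW) = W†(g†Pg)W the first gate of the list acts on `P` first, so the recursion runs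
through the list in order. -/
theorem gatesAmp_true {n : ℕ} (gs : List (Gate n)) (P Q : PauliString n) :
    gatesAmp true gs P Q = Matrix.trace
      (Q.toOp * (gs.map Gate.toOp).prodᴴ * P.toOp * (gs.map Gate.toOp).prod) / 2 ^ n := by
  induction gs generalizing P with
  | nil =>
    simp only [gatesAmp, List.map_nil, List.prod_nil, Matrix.conjTranspose_one, mul_one]
    rw [PauliString.trace_toOp_mul]
    by_cases h : P = Q
    · simp [h]
    · simp [h, Ne.symm h]
  | cons g gs ih =>
    set W := (gs.map Gate.toOp).prod
    have h : Q.toOp * (g.toOp * W)ᴴ * P.toOp * (g.toOp * W) =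
        ∑ b, g.stepAmp true (P g.q₁, P g.q₂) b •
          (Q.toOp * Wᴴ * (P.setPair g.q₁ g.q₂ b).toOp * W) := by
      have h1 : Q.toOp * (g.toOp * W)ᴴ * P.toOp * (g.toOp * W) =
          Q.toOp * Wᴴ * (g.toOpᴴ * P.toOp * g.toOp) * W := by
        simp only [Matrix.conjTranspose_mul, mul_assoc]
      rw [h1, g.conj_toOp, Finset.mul_sum, Finset.sum_mul]
      exact Finset.sum_congr rfl fun b _ => by
        rw [Matrix.mul_smul, Matrix.smul_mul]; rfl
    rw [gatesAmp, List.map_cons, List.prod_cons, h, Matrix.trace_sum, Finset.sum_div]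
    exact Finset.sum_congr rfl fun b _ => by
      rw [ih, Matrix.trace_smul, smul_eq_mul, mul_div_assoc]

theorem gatesAmp_false {n : ℕ} (gs : List (Gate n)) (P Q : PauliString n) :
    gatesAmp false gs P Q = gatesAmp true (gs.map Gate.inv) P Q := by
  induction gs generalizing P with
  | nil => rfl
  | cons g gs ih => simp only [gatesAmp, List.map_cons, ih, g.stepAmp_false]; rfl

theorem gatesAmp_gates {n : ℕ} (U : Layer n) (P Q : PauliString n) :
    gatesAmp true U.gates P Q = amplitude U P Q := gatesAmp_true _ _ _

/-- The inverse gates in reversed order multiply to U†, and tr(P U Q U†) = tr(Q U† P U). -/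
theorem gatesAmp_reverse {n : ℕ} (U : Layer n) (P Q : PauliString n) :
    gatesAmp false U.gates.reverse Q P = amplitude U P Q := by
  have h : ((U.gates.reverse.map Gate.inv).map Gate.toOp).prod = U.toOpᴴ := by
    unfold Layer.toOp
    induction U.gates with
    | nil => simp
    | cons g l ih =>
      rw [List.reverse_cons, List.map_append, List.map_append, List.prod_append, ih]
      simp [Gate.toOp_inv]
  rw [gatesAmp_false, gatesAmp_true, h, Matrix.conjTranspose_conjTranspose, amplitude,
    Matrix.trace_mul_comm]
  congr 1
  simp only [← mul_assoc]
  rw [mul_assoc, mul_assoc, mul_assoc, Matrix.trace_mul_comm]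
  simp only [mul_assoc]
  rw [← Matrix.trace_mul_comm]
  simp only [mul_assoc]
  rw [Matrix.trace_mul_comm]
  simp only [mul_assoc]

/-- A gate acts trivially on the Pauli string. -/
def Gate.Untouched {n : ℕ} (g : Gate n) (P : PauliString n) : Prop := P g.q₁ = 0 ∧ P g.q₂ = 0

instance {n : ℕ} (g : Gate n) (P : PauliString n) : Decidable (g.Untouched P) :=
  inferInstanceAs (Decidable (_ ∧ _))

/-- The number of gates that act nontrivially on the Pauli string. -/
def touches {n : ℕ} (gs : List (Gate n)) (P : PauliString n) : ℕ :=
  gs.countP fun g => ¬ g.Untouched P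

/-- The qubits of a gate. -/
def Gate.qubits {n : ℕ} (g : Gate n) : Finset (Fin n) := {g.q₁, g.q₂}

/-- Gates on disjoint qubits do not influence whether the others act, so the number of choices in a
layer is fixed by the string that enters it. -/
theorem touches_setPair {n : ℕ} (g : Gate n) (gs : List (Gate n))
    (h : ∀ g' ∈ gs, Disjoint g.qubits g'.qubits) (P : PauliString n) (b : Fin 4 × Fin 4) :
    touches gs (P.setPair g.q₁ g.q₂ b) = touches gs P := by
  refine List.countP_congr fun g' hg' => ?_
  have hd := h g' hg'
  simp only [Gate.qubits, Finset.disjoint_insert_left, Finset.disjoint_singleton_left,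
    Finset.mem_insert, Finset.mem_singleton, not_or] at hd
  have h1 : P.setPair g.q₁ g.q₂ b g'.q₁ = P g'.q₁ :=
    P.setPair_apply_of_ne (Ne.symm hd.1.1) (Ne.symm hd.2.1) b
  have h2 : P.setPair g.q₁ g.q₂ b g'.q₂ = P g'.q₂ :=
    P.setPair_apply_of_ne (Ne.symm hd.1.2) (Ne.symm hd.2.2) b
  have hu : g'.Untouched (P.setPair g.q₁ g.q₂ b) ↔ g'.Untouched P := by
    unfold Gate.Untouched
    rw [h1, h2]
  simp only [decide_eq_true_eq, hu]

open Classical in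
-- Every gate that acts owns a qubit with a non-identity letter, and disjoint gates own different
-- ones. Branching is therefore controlled by the weight and not by the number of qubits.
theorem touches_le_weight {n : ℕ} (gs : List (Gate n))
    (h : gs.Pairwise fun g g' => Disjoint g.qubits g'.qubits) (P : PauliString n) :
    touches gs P ≤ P.weight := by
  have key : touches gs P ≤
      ((gs.toFinset.biUnion Gate.qubits).filter fun j => P j ≠ 0).card := by
    induction gs with
    | nil => simp [touches]
    | cons g gs ih =>
      rw [List.pairwise_cons] at h
      rw [touches, List.countP_cons, List.toFinset_cons, Finset.biUnion_insert,
        Finset.filter_union, Finset.card_union_of_disjoint, add_comm]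
      · refine Nat.add_le_add ?_ (ih h.2)
        split_ifs with hu
        · refine Finset.card_pos.2 ?_
          simp only [Gate.Untouched, not_and_or, decide_eq_true_eq] at hu
          rcases hu with hu | hu
          · exact ⟨g.q₁, by simp [Gate.qubits, hu]⟩
          · exact ⟨g.q₂, by simp [Gate.qubits, hu]⟩
        · exact Nat.zero_le _
      · refine Finset.disjoint_filter_filter ?_
        rw [Finset.disjoint_biUnion_right]
        exact fun g' hg' => h.1 g' (List.mem_toFinset.1 hg')
  exact key.trans (Finset.card_le_card (Finset.filter_subset_filter _ (Finset.subset_univ _)))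

/-! ## Enumerating Pauli paths with a tape of digits -/

theorem sum_range_mul {M : Type*} [AddCommMonoid M] (N b : ℕ) (f : ℕ → M) :
    ∑ v ∈ Finset.range (N * b), f v = ∑ a : Fin b, ∑ v ∈ Finset.range N, f (a + b * v) := by
  rw [Finset.sum_range, ← finProdFinEquiv.sum_comp, Fintype.sum_prod_type_right]
  exact Finset.sum_congr rfl fun a _ => (Finset.sum_range fun v => f (a + b * v)).symm

/-- The lowest two base-4 digits are separated from the rest of the tape: they are what one acting
gate consumes. -/
theorem sum_range_pow_succ {M : Type*} [AddCommMonoid M] (K : ℕ) (f : ℕ → M) :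
    ∑ v ∈ Finset.range (16 ^ (K + 1)), f v =
      ∑ b : Fin 4 × Fin 4, ∑ v ∈ Finset.range (16 ^ K), f (b.1 + 4 * (b.2 + 4 * v)) := by
  have h : 16 ^ (K + 1) = 16 ^ K * 4 * 4 := by ring
  rw [h, sum_range_mul, Fintype.sum_prod_type]
  exact Finset.sum_congr rfl fun a _ => sum_range_mul _ _ fun v => f (a + 4 * v)

/-- One step of the propagation of a Pauli string: a gate that acts nontrivially replaces the
letters of its two qubits by the next two digits of the tape. The components are the string, the
tape and the accumulated amplitude. -/
def gateStep {n : ℕ} (fwd : Bool) (x : PauliString n × ℕ × ℂ) (g : Gate n) :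
    PauliString n × ℕ × ℂ :=
  if g.Untouched x.1 then x else
    (x.1.setPair g.q₁ g.q₂ (Fin.ofNat 4 x.2.1, Fin.ofNat 4 (x.2.1 / 4)), x.2.1 / 4 / 4,
      x.2.2 * g.stepAmp fwd (x.1 g.q₁, x.1 g.q₂) (Fin.ofNat 4 x.2.1, Fin.ofNat 4 (x.2.1 / 4)))

theorem gateStep_touched {n : ℕ} (fwd : Bool) {P : PauliString n} {g : Gate n}
    (hg : ¬ g.Untouched P) (b : Fin 4 × Fin 4) (v : ℕ) (z : ℂ) :
    gateStep fwd (P, (b.1 : ℕ) + 4 * (b.2 + 4 * v), z) g =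
      (P.setPair g.q₁ g.q₂ b, v, z * g.stepAmp fwd (P g.q₁, P g.q₂) b) := by
  have h1 : Fin.ofNat 4 ((b.1 : ℕ) + 4 * (b.2 + 4 * v)) = b.1 := by
    ext; simp [Fin.ofNat]
  have h2 : ((b.1 : ℕ) + 4 * (b.2 + 4 * v)) / 4 = b.2 + 4 * v := by omega
  have h3 : Fin.ofNat 4 ((b.2 : ℕ) + 4 * v) = b.2 := by
    ext; simp [Fin.ofNat]
  have h4 : ((b.2 : ℕ) + 4 * v) / 4 = v := by omega
  simp only [gateStep, if_neg hg, h1, h2, h3, h4]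

theorem foldl_gateStep_smul {n : ℕ} (fwd : Bool) (gs : List (Gate n)) (P : PauliString n) (v : ℕ)
    (z : ℂ) : gs.foldl (gateStep fwd) (P, v, z) =
      ((gs.foldl (gateStep fwd) (P, v, 1)).1, (gs.foldl (gateStep fwd) (P, v, 1)).2.1,
        z * (gs.foldl (gateStep fwd) (P, v, 1)).2.2) := by
  induction gs generalizing P v z with
  | nil => simp
  | cons g gs ih =>
    rw [List.foldl_cons, List.foldl_cons]
    by_cases hg : g.Untouched P
    · simp only [gateStep, if_pos hg]
      exact ih P v z
    · simp only [gateStep, if_neg hg, one_mul]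
      rw [ih _ _ (z * _), ih _ _ (g.stepAmp _ _ _)]
      simp only [mul_assoc]

/-- Summing over the digits consumed by the acting gates carries out the sums over letters in
`gatesAmp`. A gate that does not act has a Kronecker delta as amplitude and consumes nothing. The
unread digits are handed on to `Ψ`. -/
theorem sum_foldl_gateStep {n : ℕ} (fwd : Bool) (gs : List (Gate n))
    (h : gs.Pairwise fun g g' => Disjoint g.qubits g'.qubits) (P : PauliString n) (K : ℕ)
    (hK : touches gs P ≤ K) (z : ℂ) (Ψ : PauliString n → ℕ → ℂ) :
    ∑ v ∈ Finset.range (16 ^ K), (gs.foldl (gateStep fwd) (P, v, z)).2.2 *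
        Ψ (gs.foldl (gateStep fwd) (P, v, z)).1 (gs.foldl (gateStep fwd) (P, v, z)).2.1 =
      z * ∑ Q, gatesAmp fwd gs P Q * ∑ v ∈ Finset.range (16 ^ (K - touches gs P)), Ψ Q v := by
  induction gs generalizing P K z with
  | nil =>
    rw [Finset.sum_eq_single P]
    · simp [gatesAmp, touches, Finset.mul_sum]
    · intro Q _ hQ
      simp [gatesAmp, Ne.symm hQ]
    · simp
  | cons g gs ih =>
    rw [List.pairwise_cons] at h
    by_cases hg : g.Untouched P
    · have ht : touches (g :: gs) P = touches gs P := by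
        simp [touches, hg]
      have hs : ∀ v, gateStep fwd (P, v, z) g = (P, v, z) := fun v => by
        simp only [gateStep, if_pos hg]
      simp only [List.foldl_cons, hs]
      rw [ht] at hK ⊢
      rw [ih h.2 P K hK z]
      have h0 : (P g.q₁, P g.q₂) = (0, 0) := Prod.ext hg.1 hg.2
      have hp : P.setPair g.q₁ g.q₂ (0, 0) = P := by
        rw [← h0, P.setPair_self]
      simp only [gatesAmp, h0, g.stepAmp_zero, ite_mul, one_mul, zero_mul, Finset.sum_ite_eq',
        Finset.mem_univ, if_true, hp]
    · have ht : touches (g :: gs) P = touches gs P + 1 := by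
        simp [touches, hg]
      obtain ⟨K, rfl⟩ : ∃ K', K = K' + 1 := ⟨K - 1, by omega⟩
      rw [sum_range_pow_succ]
      simp only [List.foldl_cons, gateStep_touched fwd hg]
      have hb : ∀ b : Fin 4 × Fin 4, touches gs (P.setPair g.q₁ g.q₂ b) = touches gs P :=
        touches_setPair g gs h.1 P
      have hi := fun b : Fin 4 × Fin 4 => ih h.2 (P.setPair g.q₁ g.q₂ b) K (by rw [hb]; omega)
        (z * g.stepAmp fwd (P g.q₁, P g.q₂) b)
      simp only [hi, hb, ht, gatesAmp, Finset.sum_mul, Nat.add_sub_add_right]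
      simp only [Finset.mul_sum]
      rw [Finset.sum_comm]
      refine Finset.sum_congr rfl fun Q _ => ?_
      refine Finset.sum_congr rfl fun v _ => Finset.sum_congr rfl fun b _ => ?_
      ring

/-- A stage of the enumeration: the entry `dst` of the path is obtained by propagating the entry
`src` through a list of gates, and contributes the given factor. -/
structure Stage (n : ℕ) (ι : Type) where
  src : ι
  dst : ι
  fwd : Bool
  gates : List (Gate n)
  factor : PauliString n → ℂ

/-- Perform a stage. The components are the path, the tape and the accumulated amplitude. -/
def stageStep {n : ℕ} {ι : Type} [DecidableEq ι] (x : (ι → PauliString n) × ℕ × ℂ)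
    (st : Stage n ι) : (ι → PauliString n) × ℕ × ℂ :=
  let r := st.gates.foldl (gateStep st.fwd) (x.1 st.src, x.2.1, x.2.2)
  (Function.update x.1 st.dst r.1, r.2.1, r.2.2 * st.factor r.1)

/-- The amplitude of a stage along a path. -/
def Stage.amp {n : ℕ} {ι : Type} (st : Stage n ι) (q : ι → PauliString n) : ℂ :=
  gatesAmp st.fwd st.gates (q st.src) (q st.dst) * st.factor (q st.dst)

/-- The stages visit distinct entries of the path, and leave the entries alone that they have
already used. -/
structure ValidStages {n : ℕ} {ι : Type} (sts : List (Stage n ι)) : Prop where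
  ne : ∀ st ∈ sts, st.src ≠ st.dst
  pairwise : sts.Pairwise fun s t => t.dst ≠ s.dst ∧ t.dst ≠ s.src
  disjoint : ∀ st ∈ sts, st.gates.Pairwise fun g g' => Disjoint g.qubits g'.qubits

theorem ValidStages.tail {n : ℕ} {ι : Type} {st : Stage n ι} {sts : List (Stage n ι)}
    (h : ValidStages (st :: sts)) : ValidStages sts :=
  ⟨fun s hs => h.ne s (List.mem_cons_of_mem _ hs), (List.pairwise_cons.1 h.pairwise).2,
    fun s hs => h.disjoint s (List.mem_cons_of_mem _ hs)⟩

section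
variable {n : ℕ} {ι : Type} [DecidableEq ι]

theorem foldl_stageStep_smul (sts : List (Stage n ι)) (p : ι → PauliString n) (v : ℕ) (z : ℂ) :
    sts.foldl stageStep (p, v, z) =
      ((sts.foldl stageStep (p, v, 1)).1, (sts.foldl stageStep (p, v, 1)).2.1,
        z * (sts.foldl stageStep (p, v, 1)).2.2) := by
  induction sts generalizing p v z with
  | nil => simp
  | cons st sts ih =>
    rw [List.foldl_cons, List.foldl_cons, stageStep, stageStep]
    simp only
    rw [foldl_gateStep_smul st.fwd st.gates _ v z, ih _ _ (_ * _), ih _ _ (_ * st.factor _)]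
    simp only [mul_assoc]

theorem foldl_stageStep_apply (sts : List (Stage n ι)) (x : (ι → PauliString n) × ℕ × ℂ) (i : ι)
    (hi : ∀ st ∈ sts, st.dst ≠ i) : (sts.foldl stageStep x).1 i = x.1 i := by
  induction sts generalizing x with
  | nil => rfl
  | cons st sts ih =>
    rw [List.foldl_cons, ih _ fun s hs => hi s (List.mem_cons_of_mem _ hs), stageStep]
    exact Function.update_of_ne (Ne.symm (hi st List.mem_cons_self)) _ _

/-- A path may need fewer digits than the tape provides; demanding that the tape end at zero selects
one tape for every sequence of choices. The length condition concerns only the paths on which `h`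
does not vanish, so that tapes may be too short for heavy paths. -/
theorem sum_foldl_stageStep [Fintype ι] (sts : List (Stage n ι)) (hv : ValidStages sts)
    (h : (ι → PauliString n) → ℂ) (p : ι → PauliString n) (z : ℂ) (K : ℕ)
    (hK : ∀ q : ι → PauliString n, (∀ i, (∀ st ∈ sts, st.dst ≠ i) → q i = p i) → h q ≠ 0 →
      (sts.map fun st => touches st.gates (q st.src)).sum ≤ K) :
    ∑ v ∈ Finset.range (16 ^ K), (if (sts.foldl stageStep (p, v, z)).2.1 = 0 then
        (sts.foldl stageStep (p, v, z)).2.2 * h (sts.foldl stageStep (p, v, z)).1 else 0) =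
      z * ∑ q : ι → PauliString n with ∀ i, (∀ st ∈ sts, st.dst ≠ i) → q i = p i,
        (sts.map fun st => st.amp q).prod * h q := by
  induction sts generalizing p z K with
  | nil =>
    refine (Finset.sum_eq_single 0 (fun v _ hv0 => if_neg hv0)
      fun h0 => absurd (Finset.mem_range.2 (by positivity)) h0).trans ?_
    rw [if_pos rfl]
    simp only [List.foldl_nil, List.not_mem_nil, false_imp_iff, implies_true, forall_const,
      List.map_nil, List.prod_nil, one_mul]
    have : Finset.univ.filter (fun q : ι → PauliString n => ∀ i, q i = p i) = {p} := by
      ext q; simp [funext_iff]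
    rw [this, Finset.sum_singleton]
  | cons st sts ih =>
    have hpw := (List.pairwise_cons.1 hv.pairwise).1
    have hsrc : ∀ q : ι → PauliString n, (∀ i, (∀ s ∈ st :: sts, s.dst ≠ i) → q i = p i) →
        q st.src = p st.src := fun q hq => hq _ fun s hs => by
      rcases List.mem_cons.1 hs with rfl | hs
      · exact (hv.ne _ List.mem_cons_self).symm
      · exact (hpw s hs).2
    by_cases hT : touches st.gates (p st.src) ≤ K
    · set Ψ : PauliString n → ℕ → ℂ := fun Q v => st.factor Q *
        if (sts.foldl stageStep (Function.update p st.dst Q, v, 1)).2.1 = 0 then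
          (sts.foldl stageStep (Function.update p st.dst Q, v, 1)).2.2 *
            h (sts.foldl stageStep (Function.update p st.dst Q, v, 1)).1 else 0 with hΨ
      have hstep : ∀ v, (if ((st :: sts).foldl stageStep (p, v, z)).2.1 = 0 then
          ((st :: sts).foldl stageStep (p, v, z)).2.2 *
            h ((st :: sts).foldl stageStep (p, v, z)).1 else 0) =
          (st.gates.foldl (gateStep st.fwd) (p st.src, v, z)).2.2 *
            Ψ (st.gates.foldl (gateStep st.fwd) (p st.src, v, z)).1
              (st.gates.foldl (gateStep st.fwd) (p st.src, v, z)).2.1 := fun v => by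
        rw [List.foldl_cons, stageStep]
        simp only [hΨ]
        rw [foldl_stageStep_smul]
        simp only
        split_ifs <;> ring
      have hR : ∀ q : ι → PauliString n, (∀ i, (∀ s ∈ st :: sts, s.dst ≠ i) → q i = p i) ↔
          ∀ i, (∀ s ∈ sts, s.dst ≠ i) → q i = Function.update p st.dst (q st.dst) i := by
        intro q
        refine forall_congr' fun i => ?_
        by_cases hi : i = st.dst
        · subst hi; simp
        · simp [Function.update_of_ne hi, Ne.symm hi]
      rw [Finset.sum_congr rfl fun v _ => hstep v,
        sum_foldl_gateStep _ _ (hv.disjoint _ List.mem_cons_self) _ _ hT]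
      congr 1
      rw [← Finset.sum_fiberwise _ fun q : ι → PauliString n => q st.dst]
      refine Finset.sum_congr rfl fun Q _ => ?_
      simp only [hΨ, ← Finset.mul_sum]
      rw [ih hv.tail (Function.update p st.dst Q) 1 (K - touches st.gates (p st.src)), one_mul,
        Finset.mul_sum, Finset.mul_sum]
      · have hset : (Finset.univ.filter fun q : ι → PauliString n =>
            ∀ i, (∀ s ∈ st :: sts, s.dst ≠ i) → q i = p i).filter (fun q => q st.dst = Q) =
            Finset.univ.filter fun q : ι → PauliString n =>
              ∀ i, (∀ s ∈ sts, s.dst ≠ i) → q i = Function.update p st.dst Q i := by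
          ext q
          simp only [Finset.mem_filter, Finset.mem_univ, true_and]
          constructor
          · rintro ⟨h1, rfl⟩
            exact (hR q).1 h1
          · intro h1
            have hQ : q st.dst = Q := by
              have := h1 st.dst fun s hs => (hpw s hs).1
              rwa [Function.update_self] at this
            exact ⟨(hR q).2 (by rw [hQ]; exact h1), hQ⟩
        rw [hset]
        refine Finset.sum_congr rfl fun q hq => ?_
        rw [← hset] at hq
        simp only [Finset.mem_filter, Finset.mem_univ, true_and] at hq
        rw [List.map_cons, List.prod_cons, Stage.amp, hsrc q hq.1, hq.2]
        ring
      · intro q hq hh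
        have hQ : q st.dst = Q := by
          have := hq st.dst fun s hs => (hpw s hs).1
          rwa [Function.update_self] at this
        have hq' := (hR q).2 (by rw [hQ]; exact hq)
        have := hK q hq' hh
        rw [List.map_cons, List.sum_cons, hsrc q hq'] at this
        omega
    -- The tape is too short for this stage. Then `h` vanishes on all completions, among them the
    -- paths produced by the fold, so both sides are zero.
    · have hz : ∀ q : ι → PauliString n, (∀ i, (∀ s ∈ st :: sts, s.dst ≠ i) → q i = p i) →
          h q = 0 := fun q hq => by
        by_contra hh
        have := hK q hq hh
        rw [List.map_cons, List.sum_cons, hsrc q hq] at this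
        omega
      rw [Finset.sum_eq_zero, Finset.sum_eq_zero, mul_zero]
      · intro q hq
        rw [hz q (Finset.mem_filter.1 hq).2, mul_zero]
      · intro v _
        rw [hz _ fun i hi => foldl_stageStep_apply _ _ i hi, mul_zero, ite_self]

end

/-! ## The stages that enumerate the paths with a given entry -/

/-- The gates of layer number `u`. -/
def gatesAt {n : ℕ} (L : Circuit n) (u : ℕ) : List (Gate n) := (L[u]?.map Layer.gates).getD []

theorem gatesAt_eq {n : ℕ} (L : Circuit n) (u : Fin L.length) :
    gatesAt L u = (L.get u).gates := by
  simp [gatesAt]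

theorem gatesAt_disjoint {n : ℕ} (L : Circuit n) (u : ℕ) :
    (gatesAt L u).Pairwise fun g g' => Disjoint g.qubits g'.qubits := by
  unfold gatesAt
  cases L[u]? with
  | none => exact List.Pairwise.nil
  | some U => exact U.disjoint

/-- The damping factor of a Pauli string under one layer of noise. -/
def noiseFactor {n : ℕ} (γ : ℝ) (P : PauliString n) : ℂ := (Real.exp (-γ) : ℂ) ^ P.weight

/-- The weight of a Pauli string is at most `ℓ / (d + 1)`. -/
def IsLow {n : ℕ} (d ℓ : ℕ) (P : PauliString n) : Prop := (d + 1) * P.weight ≤ ℓ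

instance {n : ℕ} (d ℓ : ℕ) (P : PauliString n) : Decidable (IsLow d ℓ P) :=
  inferInstanceAs (Decidable (_ ≤ _))

section
variable {n : ℕ} (γ : ℝ) (ℓ : ℕ) (L : Circuit n)

/-- Propagation through layer number `u` towards the end of the path. -/
def fwdStage (u : ℕ) : Stage n (Fin (L.length + 1)) where
  src := Fin.ofNat _ u
  dst := Fin.ofNat _ (u + 1)
  fwd := true
  gates := gatesAt L u
  factor := noiseFactor γ

/-- Propagation through layer number `u` towards the beginning of the path; strings of low weight
are discarded. -/
def bwdStage (u : ℕ) : Stage n (Fin (L.length + 1)) where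
  src := Fin.ofNat _ (u + 1)
  dst := Fin.ofNat _ u
  fwd := false
  gates := (gatesAt L u).reverse
  factor := fun Q => noiseFactor γ Q * if IsLow L.length ℓ Q then 0 else 1

/-- The stages that complete a path from its entry number `t`. -/
def pathStages (t : ℕ) : List (Stage n (Fin (L.length + 1))) :=
  (List.range' t (L.length - t)).map (fwdStage γ L) ++
    (List.range t).reverse.map (bwdStage γ ℓ L)

theorem ofNat_inj {d i j : ℕ} (hi : i ≤ d) (hj : j ≤ d) :
    Fin.ofNat (d + 1) i = Fin.ofNat (d + 1) j ↔ i = j := by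
  rw [Fin.ext_iff]
  simp only [Fin.ofNat]
  rw [Nat.mod_eq_of_lt (by omega), Nat.mod_eq_of_lt (by omega)]

theorem validStages_pathStages {t : ℕ} (ht : t ≤ L.length) :
    ValidStages (pathStages γ ℓ L t) := by
  refine ⟨?_, ?_, ?_⟩
  · intro st hst
    simp only [pathStages, List.mem_append, List.mem_map, List.mem_range'_1, List.mem_reverse,
      List.mem_range] at hst
    rcases hst with ⟨u, hu, rfl⟩ | ⟨u, hu, rfl⟩
    · exact fun h => by have := (ofNat_inj (by omega) (by omega)).1 h; omega
    · exact fun h => by have := (ofNat_inj (by omega) (by omega)).1 h; omega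
  · rw [pathStages, List.pairwise_append]
    refine ⟨?_, ?_, ?_⟩
    · rw [List.pairwise_map]
      refine List.Pairwise.imp_of_mem ?_ (List.pairwise_lt_range' (s := t) (n := L.length - t))
      intro u u' hu hu' hlt
      rw [List.mem_range'_1] at hu hu'
      exact ⟨fun h => by have := (ofNat_inj (by omega) (by omega)).1 h; omega,
        fun h => by have := (ofNat_inj (by omega) (by omega)).1 h; omega⟩
    · rw [List.pairwise_map, List.pairwise_reverse]
      refine List.Pairwise.imp_of_mem ?_ (List.pairwise_lt_range (n := t))
      intro u u' hu hu' hlt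
      rw [List.mem_range] at hu hu'
      exact ⟨fun h => by have := (ofNat_inj (by omega) (by omega)).1 h; omega,
        fun h => by have := (ofNat_inj (by omega) (by omega)).1 h; omega⟩
    · intro a ha b hb
      simp only [List.mem_map, List.mem_range'_1, List.mem_reverse, List.mem_range] at ha hb
      obtain ⟨u, hu, rfl⟩ := ha
      obtain ⟨u', hu', rfl⟩ := hb
      exact ⟨fun h => by have := (ofNat_inj (by omega) (by omega)).1 h; omega,
        fun h => by have := (ofNat_inj (by omega) (by omega)).1 h; omega⟩
  · intro st hst
    simp only [pathStages, List.mem_append, List.mem_map] at hst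
    rcases hst with ⟨u, _, rfl⟩ | ⟨u, _, rfl⟩
    · exact gatesAt_disjoint L u
    · exact List.pairwise_reverse.2 ((gatesAt_disjoint L u).imp fun h => h.symm)

/-- Every entry except number `t` is the destination of a stage: the later ones forwards, the
earlier ones backwards. -/
theorem forall_pathStages_iff {t : ℕ} (ht : t ≤ L.length)
    (p q : Fin (L.length + 1) → PauliString n) :
    (∀ i, (∀ st ∈ pathStages γ ℓ L t, st.dst ≠ i) → q i = p i) ↔
      q (Fin.ofNat _ t) = p (Fin.ofNat _ t) := by
  constructor
  · refine fun h => h _ fun st hst => ?_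
    simp only [pathStages, List.mem_append, List.mem_map, List.mem_range'_1, List.mem_reverse,
      List.mem_range] at hst
    rcases hst with ⟨u, hu, rfl⟩ | ⟨u, hu, rfl⟩
    · exact fun h => by have := (ofNat_inj (by omega) (by omega)).1 h; omega
    · exact fun h => by have := (ofNat_inj (by omega) (by omega)).1 h; omega
  · intro h i hi
    have hiv : i = Fin.ofNat _ (i : ℕ) := by ext; simp
    rcases lt_trichotomy (i : ℕ) t with hlt | heq | hgt
    · refine absurd hiv.symm (hi (bwdStage γ ℓ L i) ?_)
      simp only [pathStages, List.mem_append, List.mem_map, List.mem_reverse, List.mem_range]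
      exact Or.inr ⟨i, hlt, rfl⟩
    · rw [hiv, heq, h]
    · refine absurd ?_ (hi (fwdStage γ L (i - 1)) ?_)
      · rw [fwdStage, Nat.sub_add_cancel (by omega)]
        exact hiv.symm
      · simp only [pathStages, List.mem_append, List.mem_map, List.mem_range'_1]
        exact Or.inl ⟨i - 1, by omega, rfl⟩

theorem range'_toFinset {t d : ℕ} (ht : t ≤ d) :
    (List.range' t (d - t)).toFinset = Finset.Ico t d := by
  ext u
  simp only [List.mem_toFinset, List.mem_range'_1, Finset.mem_Ico]
  omega

/-- Within one direction, each entry is a source at most once, so either direction needs at most as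
many choices as the total weight. -/
theorem sum_touches_pathStages_le {t : ℕ} (ht : t ≤ L.length)
    (q : Fin (L.length + 1) → PauliString n) (hq : PauliPath.weight q ≤ ℓ) :
    ((pathStages γ ℓ L t).map fun st => touches st.gates (q st.src)).sum ≤ 2 * ℓ := by
  have hw : PauliPath.weight q =
      ∑ i ∈ Finset.range (L.length + 1), PauliString.weight (q (Fin.ofNat _ i)) := by
    rw [Finset.sum_range, PauliPath.weight]
    simp
  have hsrc : ∀ st ∈ pathStages γ ℓ L t, touches st.gates (q st.src) ≤ (q st.src).weight :=
    fun st hst => touches_le_weight _ ((validStages_pathStages γ ℓ L ht).disjoint st hst) _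
  refine (List.sum_le_sum hsrc).trans ?_
  rw [pathStages, List.map_append, List.sum_append, List.map_map, List.map_map,
    ← List.sum_toFinset _ List.nodup_range', range'_toFinset ht,
    ← List.sum_toFinset _ (List.nodup_reverse.2 List.nodup_range), List.toFinset_reverse,
    List.toFinset_range]
  have h1 : ∑ u ∈ Finset.Ico t L.length,
      ((fun st => (q st.src).weight) ∘ fwdStage γ L) u ≤ ℓ := by
    refine le_trans ?_ (hw ▸ hq)
    refine Finset.sum_le_sum_of_subset fun u hu => ?_
    simp only [Finset.mem_Ico, Finset.mem_range] at hu ⊢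
    omega
  have h2 : ∑ u ∈ Finset.range t, ((fun st => (q st.src).weight) ∘ bwdStage γ ℓ L) u ≤ ℓ := by
    refine le_trans ?_ (hw ▸ hq)
    rw [Finset.sum_range_succ']
    refine le_trans ?_ (Nat.le_add_right _ _)
    exact Finset.sum_le_sum_of_subset (Finset.range_subset_range.2 ht)
  exact (Nat.add_le_add h1 h2).trans (by omega)

/-- The contribution of a Pauli path to `tr(ρ Õ)`, up to the coefficient of its first entry. -/
def pathTerm (ρ : Op n) (q : PauliPath n L.length) : ℂ :=
  if q.weight ≤ ℓ then (∏ i, noiseFactor γ (q i)) *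
    (∏ u : Fin L.length, amplitude (L.get u) (q u.castSucc) (q u.succ)) *
      Matrix.trace (ρ * (q (Fin.last _)).toOp) else 0

theorem trace_mul_truncated (ρ O : Op n) :
    Matrix.trace (ρ * truncated γ ℓ L O) = ∑ q, pathTerm γ ℓ L ρ q * pauliCoeff O (q 0) := by
  rw [truncated, Finset.mul_sum, Matrix.trace_sum, Finset.sum_filter]
  refine Finset.sum_congr rfl fun q _ => ?_
  rw [pathTerm]
  split_ifs
  · have h : (Real.exp (-γ * q.weight) : ℂ) = ∏ i, noiseFactor γ (q i) := by
      simp only [noiseFactor]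
      rw [Finset.prod_pow_eq_pow_sum, ← Complex.ofReal_pow, ← Real.exp_nat_mul, mul_comm]
      rfl
    rw [Matrix.mul_smul, Matrix.trace_smul, smul_eq_mul, h]
    ring
  · rw [zero_mul]

/-- A stage supplies the damping of its destination. Entry `t` is no destination, so its factor has
to be put in at the start. -/
theorem noiseFactor_mul_prod_amp {t : ℕ} (ht : t ≤ L.length) (q : PauliPath n L.length) :
    noiseFactor γ (q (Fin.ofNat _ t)) * ((pathStages γ ℓ L t).map fun st => st.amp q).prod =
      (∏ s ∈ Finset.range t, if IsLow L.length ℓ (q (Fin.ofNat _ s)) then (0 : ℂ) else 1) *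
        ((∏ i, noiseFactor γ (q i)) *
          ∏ u : Fin L.length, amplitude (L.get u) (q u.castSucc) (q u.succ)) := by
  set a : ℕ → ℂ := fun u => gatesAmp true (gatesAt L u) (q (Fin.ofNat _ u))
    (q (Fin.ofNat _ (u + 1))) with ha
  have ha' : ∏ u : Fin L.length, amplitude (L.get u) (q u.castSucc) (q u.succ) =
      ∏ u ∈ Finset.range L.length, a u := by
    rw [Finset.prod_range]
    refine Finset.prod_congr rfl fun u _ => ?_
    have h1 : Fin.ofNat (L.length + 1) (u : ℕ) = u.castSucc := by
      ext; simp only [Fin.ofNat, Fin.val_castSucc]; exact Nat.mod_eq_of_lt (by omega)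
    have h2 : Fin.ofNat (L.length + 1) ((u : ℕ) + 1) = u.succ := by
      ext; simp only [Fin.ofNat, Fin.val_succ]; exact Nat.mod_eq_of_lt (by omega)
    simp only [ha, h1, h2, gatesAt_eq, gatesAmp_gates]
  have hn : ∏ i, noiseFactor γ (q i) =
      ∏ i ∈ Finset.range (L.length + 1), noiseFactor γ (q (Fin.ofNat _ i)) := by
    rw [Finset.prod_range]
    simp
  rw [pathStages, List.map_append, List.prod_append, List.map_map, List.map_map,
    ← List.prod_toFinset _ List.nodup_range', range'_toFinset ht,
    ← List.prod_toFinset _ (List.nodup_reverse.2 List.nodup_range), List.toFinset_reverse,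
    List.toFinset_range, ha', hn]
  have hf : ∀ u, ((fun st : Stage n (Fin (L.length + 1)) => st.amp q) ∘ fwdStage γ L) u =
      a u * noiseFactor γ (q (Fin.ofNat _ (u + 1))) := fun u => rfl
  have hb : ∀ u ∈ Finset.range t,
      ((fun st : Stage n (Fin (L.length + 1)) => st.amp q) ∘ bwdStage γ ℓ L) u =
      a u * (noiseFactor γ (q (Fin.ofNat _ u)) *
        if IsLow L.length ℓ (q (Fin.ofNat _ u)) then 0 else 1) := by
    intro u hu
    have hu' : u < L.length := by rw [Finset.mem_range] at hu; omega
    have h1 : gatesAt L u = (L.get ⟨u, hu'⟩).gates := gatesAt_eq L ⟨u, hu'⟩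
    simp only [Function.comp_apply, Stage.amp, bwdStage, ha, h1, gatesAmp_reverse, gatesAmp_gates]
  simp only [hf]
  rw [Finset.prod_congr rfl hb]
  simp only [Finset.prod_mul_distrib]
  rw [← Finset.prod_range_mul_prod_Ico a ht,
    ← Finset.prod_range_mul_prod_Ico (fun i => noiseFactor γ (q (Fin.ofNat _ i)))
      (by omega : t ≤ L.length + 1), Finset.prod_eq_prod_Ico_succ_bot (by omega : t < L.length + 1),
    ← Finset.prod_Ico_add' (fun i => noiseFactor γ (q (Fin.ofNat _ i))) t L.length 1]
  ring

/-- The result of the enumeration for one value of the tape. -/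
def tapeValue (ρ : Op n) (c : PauliString n → ℂ) (t : ℕ) (P : PauliString n) (z : ℂ) (v : ℕ) : ℂ :=
  let r := (pathStages γ ℓ L t).foldl stageStep (fun _ => P, v, z * noiseFactor γ P)
  if r.2.1 = 0 then r.2.2 * (if PauliPath.weight r.1 ≤ ℓ then
    Matrix.trace (ρ * (r.1 (Fin.last _)).toOp) * c (r.1 0) else 0) else 0

theorem sum_tapeValue (ρ : Op n) (c : PauliString n → ℂ) {t : ℕ} (ht : t ≤ L.length)
    (P : PauliString n) (z : ℂ) :
    ∑ v ∈ Finset.range (256 ^ ℓ), tapeValue γ ℓ L ρ c t P z v =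
      z * ∑ q : PauliPath n L.length, if q (Fin.ofNat _ t) = P then
        (∏ s ∈ Finset.range t, if IsLow L.length ℓ (q (Fin.ofNat _ s)) then (0 : ℂ) else 1) *
          (pathTerm γ ℓ L ρ q * c (q 0)) else 0 := by
  -- There are 16 outcomes per acting gate, and at most 2ℓ acting gates.
  have h256 : 256 ^ ℓ = 16 ^ (2 * ℓ) := by rw [pow_mul]; norm_num
  rw [h256]
  refine (sum_foldl_stageStep (pathStages γ ℓ L t) (validStages_pathStages γ ℓ L ht)
    (fun q => if PauliPath.weight q ≤ ℓ then
      Matrix.trace (ρ * (q (Fin.last _)).toOp) * c (q 0) else 0) (fun _ => P)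
    (z * noiseFactor γ P) (2 * ℓ) ?_).trans ?_
  · intro q _ hq
    refine sum_touches_pathStages_le γ ℓ L ht q ?_
    by_contra hc
    exact hq (if_neg hc)
  · simp only [forall_pathStages_iff γ ℓ L ht (fun _ => P)]
    rw [Finset.sum_filter, mul_assoc, Finset.mul_sum]
    congr 1
    refine Finset.sum_congr rfl fun q _ => ?_
    split_ifs with h1 h2
    · rw [← mul_assoc, ← h1, noiseFactor_mul_prod_amp γ ℓ L ht, pathTerm, if_pos h2]
      ring
    · rw [pathTerm, if_neg h2]
      ring
    · rw [mul_zero]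

/-- The summand indicates that `t` is the first low position; the sum telescopes to the indicator
that a low position exists. -/
theorem sum_first_low (low : ℕ → Prop) [DecidablePred low] (m : ℕ) :
    ∑ t ∈ Finset.range m, (if low t then (∏ s ∈ Finset.range t, if low s then (0 : ℂ) else 1)
      else 0) = 1 - ∏ s ∈ Finset.range m, if low s then (0 : ℂ) else 1 := by
  induction m with
  | zero => simp
  | succ m ih =>
    rw [Finset.sum_range_succ, ih, Finset.prod_range_succ]
    split_ifs <;> ring

/-- The lightest of the d + 1 entries weighs at most the average. -/
theorem exists_isLow (q : PauliPath n L.length) (hq : q.weight ≤ ℓ) :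
    ∃ t ∈ Finset.range (L.length + 1), IsLow L.length ℓ (q (Fin.ofNat _ t)) := by
  by_contra hc
  push Not at hc
  have h : ∀ i, ℓ + 1 ≤ (L.length + 1) * (q i).weight := fun i => by
    have := hc i (Finset.mem_range.2 i.2)
    have hi : Fin.ofNat (L.length + 1) (i : ℕ) = i := by ext; simp
    rw [hi, IsLow] at this
    omega
  have h2 := Finset.sum_le_sum fun i (_ : i ∈ Finset.univ) => h i
  rw [Finset.sum_const, Finset.card_univ, Fintype.card_fin, smul_eq_mul, ← Finset.mul_sum] at h2
  have h3 := Nat.le_of_mul_le_mul_left h2 (by omega)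
  have h4 : q.weight = ∑ i, (q i).weight := rfl
  omega

/-- Sorting the paths by their first entry of low weight. -/
theorem sum_tapeValue_low (ρ O : Op n) :
    ∑ t ∈ Finset.range (L.length + 1), ∑ P : PauliString n with IsLow L.length ℓ P,
      ∑ v ∈ Finset.range (256 ^ ℓ), tapeValue γ ℓ L ρ (pauliCoeff O) t P 1 v =
      Matrix.trace (ρ * truncated γ ℓ L O) := by
  have h1 : ∀ t ∈ Finset.range (L.length + 1), ∑ P : PauliString n with IsLow L.length ℓ P,
      ∑ v ∈ Finset.range (256 ^ ℓ), tapeValue γ ℓ L ρ (pauliCoeff O) t P 1 v =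
      ∑ q, (if IsLow L.length ℓ (q (Fin.ofNat _ t)) then
        ∏ s ∈ Finset.range t, if IsLow L.length ℓ (q (Fin.ofNat _ s)) then (0 : ℂ) else 1 else 0) *
          (pathTerm γ ℓ L ρ q * pauliCoeff O (q 0)) := by
    intro t ht
    have ht' : t ≤ L.length := by rw [Finset.mem_range] at ht; omega
    simp only [sum_tapeValue γ ℓ L ρ (pauliCoeff O) ht', one_mul]
    rw [Finset.sum_comm]
    refine Finset.sum_congr rfl fun q _ => ?_
    rw [Finset.sum_filter, Finset.sum_eq_single (q (Fin.ofNat _ t))]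
    · rw [if_pos rfl]
      split_ifs <;> simp
    · intro P _ hP
      rw [if_neg (Ne.symm hP), ite_self]
    · simp
  rw [Finset.sum_congr rfl h1, Finset.sum_comm, trace_mul_truncated]
  refine Finset.sum_congr rfl fun q _ => ?_
  rw [← Finset.sum_mul, sum_first_low fun t => IsLow L.length ℓ (q (Fin.ofNat _ t))]
  by_cases hq : q.weight ≤ ℓ
  · obtain ⟨t, ht, hlow⟩ := exists_isLow ℓ L q hq
    rw [Finset.prod_eq_zero (i := t) ht (by rw [if_pos hlow]), sub_zero, one_mul]
  · rw [pathTerm, if_neg hq]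
    ring

theorem pauliCoeff_sumOfPaulis (terms : List (PauliString n × ℂ)) (Q : PauliString n) :
    pauliCoeff (sumOfPaulis terms) Q = (terms.map fun x => x.2 * if x.1 = Q then 1 else 0).sum := by
  unfold sumOfPaulis
  induction terms with
  | nil => simp [pauliCoeff]
  | cons x l ih =>
    rw [List.map_cons, List.sum_cons, pauliCoeff_add, pauliCoeff_smul, pauliCoeff_toOp, ih]
    rfl

/-- From entry 0 there is nothing to do backwards, and by linearity the terms are treated one at a
time; repeated strings do no harm. -/
theorem sum_tapeValue_terms (ρ : Op n) (terms : List (PauliString n × ℂ)) :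
    (terms.map fun x => ∑ v ∈ Finset.range (256 ^ ℓ),
      tapeValue γ ℓ L ρ (fun _ => 1) 0 x.1 x.2 v).sum =
      Matrix.trace (ρ * truncated γ ℓ L (sumOfPaulis terms)) := by
  rw [trace_mul_truncated]
  simp only [sum_tapeValue γ ℓ L ρ (fun _ => 1) (Nat.zero_le L.length), pauliCoeff_sumOfPaulis]
  induction terms with
  | nil => simp
  | cons x l ih =>
    rw [List.map_cons, List.sum_cons, ih]
    simp only [List.map_cons, List.sum_cons, mul_add, Finset.sum_add_distrib]
    congr 1
    rw [Finset.mul_sum]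
    refine Finset.sum_congr rfl fun q _ => ?_
    have h0 : Fin.ofNat (L.length + 1) 0 = 0 := rfl
    rw [h0, Finset.range_zero, Finset.prod_empty]
    by_cases hq : q 0 = x.1
    · rw [if_pos hq, if_pos hq.symm]; ring
    · rw [if_neg hq, if_neg (Ne.symm hq)]; ring

end

/-! ## Encoding Pauli strings of low weight by numbers -/

/-- One step of the decoding of a Pauli string: the letter of qubit `j` is read off if the next
position recorded in the number is `j`. The components are the remaining number, the string and an
indicator of validity. -/
def startStep {n : ℕ} (x : ℕ × PauliString n × ℂ) (j : Fin n) : ℕ × PauliString n × ℂ :=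
  if x.1 ≠ 0 ∧ x.1 % n = j then
    (x.1 / n / 4, Function.update x.2.1 j (Fin.ofNat 4 (x.1 / n)),
      if Fin.ofNat 4 (x.1 / n) = 0 then 0 else x.2.2)
  else (x.1, Function.update x.2.1 j 0, x.2.2)

/-- The encoding that is inverted by `startStep`. -/
def encodePauli {n : ℕ} (P : PauliString n) : List (Fin n) → ℕ
  | [] => 0
  | j :: js => if P j = 0 then encodePauli P js else j + n * (P j + 4 * encodePauli P js)

section
variable {n : ℕ}

/-- The residue modulo `n` names a position still to come. Hence, in decoding, a residue equal to
the current qubit means that its letter was recorded. -/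
theorem encodePauli_mod (P : PauliString n) (js : List (Fin n)) (h : encodePauli P js ≠ 0) :
    ∃ j ∈ js, encodePauli P js % n = (j : ℕ) := by
  induction js with
  | nil => exact absurd rfl h
  | cons j js ih =>
    rw [encodePauli] at h ⊢
    split_ifs at h ⊢ with hP
    · obtain ⟨j', hj', h'⟩ := ih h
      exact ⟨j', List.mem_cons_of_mem _ hj', h'⟩
    · exact ⟨j, List.mem_cons_self, by rw [Nat.add_mul_mod_self_left, Nat.mod_eq_of_lt j.2]⟩

/-- A recorded letter costs a factor `n` for its position and a factor 4 for its value. -/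
theorem encodePauli_lt (P : PauliString n) (js : List (Fin n)) :
    encodePauli P js < (4 * n) ^ (js.countP fun j => P j ≠ 0) := by
  induction js with
  | nil => simp [encodePauli]
  | cons j js ih =>
    rw [encodePauli, List.countP_cons]
    split_ifs with h1 h2 h2
    · simp [h1] at h2
    · simpa using ih
    · have hj := j.2
      have hP := (P j).2
      rw [pow_succ']
      have h3 : (j : ℕ) + n * (P j + 4 * encodePauli P js) <
          4 * n * (encodePauli P js + 1) := by nlinarith
      exact h3.trans_le (Nat.mul_le_mul_left _ ih)
    · simp [h1] at h2

theorem foldl_startStep_apply (js : List (Fin n)) (x : ℕ × PauliString n × ℂ) (i : Fin n)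
    (hi : i ∉ js) : (js.foldl startStep x).2.1 i = x.2.1 i := by
  induction js generalizing x with
  | nil => rfl
  | cons j js ih =>
    rw [List.mem_cons, not_or] at hi
    rw [List.foldl_cons, ih _ hi.2, startStep]
    split_ifs <;> exact Function.update_of_ne hi.1 _ _

theorem foldl_startStep_valid (js : List (Fin n)) (x : ℕ × PauliString n × ℂ) :
    (js.foldl startStep x).2.2 = 0 ∨ (js.foldl startStep x).2.2 = x.2.2 := by
  induction js generalizing x with
  | nil => exact Or.inr rfl
  | cons j js ih =>
    rw [List.foldl_cons]
    rcases ih (startStep x j) with h | h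
    · exact Or.inl h
    · rw [h, startStep]
      split_ifs
      · exact Or.inl rfl
      · exact Or.inr rfl
      · exact Or.inr rfl

/-- Positions are recorded in increasing order, so one pass over the qubits recovers the string. A
recorded letter is nonzero, so the value 0 is free to mark the end of the code. -/
theorem foldl_startStep_encode (js : List (Fin n)) (hjs : js.Pairwise (· < ·))
    (P P₀ : PauliString n) (c : ℂ) :
    (js.foldl startStep (encodePauli P js, P₀, c)).1 = 0 ∧
      (js.foldl startStep (encodePauli P js, P₀, c)).2.2 = c ∧
      ∀ j ∈ js, (js.foldl startStep (encodePauli P js, P₀, c)).2.1 j = P j := by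
  induction js generalizing P₀ with
  | nil => simp [encodePauli]
  | cons j js ih =>
    rw [List.pairwise_cons] at hjs
    have hj : j ∉ js := fun h => lt_irrefl _ (hjs.1 j h)
    have hstep : startStep (encodePauli P (j :: js), P₀, c) j =
        (encodePauli P js, Function.update P₀ j (P j), c) := by
      rw [encodePauli]
      split_ifs with hP
      · rw [startStep, if_neg, hP]
        rintro ⟨h0, hm⟩
        obtain ⟨j', hj', h'⟩ := encodePauli_mod P js h0
        have : j' = j := Fin.ext (h'.symm.trans hm)
        exact hj (this ▸ hj')
      · have hn : 0 < n := j.pos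
        have h1 : ((j : ℕ) + n * (P j + 4 * encodePauli P js)) / n = P j + 4 * encodePauli P js :=
            by
          rw [Nat.add_mul_div_left _ _ hn, Nat.div_eq_of_lt j.2, zero_add]
        have h2 : ((j : ℕ) + n * (P j + 4 * encodePauli P js)) % n = j := by
          rw [Nat.add_mul_mod_self_left, Nat.mod_eq_of_lt j.2]
        have h3 : (j : ℕ) + n * (P j + 4 * encodePauli P js) ≠ 0 := by
          have : 0 < (P j : ℕ) := Nat.pos_of_ne_zero fun h => hP (Fin.ext h)
          positivity
        have h4 : Fin.ofNat 4 ((P j : ℕ) + 4 * encodePauli P js) = P j := by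
          ext; simp [Fin.ofNat]
        have h5 : ((P j : ℕ) + 4 * encodePauli P js) / 4 = encodePauli P js := by omega
        rw [startStep, if_pos ⟨h3, h2⟩]
        simp only [h1, h4, h5, if_neg hP]
    rw [List.foldl_cons, hstep]
    obtain ⟨h1, h2, h3⟩ := ih hjs.2 (Function.update P₀ j (P j))
    refine ⟨h1, h2, fun i hi => ?_⟩
    rcases List.mem_cons.1 hi with rfl | hi
    · rw [foldl_startStep_apply _ _ _ hj]
      exact Function.update_self _ _ _
    · exact h3 i hi

/-- Conversely, a number that is used up without producing an identity letter is the code of the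
decoded string. So no string is produced twice. -/
theorem encode_foldl_startStep (js : List (Fin n)) (hjs : js.Pairwise (· < ·))
    (x : ℕ × PauliString n × ℂ) (h0 : (js.foldl startStep x).1 = 0)
    (hc : (js.foldl startStep x).2.2 ≠ 0) :
    x.1 = encodePauli (js.foldl startStep x).2.1 js := by
  induction js generalizing x with
  | nil => exact h0
  | cons j js ih =>
    rw [List.pairwise_cons] at hjs
    have hj : j ∉ js := fun h => lt_irrefl _ (hjs.1 j h)
    rw [List.foldl_cons] at h0 hc ⊢
    have hi := ih hjs.2 _ h0 hc
    have hc' : (startStep x j).2.2 ≠ 0 := fun h => by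
      rcases foldl_startStep_valid js (startStep x j) with h' | h'
      · exact hc h'
      · exact hc (h'.trans h)
    rw [encodePauli, ← hi, foldl_startStep_apply _ _ _ hj]
    unfold startStep at hc' ⊢
    by_cases h1 : x.1 ≠ 0 ∧ x.1 % n = j
    · rw [if_pos h1] at hc' ⊢
      simp only [Function.update_self] at hc' ⊢
      have ha : Fin.ofNat 4 (x.1 / n) ≠ 0 := fun h => hc' (if_pos h)
      have hv : ((Fin.ofNat 4 (x.1 / n) : Fin 4) : ℕ) = x.1 / n % 4 := rfl
      rw [if_neg ha, hv, ← h1.2, Nat.mod_add_div, Nat.mod_add_div]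
    · rw [if_neg h1]
      simp only [Function.update_self, if_true]

theorem weight_eq_countP (P : PauliString n) :
    P.weight = (List.finRange n).countP fun j => P j ≠ 0 := by
  rw [PauliString.weight, List.countP_eq_length_filter,
    ← List.toFinset_card_of_nodup ((List.nodup_finRange n).filter _)]
  congr 1
  ext j
  simp

/-- Summation over the Pauli strings of low weight, by decoding numbers. -/
theorem sum_decode (d ℓ N : ℕ) (hn : 1 ≤ n) (hN : (4 * n) ^ (ℓ / (d + 1)) ≤ N)
    (F : PauliString n → ℂ → ℂ) (hF : ∀ P, F P 0 = 0) :
    (∑ u ∈ Finset.range N,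
      F ((List.finRange n).foldl startStep (u, 0, 1)).2.1
        (if ((List.finRange n).foldl startStep (u, 0, 1)).1 = 0 ∧
          IsLow d ℓ ((List.finRange n).foldl startStep (u, 0, 1)).2.1 then
          ((List.finRange n).foldl startStep (u, 0, 1)).2.2 else 0)) =
      ∑ P : PauliString n with IsLow d ℓ P, F P 1 := by
  have hs : (List.finRange n).Pairwise (· < ·) := List.pairwise_lt_finRange n
  have hdec : ∀ P : PauliString n,
      ((List.finRange n).foldl startStep (encodePauli P (List.finRange n), 0, (1 : ℂ))).2.1 = P :=
    fun P => funext fun j =>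
      (foldl_startStep_encode _ hs P 0 1).2.2 j (List.mem_finRange j)
  have hinj : Set.InjOn (fun P : PauliString n => encodePauli P (List.finRange n))
      (Finset.univ.filter fun P => IsLow d ℓ P : Finset (PauliString n)) := fun P _ Q _ h => by
    rw [← hdec P, ← hdec Q]
    simp only at h
    rw [h]
  symm
  calc _ = ∑ u ∈ (Finset.univ.filter fun P : PauliString n => IsLow d ℓ P).image
        (fun P => encodePauli P (List.finRange n)),
        F ((List.finRange n).foldl startStep (u, 0, 1)).2.1
        (if ((List.finRange n).foldl startStep (u, 0, 1)).1 = 0 ∧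
          IsLow d ℓ ((List.finRange n).foldl startStep (u, 0, 1)).2.1 then
          ((List.finRange n).foldl startStep (u, 0, 1)).2.2 else 0) := by
        rw [Finset.sum_image hinj]
        refine Finset.sum_congr rfl fun P hP => ?_
        rw [hdec, if_pos ⟨(foldl_startStep_encode _ hs P 0 1).1, (Finset.mem_filter.1 hP).2⟩,
          (foldl_startStep_encode _ hs P 0 1).2.1]
    _ = _ := by
        refine Finset.sum_subset ?_ ?_
        · intro u hu
          obtain ⟨P, hP, rfl⟩ := Finset.mem_image.1 hu
          have hw : P.weight ≤ ℓ / (d + 1) :=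
            (Nat.le_div_iff_mul_le (by omega)).2 (by
              have := (Finset.mem_filter.1 hP).2
              rw [IsLow, mul_comm] at this
              exact this)
          refine Finset.mem_range.2 ((encodePauli_lt P _).trans_le (le_trans ?_ hN))
          rw [← weight_eq_countP]
          exact Nat.pow_le_pow_right (by omega) hw
        -- A number that is not the code of a light string is either rejected or decoded with the
        -- factor 0.
        · intro u _ hu
          split_ifs with h
          · by_cases hc : ((List.finRange n).foldl startStep (u, 0, (1 : ℂ))).2.2 = 0
            · rw [hc, hF]
            · refine absurd (Finset.mem_image.2 ⟨_, Finset.mem_filter.2 ⟨Finset.mem_univ _, h.2⟩,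
                ?_⟩) hu
              exact (encode_foldl_startStep _ hs (u, 0, (1 : ℂ)) h.1 hc).symm
          · exact hF _

end

/-! ## Reasoning about programs -/

/-- The kind (register, array, scalar register, scalar array) and the number of the memory object
that an instruction overwrites. -/
def Instr.target : Instr → ℕ × ℕ
  | .const i _ => (0, i)
  | .add i _ _ => (0, i)
  | .sub i _ _ => (0, i)
  | .load i _ _ => (0, i)
  | .query i _ _ => (0, i)
  | .store k _ _ => (1, k)
  | .sconst i _ _ => (2, i)
  | .sadd i _ _ => (2, i)
  | .ssub i _ _ => (2, i)
  | .smul i _ _ => (2, i)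
  | .sdiv i _ _ => (2, i)
  | .sconj i _ => (2, i)
  | .sload i _ _ => (2, i)
  | .squery i _ _ => (2, i)
  | .sstore k _ _ => (3, k)

/-- The program does not overwrite the memory object with the given kind and number. -/
def Program.avoids (c k : ℕ) : Program → Bool
  | .skip => true
  | .step i => !(Nat.beq i.target.1 c && Nat.beq i.target.2 k)
  | .seq p q => p.avoids c k && q.avoids c k
  | .branch _ p q => p.avoids c k && q.avoids c k
  | .loop _ p => p.avoids c k

/-- The memories agree on everything that the program does not overwrite. -/
structure Agree (p : Program) (s s' : State) : Prop where
  reg : ∀ i, p.avoids 0 i = true → s'.reg i = s.reg i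
  arr : ∀ k, p.avoids 1 k = true → s'.arr k = s.arr k
  sreg : ∀ i, p.avoids 2 i = true → s'.sreg i = s.sreg i
  sarr : ∀ k, p.avoids 3 k = true → s'.sarr k = s.sarr k

theorem Agree.refl (p : Program) (s : State) : Agree p s s :=
  ⟨fun _ _ => rfl, fun _ _ => rfl, fun _ _ => rfl, fun _ _ => rfl⟩

theorem Agree.trans {p q r : Program} {s s' s'' : State} (h : Agree p s s') (h' : Agree q s' s'')
    (hr : ∀ c k, r.avoids c k = true → p.avoids c k = true ∧ q.avoids c k = true) :
    Agree r s s'' :=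
  ⟨fun i hi => (h'.reg i (hr _ _ hi).2).trans (h.reg i (hr _ _ hi).1),
    fun i hi => (h'.arr i (hr _ _ hi).2).trans (h.arr i (hr _ _ hi).1),
    fun i hi => (h'.sreg i (hr _ _ hi).2).trans (h.sreg i (hr _ _ hi).1),
    fun i hi => (h'.sarr i (hr _ _ hi).2).trans (h.sarr i (hr _ _ hi).1)⟩

theorem Agree.mono {p r : Program} {s s' : State} (h : Agree p s s')
    (hr : ∀ c k, r.avoids c k = true → p.avoids c k = true) : Agree r s s' :=
  ⟨fun i hi => h.reg i (hr _ _ hi), fun i hi => h.arr i (hr _ _ hi),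
    fun i hi => h.sreg i (hr _ _ hi), fun i hi => h.sarr i (hr _ _ hi)⟩

/-! ### Reading a memory after an update -/

section projections
variable (s : State) (i k a v j : ℕ) (x : ℂ)

@[simp] theorem State.setReg_reg : (s.setReg i v).reg j = if j = i then v else s.reg j :=
  Function.update_apply _ _ _ _
@[simp] theorem State.setReg_arr : (s.setReg i v).arr = s.arr := rfl
@[simp] theorem State.setReg_sreg : (s.setReg i v).sreg = s.sreg := rfl
@[simp] theorem State.setReg_sarr : (s.setReg i v).sarr = s.sarr := rfl
@[simp] theorem State.setSreg_reg : (s.setSreg i x).reg = s.reg := rfl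
@[simp] theorem State.setSreg_arr : (s.setSreg i x).arr = s.arr := rfl
@[simp] theorem State.setSreg_sreg : (s.setSreg i x).sreg j = if j = i then x else s.sreg j :=
  Function.update_apply _ _ _ _
@[simp] theorem State.setSreg_sarr : (s.setSreg i x).sarr = s.sarr := rfl
@[simp] theorem State.setArr_reg : (s.setArr k a v).reg = s.reg := rfl
@[simp] theorem State.setArr_arr : (s.setArr k a v).arr j =
    if j = k then Function.update (s.arr k) a v else s.arr j := Function.update_apply _ _ _ _
@[simp] theorem State.setArr_sreg : (s.setArr k a v).sreg = s.sreg := rfl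
@[simp] theorem State.setArr_sarr : (s.setArr k a v).sarr = s.sarr := rfl
@[simp] theorem State.setSarr_reg : (s.setSarr k a x).reg = s.reg := rfl
@[simp] theorem State.setSarr_arr : (s.setSarr k a x).arr = s.arr := rfl
@[simp] theorem State.setSarr_sreg : (s.setSarr k a x).sreg = s.sreg := rfl
@[simp] theorem State.setSarr_sarr : (s.setSarr k a x).sarr j =
    if j = k then Function.update (s.sarr k) a x else s.sarr j := Function.update_apply _ _ _ _

end projections

/-- The frame rule. What a program leaves alone is computed from its text, so the side conditions
below are mostly settled by `rfl`. -/
theorem Exec.agree {I : Input} {τ : ℕ} {p : Program} {s s' : State} {T : ℕ}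
    (h : Exec I τ p s s' T) : Agree p s s' := by
  induction h with
  | skip s => exact Agree.refl _ s
  | step c s =>
    have key : ∀ c' k, (Program.step c).avoids c' k = true →
        ¬ (c.target.1 = c' ∧ c.target.2 = k) := by
      intro c' k h
      rintro ⟨rfl, rfl⟩
      simp [Program.avoids] at h
    cases c <;> refine ⟨fun i hi => ?_, fun i hi => ?_, fun i hi => ?_, fun i hi => ?_⟩ <;>
      have hk := key _ _ hi <;> simp only [Instr.target, true_and] at hk <;>
      simp only [Instr.exec, State.setReg_reg, State.setReg_arr, State.setReg_sreg,
        State.setReg_sarr, State.setSreg_reg, State.setSreg_arr, State.setSreg_sreg,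
        State.setSreg_sarr, State.setArr_reg, State.setArr_arr, State.setArr_sreg,
        State.setArr_sarr, State.setSarr_reg, State.setSarr_arr, State.setSarr_sreg,
        State.setSarr_sarr] <;> exact if_neg (Ne.symm hk)
  | seq _ _ ih1 ih2 => exact ih1.trans ih2 fun c k h => (Bool.and_eq_true _ _).mp h
  | branch_true _ _ ih => exact ih.mono fun c k h => ((Bool.and_eq_true _ _).mp h).1
  | branch_false _ _ ih => exact ih.mono fun c k h => ((Bool.and_eq_true _ _).mp h).2
  | loop_done _ => exact Agree.refl _ _
  | loop_next _ _ _ ih1 ih2 => exact ih1.trans ih2 fun c k h => ⟨h, h⟩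

/-- Started in the memory `s`, the program halts within `B` steps in a memory satisfying `Q`. -/
def Halts (I : Input) (τ : ℕ) (p : Program) (s : State) (B : ℕ) (Q : State → Prop) : Prop :=
  ∃ s' T, Exec I τ p s s' T ∧ T ≤ B ∧ Q s'

/-- Perform a list of instructions. -/
def execs (I : Input) : List Instr → State → State
  | [], s => s
  | c :: l, s => execs I l (c.exec I s)

/-- The time taken by a list of instructions. -/
def costs (I : Input) (τ : ℕ) : List Instr → State → ℕ
  | [], _ => 0
  | c :: l, s => c.cost τ s + costs I τ l (c.exec I s)

/-- Straight-line programs. -/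
def block : List Instr → Program
  | [] => .skip
  | c :: l => .seq (.step c) (block l)

/-- The programs `f a`, one after the other. -/
def seqOver {α : Type} (f : α → Program) : List α → Program
  | [] => .skip
  | a :: l => .seq (f a) (seqOver f l)

/-! ### Rules for total correctness with time bounds -/

section
variable {I : Input} {τ : ℕ} {p q : Program} {s : State} {B B' : ℕ} {Q R : State → Prop}

/-- The new postcondition may use the frame relation, so a specification has to mention only what is
overwritten. -/
theorem Halts.mono (h : Halts I τ p s B Q) (hB : B ≤ B') (hQ : ∀ s', Agree p s s' → Q s' → R s') :
    Halts I τ p s B' R := by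
  obtain ⟨s', T, h1, h2, h3⟩ := h
  exact ⟨s', T, h1, h2.trans hB, hQ s' h1.agree h3⟩

theorem Halts.le (h : Halts I τ p s B Q) (hB : B ≤ B') : Halts I τ p s B' Q :=
  h.mono hB fun _ _ h => h

theorem Halts.skip (h : Q s) : Halts I τ .skip s 0 Q := ⟨s, 0, Exec.skip s, le_rfl, h⟩

theorem Halts.seq (h : Halts I τ p s B R)
    (h' : ∀ s', Agree p s s' → R s' → Halts I τ q s' B' Q) :
    Halts I τ (.seq p q) s (B + B') Q := by
  obtain ⟨s', T, h1, h2, h3⟩ := h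
  obtain ⟨s'', T', h4, h5, h6⟩ := h' s' h1.agree h3
  exact ⟨s'', T + T', h1.seq h4, Nat.add_le_add h2 h5, h6⟩

theorem Halts.branch {b : Test} (h : b.holds s → Halts I τ p s B Q)
    (h' : ¬ b.holds s → Halts I τ q s B' Q) :
    Halts I τ (.branch b p q) s (B + B' + 1) Q := by
  by_cases hb : b.holds s
  · obtain ⟨s', T, h1, h2, h3⟩ := h hb
    exact ⟨s', T + 1, .branch_true hb h1, by omega, h3⟩
  · obtain ⟨s', T, h1, h2, h3⟩ := h' hb
    exact ⟨s', T + 1, .branch_false hb h1, by omega, h3⟩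

theorem Halts.block {l : List Instr} (h : Q (execs I l s)) (hB : costs I τ l s ≤ B) :
    Halts I τ (block l) s B Q := by
  have key : ∀ (l : List Instr) (s : State),
      Exec I τ (NoisyCircuit.block l) s (execs I l s) (costs I τ l s) := by
    intro l
    induction l with
    | nil => exact fun s => Exec.skip s
    | cons c l ih => exact fun s => (Exec.step c s).seq (ih _)
  exact ⟨_, _, key l s, hB, h⟩

/-- The number of rounds is known in advance and indexes the invariant, which yields termination and
time at once. The extra steps are the tests, the last of which fails. -/
theorem Halts.loop {b : Test} (N : ℕ) (Inv : ℕ → State → Prop) (h0 : Inv 0 s)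
    (hbody : ∀ i < N, ∀ s', Agree (.loop b p) s s' → Inv i s' →
      b.holds s' ∧ Halts I τ p s' B (Inv (i + 1)))
    (hend : ∀ s', Agree (.loop b p) s s' → Inv N s' → ¬ b.holds s' ∧ Q s') :
    Halts I τ (.loop b p) s (N * (B + 1) + 1) Q := by
  have key : ∀ k i s', i + k = N → Agree (.loop b p) s s' → Inv i s' →
      Halts I τ (.loop b p) s' (k * (B + 1) + 1) Q := by
    intro k
    induction k with
    | zero =>
      intro i s' hi ha hinv
      obtain rfl : i = N := by omega
      obtain ⟨h1, h2⟩ := hend s' ha hinv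
      exact ⟨s', 1, .loop_done h1, by omega, h2⟩
    | succ k ih =>
      intro i s' hi ha hinv
      obtain ⟨hb, s1, T, h1, h2, h3⟩ := hbody i (by omega) s' ha hinv
      have ha1 : Agree (.loop b p) s s1 := ha.trans h1.agree fun c k h => ⟨h, h⟩
      obtain ⟨s2, T', h4, h5, h6⟩ := ih (i + 1) s1 (by omega) ha1 h3
      exact ⟨s2, T + T' + 1, .loop_next hb h1 h4, by linarith, h6⟩
  exact key N 0 s (by omega) (Agree.refl _ _) h0

/-- The invariant is indexed by the part of the list still to be processed. -/
theorem Halts.seqOver {α : Type} {f : α → Program} {l : List α} (Inv : List α → State → Prop)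
    (h0 : Inv l s) (hstep : ∀ a l' s', Inv (a :: l') s' → Halts I τ (f a) s' B (Inv l'))
    (hend : ∀ s', Inv [] s' → Q s') : Halts I τ (seqOver f l) s (l.length * B) Q := by
  induction l generalizing s with
  | nil => rw [List.length_nil, zero_mul]; exact Halts.skip (hend s h0)
  | cons a l ih =>
    have := Halts.seq (q := NoisyCircuit.seqOver f l) (hstep a l s h0) fun s' _ h => ih h
    exact this.mono (by rw [List.length_cons]; linarith) fun _ _ h => h

end

/-! ## The memory layout

Registers `0` to `15` hold constants: `0`, `1`, the number of qubits `n`, the depth `d`, the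
threshold `ℓ`, the number of tapes, the number of starting points, `d + 1`, the number of starting
layers, `n + 1`, `2`, `3`, `7`, `4`, `5`, `6`. Scalar register `0` accumulates the output, scalar
registers `1` to `4` hold `e^{-γ}`, `ε`, `1/4` and `0`. The scalar arrays `0` to `3` hold the
    entries
of the single-qubit Pauli matrices. Array `0` holds the string at which a path is started, array `1`
the current string (with the letter of qubit `j` in cell `j + 1`), array `2` query words. -/

/-- The constants that the main part of the program relies on. -/
structure Env {n : ℕ} (γ : ℝ) (L : Circuit n) (ℓ : ℕ) (s : State) : Prop where
  zero : s.reg 0 = 0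
  one : s.reg 1 = 1
  qubits : s.reg 2 = n
  depth : s.reg 3 = L.length
  threshold : s.reg 4 = ℓ
  depth_succ : s.reg 7 = L.length + 1
  qubits_succ : s.reg 9 = n + 1
  two : s.reg 10 = 2
  three : s.reg 11 = 3
  seven : s.reg 12 = 7
  four : s.reg 13 = 4
  five : s.reg 14 = 5
  six : s.reg 15 = 6
  damping : s.sreg 1 = (Real.exp (-γ) : ℂ)
  quarter : s.sreg 3 = 1 / 4
  szero : s.sreg 4 = 0
  table : ∀ (a : Fin 4) (x y : Fin 2), s.sarr (2 * x + y) a = pauli1 a x y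

/-- The program does not overwrite the constants. -/
def Program.envFree (p : Program) : Bool :=
  [0, 1, 2, 3, 4, 7, 9, 10, 11, 12, 13, 14, 15].all (fun i => p.avoids 0 i) &&
    [1, 3, 4].all (fun i => p.avoids 2 i) && [0, 1, 2, 3].all fun i => p.avoids 3 i

theorem Env.of_agree {n : ℕ} {γ : ℝ} {L : Circuit n} {ℓ : ℕ} {p : Program} {s s' : State}
    (h : Env γ L ℓ s) (ha : Agree p s s') (hp : p.envFree = true) : Env γ L ℓ s' := by
  simp only [Program.envFree, List.all_cons, List.all_nil, Bool.and_true, Bool.and_eq_true] at hp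
  obtain ⟨⟨⟨h0, h1, h2, h3, h4, h7, h9, h10, h11, h12, h13, h14, h15⟩, k1, k3, k4⟩,
    l0, l1, l2, l3⟩ := hp
  refine ⟨(ha.reg _ h0).trans h.zero, (ha.reg _ h1).trans h.one, (ha.reg _ h2).trans h.qubits,
    (ha.reg _ h3).trans h.depth, (ha.reg _ h4).trans h.threshold,
    (ha.reg _ h7).trans h.depth_succ, (ha.reg _ h9).trans h.qubits_succ,
    (ha.reg _ h10).trans h.two, (ha.reg _ h11).trans h.three, (ha.reg _ h12).trans h.seven,
    (ha.reg _ h13).trans h.four, (ha.reg _ h14).trans h.five, (ha.reg _ h15).trans h.six,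
    (ha.sreg _ k1).trans h.damping, (ha.sreg _ k3).trans h.quarter, (ha.sreg _ k4).trans h.szero,
    fun a x y => ?_⟩
  rw [← h.table a x y]
  fin_cases x <;> fin_cases y
  · exact congrFun (ha.sarr 0 l0) _
  · exact congrFun (ha.sarr 1 l1) _
  · exact congrFun (ha.sarr 2 l2) _
  · exact congrFun (ha.sarr 3 l3) _

/-- The input describes the circuit and the state. -/
structure Presents {n : ℕ} (I : Input) (L : Circuit n) (ρ : Op n) : Prop where
  size : ∀ u < L.length, I.nat [2, u] = (gatesAt L u).length
  left : ∀ u g G, (gatesAt L u)[g]? = some G → I.nat [3, u, g] = (G.q₁ : ℕ)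
  right : ∀ u g G, (gatesAt L u)[g]? = some G → I.nat [4, u, g] = (G.q₂ : ℕ)
  entry : ∀ u g G (a b : Fin 2 × Fin 2), (gatesAt L u)[g]? = some G →
    I.scalar [3, u, g, a.1, a.2, b.1, b.2] = G.mat a b
  state : ∀ w, I.scalar (4 :: w) = Matrix.trace (ρ * (decodePauli n w).toOp)

/-- Array `k` holds a Pauli string. -/
def Stores {n : ℕ} (k : ℕ) (P : PauliString n) (s : State) : Prop :=
  ∀ j : Fin n, s.arr k (j + 1) = (P j : ℕ)

theorem Stores.of_arr_eq {n : ℕ} {k : ℕ} {P : PauliString n} {s s' : State} (h : Stores k P s)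
    (ha : s'.arr k = s.arr k) : Stores k P s' := fun j => by rw [ha]; exact h j

/-! ## Division -/

/-- Divide register `x` by register `b`: the remainder goes to register `34`, the quotient to
register `35`. -/
def divMod (x b : ℕ) : Program :=
  .seq (block [.add 34 x 1, .const 35 0])
    (.seq (.loop (.lt b 34) (block [.sub 34 34 b, .add 35 35 1])) (block [.sub 34 34 1]))

/-- Repeated subtraction, in time linear in the dividend. Tests are strict, so register `34` carries
the remainder plus one: b < r + 1 expresses b ≤ r. -/
theorem divMod_spec {I : Input} {τ : ℕ} {s : State} {x b : ℕ} (h1 : s.reg 1 = 1)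
    (hb : 1 ≤ s.reg b) (h34 : b ≠ 34) (h35 : b ≠ 35) :
    Halts I τ (divMod x b) s (3 * s.reg x + 4)
      fun s' => s'.reg 34 = s.reg x % s.reg b ∧ s'.reg 35 = s.reg x / s.reg b := by
  set X := s.reg x with hX
  set D := s.reg b with hD
  have hle : X / D ≤ X := Nat.div_le_self _ _
  refine Halts.le (Halts.seq (R := fun s' => s'.reg 34 = X + 1 ∧ s'.reg 35 = 0 ∧ s'.reg b = D ∧
    s'.reg 1 = 1) (B := 2) (Halts.block ?_ ?_) fun s1 _ hs1 => Halts.seq (B := (X / D) * 3 + 1)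
      (R := fun s' => s'.reg 34 = X % D + 1 ∧ s'.reg 35 = X / D ∧ s'.reg 1 = 1)
      (Halts.loop (X / D) (fun i s' => s'.reg 34 + i * D = X + 1 ∧ s'.reg 35 = i ∧ s'.reg b = D ∧
        s'.reg 1 = 1) ?_ ?_ ?_)
      fun s2 _ hs2 => Halts.block (B := 1) ?_ ?_) ?_
  · simp [execs, Instr.exec, h1, h34, h35, ← hX, ← hD]
  · simp [costs, Instr.cost]
  · simpa using hs1
  · rintro i hi s' _ ⟨h2, h3, h4, h5⟩
    have hm : (i + 1) * D ≤ X := (Nat.le_div_iff_mul_le (by omega)).1 hi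
    have hm' : (i + 1) * D = i * D + D := by ring
    refine ⟨?_, Halts.block (B := 2) ?_ ?_⟩
    · show s'.reg b < s'.reg 34
      omega
    · simp only [execs, Instr.exec, State.setReg_reg, h34, h35, h3, h4, h5, if_true, if_false]
      norm_num
      omega
    · simp [costs, Instr.cost]
  · rintro s' _ ⟨h2, h3, h4, h5⟩
    have hdm : X % D + D * (X / D) = X := Nat.mod_add_div X D
    have hlt : X % D < D := Nat.mod_lt _ (by omega)
    have hc : X / D * D = D * (X / D) := mul_comm _ _
    refine ⟨?_, by omega, h3, h5⟩
    show ¬ s'.reg b < s'.reg 34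
    omega
  · simp [execs, Instr.exec, hs2.1, hs2.2.1, hs2.2.2]
  · simp [costs, Instr.cost]
  · omega

/-! ## Amplitudes of gates -/

/-- Add to scalar register `10` the term with indices `x`, `y`, `z`, `w` of the trace that defines
the amplitude of a gate. The letters are in the registers `pa`, `pb` (before the gate) and `qa`,
    `qb`
(after the gate). -/
def ampTerm (pa pb qa qb : ℕ) (x y z w : Fin 2 × Fin 2) : Program :=
  block [.store 2 11 z.1, .store 2 13 z.2, .store 2 14 y.1, .store 2 15 y.2, .squery 11 2 12,
    .sconj 11 11, .store 2 11 w.1, .store 2 13 w.2, .store 2 14 x.1, .store 2 15 x.2,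
    .squery 12 2 12, .sload 13 (2 * x.1 + y.1) qa, .sload 14 (2 * x.2 + y.2) qb,
    .sload 15 (2 * z.1 + w.1) pa, .sload 16 (2 * z.2 + w.2) pb,
    .smul 11 11 12, .smul 13 13 14, .smul 15 15 16, .smul 11 11 13, .smul 11 11 15,
    .sadd 10 10 11]

/-- The indices of two-qubit matrices. -/
def pairs : List (Fin 2 × Fin 2) := [(0, 0), (0, 1), (1, 0), (1, 1)]

/-- Compute the amplitude of the gate whose layer and number are in the query word, in scalar
register `10`. -/
def ampProg (pa pb qa qb : ℕ) : Program :=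
  .seq (block [.sconst 10 0 0])
    (.seq (seqOver (fun x => seqOver (fun y => seqOver (fun z => seqOver (fun w =>
      ampTerm pa pb qa qb x y z w) pairs) pairs) pairs) pairs) (block [.smul 10 10 3]))

theorem sum_pairs (f : Fin 2 × Fin 2 → ℂ) : (pairs.map f).sum = ∑ x, f x := by
  rw [Fintype.sum_prod_type]
  simp [pairs, Fin.sum_univ_two, add_assoc]

/-- What the computation of an amplitude relies on. -/
structure AmpReady {n : ℕ} (γ : ℝ) (L : Circuit n) (ℓ u g : ℕ) (r : Fin 4 → ℕ)
    (a b : Fin 4 × Fin 4) (s : State) : Prop where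
  env : Env γ L ℓ s
  cell₀ : s.arr 2 0 = 3
  cell₁ : s.arr 2 1 = u
  cell₂ : s.arr 2 2 = g
  reg₀ : s.reg (r 0) = a.1
  reg₁ : s.reg (r 1) = a.2
  reg₂ : s.reg (r 2) = b.1
  reg₃ : s.reg (r 3) = b.2

section
variable {n : ℕ} {γ : ℝ} {L : Circuit n} {ℓ : ℕ} {I : Input} {τ : ℕ} {ρ : Op n}

theorem ampTerm_spec (hI : Presents I L ρ) {u g : ℕ} {G : Gate n}
    (hG : (gatesAt L u)[g]? = some G) {r : Fin 4 → ℕ} {a b : Fin 4 × Fin 4} {s : State}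
    (hs : AmpReady γ L ℓ u g r a b s) (x y z w : Fin 2 × Fin 2) :
    Halts I τ (ampTerm (r 0) (r 1) (r 2) (r 3) x y z w) s (2 * τ + 33) fun s' =>
      AmpReady γ L ℓ u g r a b s' ∧ s'.sreg 10 = s.sreg 10 +
        pauli2 b x y * star (G.mat z y) * pauli2 a z w * G.mat w x := by
  have he := hs.env
  -- Registers `0` and `1` contain their own numbers, so a bit can name the register that holds it.
  have hbit : ∀ t : Fin 2, s.reg (t : ℕ) = t := fun t => by
    fin_cases t
    · exact he.zero
    · exact he.one
  have hw1 := hI.entry u g G z y hG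
  have hw2 := hI.entry u g G w x hG
  refine Halts.mono (Q := fun s' => s'.arr 2 0 = 3 ∧ s'.arr 2 1 = u ∧ s'.arr 2 2 = g ∧
    s'.sreg 10 = s.sreg 10 + pauli2 b x y * star (G.mat z y) * pauli2 a z w * G.mat w x)
    (Halts.block ?_ ?_) le_rfl fun s' ha h => ⟨⟨he.of_agree ha rfl, h.1, h.2.1, h.2.2.1,
      (ha.reg _ rfl).trans hs.reg₀, (ha.reg _ rfl).trans hs.reg₁, (ha.reg _ rfl).trans hs.reg₂,
      (ha.reg _ rfl).trans hs.reg₃⟩, h.2.2.2⟩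
  -- Registers `11`, `13`, `14`, `15` hold 3, 4, 5, 6, the cells of the query word that receive the
  -- two index pairs; register `12` holds its length 7.
  · simp [execs, Instr.exec, he.three, he.four, he.five, he.six, he.seven, hbit, State.word,
      List.range_succ, hs.cell₀, hs.cell₁, hs.cell₂, hw1, hw2, hs.reg₀, hs.reg₁, hs.reg₂, hs.reg₃,
      he.table, pauli2]
    ring
  · simp [costs, Instr.cost, Instr.exec, he.seven]
    omega

/-- The result of adding `f` to scalar register `10` over a list of indices. -/
theorem seqOver_amp_spec {α : Type} {u g : ℕ} {r : Fin 4 → ℕ} {a b : Fin 4 × Fin 4}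
    {p : α → Program} {f : α → ℂ} {B : ℕ}
    (h : ∀ i s, AmpReady γ L ℓ u g r a b s → Halts I τ (p i) s B fun s' =>
      AmpReady γ L ℓ u g r a b s' ∧ s'.sreg 10 = s.sreg 10 + f i)
    (l : List α) {s : State} (hs : AmpReady γ L ℓ u g r a b s) :
    Halts I τ (seqOver p l) s (l.length * B) fun s' =>
      AmpReady γ L ℓ u g r a b s' ∧ s'.sreg 10 = s.sreg 10 + (l.map f).sum := by
  refine Halts.seqOver (fun l' s' => AmpReady γ L ℓ u g r a b s' ∧
    s'.sreg 10 + (l'.map f).sum = s.sreg 10 + (l.map f).sum) ⟨hs, rfl⟩ ?_ ?_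
  · rintro i l' s' ⟨h1, h2⟩
    refine (h i s' h1).mono le_rfl fun s'' _ h3 => ⟨h3.1, ?_⟩
    rw [h3.2, ← h2, List.map_cons, List.sum_cons, add_assoc]
  · rintro s' ⟨h1, h2⟩
    exact ⟨h1, by simpa using h2⟩

theorem ampProg_spec (hI : Presents I L ρ) {u g : ℕ} {G : Gate n}
    (hG : (gatesAt L u)[g]? = some G) {r : Fin 4 → ℕ} {a b : Fin 4 × Fin 4} {s : State}
    (hs : AmpReady γ L ℓ u g r a b s) :
    Halts I τ (ampProg (r 0) (r 1) (r 2) (r 3)) s (512 * τ + 8450) fun s' =>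
      s'.sreg 10 = amplitude2 G.mat a b := by
  -- The trace has 4⁴ terms of 2τ + 33 steps each; one step clears the accumulator and one divides
  -- by 4.
  refine Halts.le (Halts.seq (B := 1) (B' := 4 * (4 * (4 * (4 * (2 * τ + 33)))) + 1)
    (R := fun s' => AmpReady γ L ℓ u g r a b s' ∧ s'.sreg 10 = 0) ?_
    fun s1 _ hs1 => Halts.seq (R := fun s' => AmpReady γ L ℓ u g r a b s' ∧
      s'.sreg 10 = amplitude2 G.mat a b * 4) ?_ fun s2 _ hs2 => Halts.block ?_ ?_) (by omega)
  · refine Halts.mono (Q := fun s' => s'.sreg 10 = 0)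
      (Halts.block (by simp [execs, Instr.exec]) (by simp [costs, Instr.cost])) le_rfl
      fun s' ha h => ⟨⟨hs.env.of_agree ha rfl, ?_, ?_, ?_, (ha.reg _ rfl).trans hs.reg₀,
        (ha.reg _ rfl).trans hs.reg₁, (ha.reg _ rfl).trans hs.reg₂,
        (ha.reg _ rfl).trans hs.reg₃⟩, h⟩ <;> rw [ha.arr 2 rfl]
    exacts [hs.cell₀, hs.cell₁, hs.cell₂]
  · refine (seqOver_amp_spec (fun x s hs => seqOver_amp_spec (fun y s hs => seqOver_amp_spec
      (fun z s hs => seqOver_amp_spec (fun w s hs => ampTerm_spec hI hG hs x y z w) pairs hs)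
        pairs hs) pairs hs) pairs hs1.1).mono le_rfl fun s' _ h => ⟨h.1, ?_⟩
    rw [h.2, hs1.2, zero_add, amplitude2, div_mul_cancel₀ _ (by norm_num)]
    simp only [sum_pairs, Matrix.trace, Matrix.diag_apply, Matrix.mul_apply,
      Matrix.conjTranspose_apply, Finset.sum_mul]
    refine Finset.sum_congr rfl fun x _ => ?_
    rw [Finset.sum_comm]
    exact (Finset.sum_congr rfl fun z _ => Finset.sum_comm).trans Finset.sum_comm
  · simp only [execs, Instr.exec, State.setSreg_sreg, if_true, hs2.2, hs2.1.env.quarter]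
    ring
  · simp [costs, Instr.cost]

end

/-! ## Propagation by the machine -/

/-- Array `1`, register `20` and scalar register `9` hold the current string, tape and amplitude. -/
structure Running {n : ℕ} (γ : ℝ) (L : Circuit n) (ℓ : ℕ) (x : PauliString n × ℕ × ℂ)
    (s : State) : Prop where
  env : Env γ L ℓ s
  string : Stores 1 x.1 s
  tape : s.reg 20 = x.2.1
  amp : s.sreg 9 = x.2.2

/-- The two programs overwrite the same memory objects. -/
def SameTargets (p q : Program) : Prop := ∀ c k, p.avoids c k = q.avoids c k

theorem Agree.congr {p q : Program} {s s' : State} (h : Agree p s s') (hpq : SameTargets p q) :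
    Agree q s s' := h.mono fun c k hk => (hpq c k).trans hk

/-- A short program that overwrites the same memory objects as the computation of an amplitude. -/
def ampTargets : Program :=
  .seq (block [.sconst 10 0 0]) (ampTerm 0 0 0 0 (0, 0) (0, 0) (0, 0) (0, 0))

theorem seqOver_avoids {α : Type} {f : α → Program} {c k : ℕ} {b : Bool}
    (h : ∀ a, (f a).avoids c k = b) {l : List α} (hl : l ≠ []) :
    (seqOver f l).avoids c k = b := by
  induction l with
  | nil => exact absurd rfl hl
  | cons a l ih =>
    rw [seqOver, Program.avoids, h a]
    by_cases hl' : l = []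
    · rw [hl']; exact Bool.and_true b
    · rw [ih hl', Bool.and_self]

/-- All terms of the trace overwrite the same objects. For frame conditions, the long program may be
replaced by a short one on which `avoids` is quickly evaluated. -/
theorem ampProg_sameTargets (pa pb qa qb : ℕ) :
    SameTargets (ampProg pa pb qa qb) ampTargets := by
  intro c k
  have hp : pairs ≠ [] := List.cons_ne_nil _ _
  have h := seqOver_avoids (fun x => seqOver_avoids (fun y => seqOver_avoids (fun z =>
    seqOver_avoids (f := fun w => ampTerm pa pb qa qb x y z w) (c := c) (k := k)
      (b := (ampTerm 0 0 0 0 (0, 0) (0, 0) (0, 0) (0, 0)).avoids c k)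
      (fun w => rfl) hp) hp) hp) hp
  rw [ampProg, Program.avoids, Program.avoids, h]
  simp only [ampTargets, Program.avoids, block, ampTerm, Bool.and_true, Instr.target]
  ac_rfl

/-- Replace the letters of the two qubits of the current gate by the next two digits of the tape.
The program `A` computes the amplitude. -/
def touchProg (A : Program) : Program :=
  .seq (divMod 20 13) (.seq (block [.add 32 34 0, .add 20 35 0])
    (.seq (divMod 20 13) (.seq (block [.add 33 34 0, .add 20 35 0, .store 1 28 32, .store 1 29 33])
      (.seq A (block [.smul 9 9 10])))))

/-- Compute the amplitude of the current gate, which replaces the letters in registers `30` and `31`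
by the letters in registers `32` and `33`. -/
def stepAmpProg (fwd : Bool) : Program :=
  if fwd then ampProg 30 31 32 33 else ampProg 32 33 30 31

theorem stepAmpProg_sameTargets (fwd : Bool) : SameTargets (stepAmpProg fwd) ampTargets := by
  cases fwd <;> exact ampProg_sameTargets _ _ _ _

/-- Read the positions of gate number `26` (counted from the end, if `fwd` is false) of layer number
`24`, and the letters of the current string there. -/
def fetchGate (fwd : Bool) : Program :=
  block [if fwd then .add 27 26 0 else .sub 27 25 26, if fwd then .add 27 27 0 else .sub 27 27 1,
    .store 2 0 11, .store 2 1 24, .store 2 10 27, .query 28 2 11, .store 2 0 13, .query 29 2 11,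
    .store 2 0 11, .add 28 28 1, .add 29 29 1, .load 30 1 28, .load 31 1 29, .add 32 30 31]

/-- Perform one gate. The program `A` computes its amplitude. -/
def gateProg (A : Program) (fwd : Bool) : Program :=
  .seq (fetchGate fwd) (.branch (.eq 32 0) .skip (touchProg A))

theorem gateProg_sameTargets {A A' : Program} (h : SameTargets A A') (fwd : Bool) :
    SameTargets (gateProg A fwd) (gateProg A' fwd) := fun c k => by
  simp only [gateProg, touchProg, Program.avoids, h c k]

section
variable {n : ℕ} {γ : ℝ} {L : Circuit n} {ℓ : ℕ} {I : Input} {τ : ℕ} {ρ : Op n}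

theorem touchProg_spec (hI : Presents I L ρ) (fwd : Bool) {u g : ℕ} {G : Gate n}
    (hG : (gatesAt L u)[g]? = some G) {x : PauliString n × ℕ × ℂ} {s : State}
    (hs : Running γ L ℓ x s) (h0 : s.arr 2 0 = 3) (h1 : s.arr 2 1 = u) (h2 : s.arr 2 2 = g)
    (h28 : s.reg 28 = G.q₁ + 1) (h29 : s.reg 29 = G.q₂ + 1) (h30 : s.reg 30 = x.1 G.q₁)
    (h31 : s.reg 31 = x.1 G.q₂) (hx : ¬ G.Untouched x.1) :
    Halts I τ (touchProg (stepAmpProg fwd)) s (512 * τ + 6 * x.2.1 + 8470)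
      (Running γ L ℓ (gateStep fwd x G)) := by
  have hdm : ∀ v : ℕ, v / 4 ≤ v := fun v => Nat.div_le_self v 4
  have hv := hdm x.2.1
  set a : Fin 4 := Fin.ofNat 4 x.2.1 with ha
  set b : Fin 4 := Fin.ofNat 4 (x.2.1 / 4) with hb
  have hva : (a : ℕ) = x.2.1 % 4 := rfl
  have hvb : (b : ℕ) = x.2.1 / 4 % 4 := rfl
  have hstep : gateStep fwd x G = (x.1.setPair G.q₁ G.q₂ (a, b), x.2.1 / 4 / 4,
      x.2.2 * G.stepAmp fwd (x.1 G.q₁, x.1 G.q₂) (a, b)) := by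
    rw [gateStep, if_neg hx]
  refine Halts.le (Halts.seq (B := 3 * x.2.1 + 4) (B' := 2 + (3 * x.2.1 + 4 +
    (4 + (512 * τ + 8450 + 1))))
    (R := fun s' => s'.reg 34 = a ∧ s'.reg 35 = x.2.1 / 4) ?_ fun s1 a1 hs1 =>
    Halts.seq (R := fun s' => s'.reg 32 = a ∧ s'.reg 20 = x.2.1 / 4) (Halts.block ?_ ?_)
    fun s2 a2 hs2 => Halts.seq (R := fun s' => s'.reg 34 = b ∧ s'.reg 35 = x.2.1 / 4 / 4) ?_
    fun s3 a3 hs3 => Halts.seq (R := fun s' => s'.reg 33 = b ∧ s'.reg 20 = x.2.1 / 4 / 4 ∧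
      Stores 1 (gateStep fwd x G).1 s') (Halts.block ?_ ?_)
    fun s4 a4 hs4 => Halts.seq (R := fun s' =>
      s'.sreg 10 = G.stepAmp fwd (x.1 G.q₁, x.1 G.q₂) (a, b)) ?_
    fun s5 a5 hs5 => (Halts.block (Q := fun s' => s'.sreg 9 = (gateStep fwd x G).2.2) ?_ ?_).mono
      le_rfl fun s6 a6 hs6 => ?_) (by omega)
  · refine (divMod_spec hs.env.one (by rw [hs.env.four]; norm_num) (by norm_num)
      (by norm_num)).mono (by rw [hs.tape]) fun s' _ h => ?_
    rwa [hs.env.four, hs.tape] at h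
  all_goals have e1 : Env γ L ℓ s1 := hs.env.of_agree a1 rfl
  · simp [execs, Instr.exec, hs1.1, hs1.2, e1.zero]
  · simp [costs, Instr.cost]
  all_goals have e2 : Env γ L ℓ s2 := e1.of_agree a2 rfl
  · refine (divMod_spec e2.one (by rw [e2.four]; norm_num) (by norm_num)
      (by norm_num)).mono (by rw [hs2.2]; omega) fun s' _ h => ?_
    rwa [e2.four, hs2.2] at h
  all_goals have e3 : Env γ L ℓ s3 := e2.of_agree a3 rfl
  · have k28 : s3.reg 28 = G.q₁ + 1 := by rw [a3.reg 28 rfl, a2.reg 28 rfl, a1.reg 28 rfl, h28]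
    have k29 : s3.reg 29 = G.q₂ + 1 := by rw [a3.reg 29 rfl, a2.reg 29 rfl, a1.reg 29 rfl, h29]
    have k32 : s3.reg 32 = a := by rw [a3.reg 32 rfl, hs2.1]
    have karr : s3.arr 1 = s.arr 1 := by rw [a3.arr 1 rfl, a2.arr 1 rfl, a1.arr 1 rfl]
    refine ⟨by simp [execs, Instr.exec, hs3.1, e3.zero],
      by simp [execs, Instr.exec, hs3.2, e3.zero], fun j => ?_⟩
    rw [hstep]
    simp only [execs, Instr.exec, State.setReg_reg, State.setReg_arr, State.setArr_arr,
      State.setArr_reg, if_true, k28, k29, k32, hs3.1, e3.zero, karr]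
    norm_num
    simp only [Function.update_apply, PauliString.setPair]
    simp only [Fin.ext_iff] at *
    split_ifs with h3 h4 <;> first | rfl | omega | exact hs.string j
  · simp [costs, Instr.cost]
  all_goals have e4 : Env γ L ℓ s4 := e3.of_agree a4 rfl
  · have k30 : s4.reg 30 = x.1 G.q₁ := by
      rw [a4.reg 30 rfl, a3.reg 30 rfl, a2.reg 30 rfl, a1.reg 30 rfl, h30]
    have k31 : s4.reg 31 = x.1 G.q₂ := by
      rw [a4.reg 31 rfl, a3.reg 31 rfl, a2.reg 31 rfl, a1.reg 31 rfl, h31]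
    have k32 : s4.reg 32 = a := by rw [a4.reg 32 rfl, a3.reg 32 rfl, hs2.1]
    have karr : s4.arr 2 = s.arr 2 := by
      rw [a4.arr 2 rfl, a3.arr 2 rfl, a2.arr 2 rfl, a1.arr 2 rfl]
    rw [← karr] at h0 h1 h2
    -- Backwards, the old and the new letters exchange their roles in the amplitude.
    cases fwd
    · exact ampProg_spec (r := ![32, 33, 30, 31]) hI hG ⟨e4, h0, h1, h2, k32, hs4.1, k30, k31⟩
    · exact ampProg_spec (r := ![30, 31, 32, 33]) hI hG ⟨e4, h0, h1, h2, k30, k31, k32, hs4.1⟩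
  all_goals
    replace a5 := a5.congr (stepAmpProg_sameTargets fwd)
    have e5 : Env γ L ℓ s5 := e4.of_agree a5 rfl
  · have k9 : s5.sreg 9 = x.2.2 := by
      rw [a5.sreg 9 rfl, a4.sreg 9 rfl, a3.sreg 9 rfl, a2.sreg 9 rfl,
        a1.sreg 9 rfl, hs.amp]
    simp [execs, Instr.exec, k9, hs5, hstep]
  · simp [costs, Instr.cost]
  · refine ⟨e5.of_agree a6 rfl, hs4.2.2.of_arr_eq ?_, ?_, hs6⟩
    · rw [a6.arr 1 rfl, a5.arr 1 rfl]
    · rw [a6.reg 20 rfl, a5.reg 20 rfl, hs4.2.1, hstep]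


theorem gateProg_spec (hI : Presents I L ρ) (fwd : Bool) {u g : ℕ} {G : Gate n}
    {x : PauliString n × ℕ × ℂ} {s : State} (hs : Running γ L ℓ x s) (h24 : s.reg 24 = u)
    (h25 : s.reg 25 = (gatesAt L u).length) (h26 : s.reg 26 = g)
    (hG : (if fwd then gatesAt L u else (gatesAt L u).reverse)[g]? = some G) :
    Halts I τ (gateProg (stepAmpProg fwd) fwd) s (514 * τ + 6 * x.2.1 + 8489)
      (Running γ L ℓ (gateStep fwd x G)) := by
  have he := hs.env
  -- Backwards, gate `g` of the reversed list has number length - g - 1 in the layer as it is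
  -- queried.
  obtain ⟨i, hi, hi'⟩ : ∃ i, (gatesAt L u)[i]? = some G ∧
      (if fwd then g else (gatesAt L u).length - g - 1) = i := by
    cases fwd
    · refine ⟨_, ?_, rfl⟩
      have hlt : g < (gatesAt L u).length := by
        by_contra hlt
        rw [List.getElem?_eq_none (by simpa using hlt)] at hG
        cases hG
      have := List.getElem?_reverse hlt
      simp only [Bool.false_eq_true, if_false] at hG ⊢
      rw [← hG, this]
      congr 1
      omega
    · exact ⟨g, hG, rfl⟩
  have hl := hI.left u i G hi
  have hr := hI.right u i G hi
  refine Halts.le (Halts.seq (B := 2 * τ + 18) (B' := 0 + (512 * τ + 6 * x.2.1 + 8470) + 1)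
    (R := fun s' => Running γ L ℓ x s' ∧ s'.arr 2 0 = 3 ∧ s'.arr 2 1 = u ∧ s'.arr 2 2 = i ∧
      s'.reg 28 = G.q₁ + 1 ∧ s'.reg 29 = G.q₂ + 1 ∧ s'.reg 30 = x.1 G.q₁ ∧
      s'.reg 31 = x.1 G.q₂ ∧ s'.reg 32 = x.1 G.q₁ + x.1 G.q₂) ?_
    fun s1 a1 ⟨hr1, g0, g1, g2, g28, g29, g30, g31, g32⟩ => Halts.branch (fun hb => Halts.skip ?_)
      fun hb => ?_) (by omega)
  · refine (Halts.block (Q := fun s' => s'.arr 2 0 = 3 ∧ s'.arr 2 1 = u ∧ s'.arr 2 2 = i ∧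
      s'.reg 28 = G.q₁ + 1 ∧ s'.reg 29 = G.q₂ + 1 ∧ s'.reg 30 = x.1 G.q₁ ∧
      s'.reg 31 = x.1 G.q₂ ∧ s'.reg 32 = x.1 G.q₁ + x.1 G.q₂) ?_ ?_).mono le_rfl fun s' ha h =>
        ⟨⟨he.of_agree ha (by cases fwd <;> rfl), hs.string.of_arr_eq (ha.arr 1 (by cases fwd <;>
            rfl)),
          (ha.reg 20 (by cases fwd <;> rfl)).trans hs.tape,
          (ha.sreg 9 (by cases fwd <;> rfl)).trans hs.amp⟩, h⟩
    · have hs1 := hs.string G.q₁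
      have hs2 := hs.string G.q₂
      cases fwd <;> simp only [Bool.false_eq_true, if_false, if_true] at hi' <;>
        simp [execs, Instr.exec, he.zero, he.one, he.two, he.three, he.four, h24, h25, h26,
          State.word, List.range_succ, hl, hr, hi', hs1, hs2]
    · cases fwd <;> simp [costs, Instr.cost, Instr.exec, he.three] <;> omega
  · have h0 : s1.reg 32 = s1.reg 0 := hb
    rw [hr1.env.zero, g32] at h0
    -- The machine tests the sum of the two letters, which as natural numbers vanishes only if both
    -- do.
    have hx : G.Untouched x.1 := ⟨Fin.ext (show (x.1 G.q₁ : ℕ) = 0 by omega),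
      Fin.ext (show (x.1 G.q₂ : ℕ) = 0 by omega)⟩
    rw [gateStep, if_pos hx]
    exact hr1
  · refine touchProg_spec hI fwd hi hr1 g0 g1 g2 g28 g29 g30 g31 fun hx => hb ?_
    show s1.reg 32 = s1.reg 0
    rw [g32, hx.1, hx.2, hr1.env.zero]
    rfl

end

/-! ## Layers -/

/-- Apply the noise to the current string: multiply the amplitude by the damping factor, add the
weight to register `21`, and put `d + 1` times the weight into register `22`. -/
def weighProg : Program :=
  .seq (block [.add 22 0 0, .add 37 0 0])
    (.loop (.lt 37 2) (.seq (block [.add 37 37 1, .load 38 1 37])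
      (.branch (.eq 38 0) .skip (block [.add 21 21 1, .add 22 22 7, .smul 9 9 1]))))

/-- Perform the gates of layer number `24` and apply the noise. The program `A` computes the
amplitudes of the gates. -/
def layerProg (A : Program) (fwd : Bool) : Program :=
  .seq (block [.store 2 0 10, .store 2 1 24, .query 25 2 10, .add 26 0 0])
    (.seq (.loop (.lt 26 25) (.seq (gateProg A fwd) (block [.add 26 26 1]))) weighProg)

theorem layerProg_sameTargets {A A' : Program} (h : SameTargets A A') (fwd : Bool) :
    SameTargets (layerProg A fwd) (layerProg A' fwd) := fun c k => by
  simp only [layerProg, Program.avoids, gateProg_sameTargets h fwd c k]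

theorem gateStep_tape_le {n : ℕ} (fwd : Bool) (x : PauliString n × ℕ × ℂ) (g : Gate n) :
    (gateStep fwd x g).2.1 ≤ x.2.1 := by
  rw [gateStep]
  split_ifs
  · exact le_rfl
  · exact (Nat.div_le_self _ _).trans (Nat.div_le_self _ _)

theorem foldl_gateStep_tape_le {n : ℕ} (fwd : Bool) (gs : List (Gate n))
    (x : PauliString n × ℕ × ℂ) : (gs.foldl (gateStep fwd) x).2.1 ≤ x.2.1 := by
  induction gs generalizing x with
  | nil => exact le_rfl
  | cons g gs ih => exact (ih _).trans (gateStep_tape_le fwd x g)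

theorem PauliString.weight_le {n : ℕ} (P : PauliString n) : P.weight ≤ n :=
  (Finset.card_filter_le _ _).trans (by simp)

theorem gatesAt_length_le {n : ℕ} (L : Circuit n) (u : ℕ) : (gatesAt L u).length ≤ n := by
  -- On a string without identity letters every gate acts, so the weight bound counts all gates of
  -- the layer.
  have h : (gatesAt L u).length = touches (gatesAt L u) (fun _ => 1) := by
    rw [touches, eq_comm, List.countP_eq_length]
    intro g _
    simp [Gate.Untouched]
  rw [h]
  exact (touches_le_weight _ (gatesAt_disjoint L u) _).trans (PauliString.weight_le _)

/-- The number of non-identity letters among the first `i`. -/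
def PauliString.weightBelow {n : ℕ} (P : PauliString n) (i : ℕ) : ℕ :=
  ∑ j ∈ Finset.range i, if h : j < n then if P ⟨j, h⟩ = 0 then 0 else 1 else 0

theorem PauliString.weightBelow_succ {n : ℕ} (P : PauliString n) {i : ℕ} (h : i < n) :
    P.weightBelow (i + 1) = P.weightBelow i + if P ⟨i, h⟩ = 0 then 0 else 1 := by
  rw [weightBelow, Finset.sum_range_succ, dif_pos h, weightBelow]

theorem PauliString.weightBelow_eq {n : ℕ} (P : PauliString n) : P.weightBelow n = P.weight := by
  rw [weightBelow, Finset.sum_range, weight, Finset.card_filter]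
  refine Finset.sum_congr rfl fun j _ => ?_
  rw [dif_pos j.2]
  by_cases h : P j = 0 <;> simp [h]

section
variable {n : ℕ} {γ : ℝ} {L : Circuit n} {ℓ : ℕ} {I : Input} {τ : ℕ} {ρ : Op n}

theorem weighProg_spec {x : PauliString n × ℕ × ℂ} {s : State} (hs : Running γ L ℓ x s) :
    Halts I τ weighProg s (7 * n + 3) fun s' =>
      Running γ L ℓ (x.1, x.2.1, x.2.2 * noiseFactor γ x.1) s' ∧
      s'.reg 21 = s.reg 21 + x.1.weight ∧ s'.reg 22 = (L.length + 1) * x.1.weight := by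
  have he := hs.env
  refine Halts.mono (B := 2 + (n * (6 + 1) + 1)) (Q := fun s' => s'.sreg 9 =
      x.2.2 * noiseFactor γ x.1 ∧
      s'.reg 21 = s.reg 21 + x.1.weight ∧ s'.reg 22 = (L.length + 1) * x.1.weight)
    (Halts.seq (R := fun s' => s'.reg 22 = 0 ∧ s'.reg 37 = 0)
    (Halts.block (by simp [execs, Instr.exec, he.zero]) (by simp [costs, Instr.cost]))
    fun s1 a1 hs1 => Halts.loop n (fun i s' => s'.reg 37 = i ∧
      s'.sreg 9 = x.2.2 * (Real.exp (-γ) : ℂ) ^ x.1.weightBelow i ∧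
      s'.reg 21 = s.reg 21 + x.1.weightBelow i ∧
      s'.reg 22 = (L.length + 1) * x.1.weightBelow i)
      ⟨hs1.2, ?_, ?_, ?_⟩ ?_ ?_) (by omega) fun s' ha h =>
        ⟨⟨he.of_agree ha rfl, hs.string.of_arr_eq (ha.arr 1 rfl), (ha.reg 20 rfl).trans hs.tape,
            h.1⟩,
          h.2⟩
  · rw [a1.sreg 9 rfl, hs.amp]; simp [PauliString.weightBelow]
  · rw [a1.reg 21 rfl]; simp [PauliString.weightBelow]
  · rw [hs1.1]; simp [PauliString.weightBelow]
  · rintro i hi s2 a2 ⟨h37, h9, h21, h22⟩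
    have e2 : Env γ L ℓ s2 := (he.of_agree a1 rfl).of_agree a2 rfl
    have st2 : Stores 1 x.1 s2 :=
      (hs.string.of_arr_eq (a1.arr 1 rfl)).of_arr_eq (a2.arr 1 rfl)
    have hletter := st2 ⟨i, hi⟩
    have hw := x.1.weightBelow_succ hi
    refine ⟨?_, Halts.le (Halts.seq (B := 2) (B' := 0 + 3 + 1)
      (R := fun s' => s'.reg 37 = i + 1 ∧ s'.reg 38 = x.1 ⟨i, hi⟩) (Halts.block ?_ ?_)
      fun s3 a3 hs3 => Halts.branch (fun hb => Halts.skip ?_) fun hb => Halts.block ?_ ?_)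
      (by omega)⟩
    · show s2.reg 37 < s2.reg 2
      rw [h37, e2.qubits]; exact hi
    · simp [execs, Instr.exec, h37, e2.one, hletter]
    · simp [costs, Instr.cost]
    all_goals
      have e3 : Env γ L ℓ s3 := e2.of_agree a3 rfl
      have k9 := a3.sreg 9 rfl
      have k21 := a3.reg 21 rfl
      have k22 := a3.reg 22 rfl
    · have h0 : s3.reg 38 = s3.reg 0 := hb
      rw [e3.zero, hs3.2] at h0
      have h0' : x.1 ⟨i, hi⟩ = 0 := Fin.ext h0
      rw [hw, if_pos h0', add_zero]
      exact ⟨hs3.1, k9.trans h9, k21.trans h21, k22.trans h22⟩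
    · have h0' : x.1 ⟨i, hi⟩ ≠ 0 := fun h0 => hb (by
        show s3.reg 38 = s3.reg 0
        rw [e3.zero, hs3.2, h0]; rfl)
      rw [hw, if_neg h0']
      simp [execs, Instr.exec, hs3.1, k9, h9, k21, h21, k22, h22, e3.one, e3.depth_succ,
        e3.damping, pow_succ]
      exact ⟨by ring, by ring, by ring⟩
    · simp [costs, Instr.cost]
  · rintro s2 a2 ⟨h37, h9, h21, h22⟩
    have e2 : Env γ L ℓ s2 := (he.of_agree a1 rfl).of_agree a2 rfl
    rw [PauliString.weightBelow_eq] at h9 h21 h22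
    refine ⟨?_, h9, h21, h22⟩
    show ¬ s2.reg 37 < s2.reg 2
    rw [h37, e2.qubits]
    omega

theorem layerProg_spec (hI : Presents I L ρ) (fwd : Bool) {u : ℕ} (hu : u < L.length)
    {x : PauliString n × ℕ × ℂ} {s : State} (hs : Running γ L ℓ x s) (h24 : s.reg 24 = u)
    {y : PauliString n × ℕ × ℂ} (hy : (if fwd then gatesAt L u else (gatesAt L u).reverse).foldl
      (gateStep fwd) x = y) :
    Halts I τ (layerProg (stepAmpProg fwd) fwd) s (n * (514 * τ + 6 * x.2.1 + 8498) + τ + 9)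
      fun s' => Running γ L ℓ (y.1, y.2.1, y.2.2 * noiseFactor γ y.1) s' ∧
        s'.reg 21 = s.reg 21 + y.1.weight ∧ s'.reg 22 = (L.length + 1) * y.1.weight := by
  have he := hs.env
  set gs := if fwd then gatesAt L u else (gatesAt L u).reverse with hgs
  have hlen : gs.length = (gatesAt L u).length := by cases fwd <;> simp [hgs]
  have hle : gs.length ≤ n := hlen ▸ gatesAt_length_le L u
  have hq := hI.size u hu
  have hmul := Nat.mul_le_mul_right (514 * τ + 6 * x.2.1 + 8491) hle
  refine Halts.le (Halts.seq (B := τ + 5) (B' := (gs.length * ((514 * τ + 6 * x.2.1 + 8489 + 1) + 1)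
      + 1) + (7 * n + 3))
    (R := fun s' => Running γ L ℓ x s' ∧ s'.reg 24 = u ∧ s'.reg 25 = gs.length ∧ s'.reg 26 = 0 ∧
      s'.reg 21 = s.reg 21) ?_
    fun s1 a1 ⟨r1, h1, h2, h3, h4⟩ => Halts.seq (R := fun s' => Running γ L ℓ y s' ∧
      s'.reg 21 = s.reg 21)
      (Halts.loop gs.length (fun i s' => Running γ L ℓ ((gs.take i).foldl (gateStep fwd) x) s' ∧
        s'.reg 24 = u ∧ s'.reg 25 = gs.length ∧ s'.reg 26 = i ∧ s'.reg 21 = s.reg 21)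
        ⟨r1, h1, h2, h3, h4⟩ ?_ ?_)
      fun s2 a2 ⟨r2, h5⟩ => (weighProg_spec r2).mono le_rfl fun s' _ h => ?_) (by linarith)
  · refine (Halts.block (Q := fun s' => s'.reg 25 = gs.length ∧ s'.reg 26 = 0) ?_ ?_).mono le_rfl
      fun s' ha h => ⟨⟨he.of_agree ha rfl, hs.string.of_arr_eq (ha.arr 1 rfl),
        (ha.reg 20 rfl).trans hs.tape, (ha.sreg 9 rfl).trans hs.amp⟩, (ha.reg 24 rfl).trans h24,
        h.1, h.2, ha.reg 21 rfl⟩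
    · simp [execs, Instr.exec, he.zero, he.one, he.two, h24, State.word, List.range_succ, hq, hlen]
    · simp [costs, Instr.cost, Instr.exec, he.two]
      omega
  · rintro i hi s' _ ⟨r, g24, g25, g26, g21⟩
    refine ⟨?_, Halts.seq (R := fun s' => Running γ L ℓ ((gs.take (i + 1)).foldl (gateStep fwd) x)
        s' ∧
        s'.reg 24 = u ∧ s'.reg 25 = gs.length ∧ s'.reg 26 = i ∧ s'.reg 21 = s.reg 21)
      ((gateProg_spec hI fwd r g24 (g25.trans hlen) g26 (List.getElem?_eq_getElem hi)).mono ?_ ?_)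
      fun s3 a3 ⟨r3, k24, k25, k26, k21⟩ => (Halts.block (Q := fun s' => s'.reg 26 = i + 1) ?_
        ?_).mono le_rfl fun s4 a4 h => ⟨⟨r3.env.of_agree a4 rfl, r3.string.of_arr_eq (a4.arr 1 rfl),
          (a4.reg 20 rfl).trans r3.tape, (a4.sreg 9 rfl).trans r3.amp⟩, (a4.reg 24 rfl).trans k24,
          (a4.reg 25 rfl).trans k25, h, (a4.reg 21 rfl).trans k21⟩⟩
    · show s'.reg 26 < s'.reg 25
      rw [g26, g25]; exact hi
    -- The tape only shrinks, so the time for each gate is bounded by the tape at the start of the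
    -- layer.
    · have := foldl_gateStep_tape_le fwd (gs.take i) x
      omega
    · intro s3 a3 r3
      replace a3 := a3.congr (gateProg_sameTargets (stepAmpProg_sameTargets fwd) fwd)
      refine ⟨?_, (a3.reg 24 (by cases fwd <;> rfl)).trans g24,
        (a3.reg 25 (by cases fwd <;> rfl)).trans g25, (a3.reg 26 (by cases fwd <;> rfl)).trans g26,
        (a3.reg 21 (by cases fwd <;> rfl)).trans g21⟩
      rwa [List.take_succ_eq_append_getElem hi, List.foldl_append]
    · simp [execs, Instr.exec, k26, r3.env.one]
    · simp [costs, Instr.cost]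
  · rintro s' _ ⟨r, g24, g25, g26, g21⟩
    rw [List.take_length, hy] at r
    refine ⟨?_, r, g21⟩
    show ¬ s'.reg 26 < s'.reg 25
    rw [g26, g25]; exact lt_irrefl _
  · rw [h5] at h
    exact h

end

/-! ## The value of a tape -/

/-- Copy the string in array `0` to array `1`. -/
def copyProg : Program :=
  .seq (block [.add 37 0 0])
    (.loop (.lt 37 2) (block [.add 37 37 1, .load 38 0 37, .store 1 37 38]))

/-- The body of the loop over the layers after the starting point. -/
def fwdProg (A : Bool → Program) : Program :=
  .seq (layerProg (A true) true) (block [.add 24 24 1])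

/-- The body of the loop over the layers before the starting point. -/
def bwdProg (A : Bool → Program) : Program :=
  .seq (block [.sub 24 24 1]) (.seq (layerProg (A false) false)
    (.branch (.lt 4 22) .skip (block [.sadd 9 4 4])))

/-- Start with the string in array `0` at layer number `16` and with the amplitude in scalar
register `8`, follow the tape in register `18`, and add the result to scalar register `0`. The
programs `A` compute the amplitudes of the gates, the program `F` multiplies with the coefficient of
the first string of the path. -/
def coreProg (A : Bool → Program) (F : Program) : Program :=
  .seq (block [.add 20 18 0, .add 21 0 0, .sadd 9 8 4, .add 24 16 0])
  (.seq copyProg (.seq weighProg (.seq (.loop (.lt 24 3) (fwdProg A))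
  (.seq (block [.store 1 0 13, .squery 7 1 9, .add 24 16 0])
  (.seq copyProg (.seq (.loop (.lt 0 24) (bwdProg A)) (.seq (block [.smul 9 9 7])
  (.seq F (.seq (.branch (.lt 4 21) (block [.sadd 9 4 4]) .skip)
  (.seq (.branch (.lt 0 20) (block [.sadd 9 4 4]) .skip) (block [.sadd 0 0 9])))))))))))

/-- Multiply the amplitude with the coefficient of the current string in the observable. -/
def coeffProg : Program := block [.store 1 0 14, .squery 12 1 9, .smul 9 9 12]

theorem fwdProg_sameTargets {A A' : Bool → Program} (h : ∀ b, SameTargets (A b) (A' b)) :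
    SameTargets (fwdProg A) (fwdProg A') := fun c k => by
  simp only [fwdProg, Program.avoids, layerProg_sameTargets (h true) true c k]

theorem bwdProg_sameTargets {A A' : Bool → Program} (h : ∀ b, SameTargets (A b) (A' b)) :
    SameTargets (bwdProg A) (bwdProg A') := fun c k => by
  simp only [bwdProg, Program.avoids, layerProg_sameTargets (h false) false c k]

theorem coreProg_sameTargets {A A' : Bool → Program} (h : ∀ b, SameTargets (A b) (A' b))
    (F : Program) : SameTargets (coreProg A F) (coreProg A' F) := fun c k => by
  simp only [coreProg, Program.avoids, fwdProg_sameTargets h c k, bwdProg_sameTargets h c k]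

theorem stageStep_tape_le {n : ℕ} {ι : Type} [DecidableEq ι] (x : (ι → PauliString n) × ℕ × ℂ)
    (st : Stage n ι) : (stageStep x st).2.1 ≤ x.2.1 := foldl_gateStep_tape_le _ _ _

/-- The machine adds up the weight entry by entry. Setting an unvisited entry does not change what
was counted before. -/
theorem sum_weight_update {n d : ℕ} (q : PauliPath n d) (P : PauliString n) {A : Finset ℕ} {u : ℕ}
    (hA : ∀ i ∈ A, i ≤ d) (hu : u ≤ d) (huA : u ∉ A) :
    ∑ i ∈ insert u A, PauliString.weight (Function.update q (Fin.ofNat _ u) P (Fin.ofNat _ i)) =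
      ∑ i ∈ A, PauliString.weight (q (Fin.ofNat _ i)) + P.weight := by
  rw [Finset.sum_insert huA, Function.update_self, add_comm]
  congr 1
  refine Finset.sum_congr rfl fun i hi => ?_
  rw [Function.update_of_ne]
  rw [Ne, ofNat_inj (hA i hi) hu]
  rintro rfl
  exact huA hi

/-- Letters begin at cell 1, so cell 0 is free for the kind of the query and the array itself serves
as the query word. -/
theorem word_of_stores {n k : ℕ} {P : PauliString n} {s : State} (h : Stores k P s) :
    ∃ w, s.word k (n + 1) = s.arr k 0 :: w ∧ decodePauli n w = P := by
  refine ⟨(List.range n).map fun j => s.arr k (j + 1), ?_, ?_⟩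
  · rw [State.word, List.range_succ_eq_map, List.map_cons, List.map_map]
    rfl
  · funext j
    rw [decodePauli, List.getD_eq_getElem?_getD, List.getElem?_map, List.getElem?_range j.2]
    simp only [Option.map_some, Option.getD_some]
    rw [h j]
    exact Fin.ext (Nat.mod_eq_of_lt (P j).2)

section
variable {n : ℕ} {γ : ℝ} {L : Circuit n} {ℓ : ℕ} {I : Input} {τ : ℕ} {ρ : Op n}

theorem copyProg_spec {P : PauliString n} {s : State} (he : Env γ L ℓ s) (h : Stores 0 P s) :
    Halts I τ copyProg s (4 * n + 2) (Stores 1 P) := by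
  refine Halts.le (Halts.seq (B := 1) (B' := n * (3 + 1) + 1) (R := fun s' => s'.reg 37 = 0)
    (Halts.block (by simp [execs, Instr.exec, he.zero]) (by simp [costs, Instr.cost]))
    fun s1 a1 hs1 => Halts.loop n (fun i s' => s'.reg 37 = i ∧
      ∀ j : Fin n, (j : ℕ) < i → s'.arr 1 (j + 1) = P j)
      ⟨hs1, fun j hj => absurd hj (Nat.not_lt_zero _)⟩ ?_ ?_) (by omega)
  · rintro i hi s2 a2 ⟨h37, hst⟩
    have e2 : Env γ L ℓ s2 := (he.of_agree a1 rfl).of_agree a2 rfl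
    have h0 : s2.arr 0 (i + 1) = P ⟨i, hi⟩ := by
      rw [a2.arr 0 rfl, a1.arr 0 rfl]; exact h ⟨i, hi⟩
    refine ⟨?_, Halts.block ⟨by simp [execs, Instr.exec, h37, e2.one], fun j hj => ?_⟩
      (by simp [costs, Instr.cost])⟩
    · show s2.reg 37 < s2.reg 2
      rw [h37, e2.qubits]; exact hi
    · simp only [execs, Instr.exec, State.setReg_reg, State.setReg_arr, State.setArr_arr, h37,
        e2.one]
      norm_num
      rw [h0, Function.update_apply]
      by_cases hji : (j : ℕ) = i
      · rw [if_pos (by omega)]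
        exact congrArg _ (congrArg _ (Fin.ext hji.symm))
      · rw [if_neg (by omega)]
        exact hst j (by omega)
  · rintro s2 a2 ⟨h37, hst⟩
    have e2 : Env γ L ℓ s2 := (he.of_agree a1 rfl).of_agree a2 rfl
    refine ⟨?_, fun j => hst j j.2⟩
    show ¬ s2.reg 37 < s2.reg 2
    rw [h37, e2.qubits]
    exact lt_irrefl _

theorem coeffProg_spec {O : Op n} (hO : ∀ w, I.scalar (5 :: w) = pauliCoeff O (decodePauli n w))
    {P : PauliString n} {s : State} (he : Env γ L ℓ s) (h : Stores 1 P s) :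
    Halts I τ coeffProg s (τ + n + 3) fun s' => s'.sreg 9 = s.sreg 9 * pauliCoeff O P := by
  obtain ⟨w, hw, rfl⟩ := word_of_stores (s := s.setArr 1 0 5) (k := 1) (P := P) fun j => by
    simpa using h j
  simp only [State.setArr_arr, if_true, Function.update_self] at hw
  refine Halts.block ?_ ?_
  · simp [execs, Instr.exec, he.five, he.zero, he.qubits_succ, hw, hO]
  · simp [costs, Instr.cost, Instr.exec, he.qubits_succ]
    omega

/-- The machine is at entry number `u` of the path, and has visited the entries in `A`. -/
structure Follows (γ : ℝ) (L : Circuit n) (ℓ V u : ℕ) (A : Finset ℕ)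
    (x : PauliPath n L.length × ℕ × ℂ) (s : State) : Prop where
  running : Running γ L ℓ (x.1 (Fin.ofNat _ u), x.2) s
  position : s.reg 24 = u
  weight : s.reg 21 = ∑ i ∈ A, PauliString.weight (x.1 (Fin.ofNat _ i))
  tape_le : x.2.1 ≤ V

/-- A bound for the time that is needed for a layer. -/
def layerTime (n τ V : ℕ) : ℕ := n * (514 * τ + 6 * V + 8498) + τ + 9

theorem layerTime_mono {n τ V W : ℕ} (h : V ≤ W) :
    n * (514 * τ + 6 * V + 8498) + τ + 9 ≤ layerTime n τ W := by
  rw [layerTime]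
  gcongr

theorem fwdProg_spec (hI : Presents I L ρ) {V u : ℕ} {A : Finset ℕ}
    {x : PauliPath n L.length × ℕ × ℂ} {s : State} (hs : Follows γ L ℓ V u A x s)
    (hu : u < L.length) (hA : ∀ i ∈ A, i ≤ u) :
    Halts I τ (fwdProg stepAmpProg) s (layerTime n τ V + 1)
      (Follows γ L ℓ V (u + 1) (insert (u + 1) A) (stageStep x (fwdStage γ L u))) := by
  refine Halts.seq ((layerProg_spec hI true hu hs.running hs.position rfl).mono
    (layerTime_mono hs.tape_le) fun s1 a1 h => (⟨h, ?_⟩ : _ ∧ s1.reg 24 = u)) fun s1 a1 hs1 =>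
      (Halts.block (Q := fun s' => s'.reg 24 = u + 1) ?_ ?_).mono le_rfl fun s2 a2 h => ?_
  · exact ((a1.congr (layerProg_sameTargets (stepAmpProg_sameTargets true) true)).reg 24
      rfl).trans hs.position
  · simp [execs, Instr.exec, hs1.2, hs1.1.1.env.one]
  · simp [costs, Instr.cost]
  · obtain ⟨⟨r, hW, -⟩, -⟩ := hs1
    refine ⟨⟨r.env.of_agree a2 rfl, ?_, (a2.reg 20 rfl).trans r.tape, (a2.sreg 9 rfl).trans r.amp⟩,
      h, ?_, (stageStep_tape_le _ _).trans hs.tape_le⟩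
    · have := r.string.of_arr_eq (a2.arr 1 rfl)
      simpa [stageStep, fwdStage] using this
    · rw [a2.reg 21 rfl, hW, hs.weight]
      exact (sum_weight_update x.1 _ (fun i hi => (hA i hi).trans hu.le) hu
        fun h => absurd (hA _ h) (by omega)).symm

theorem bwdProg_spec (hI : Presents I L ρ) {V u : ℕ} {A : Finset ℕ}
    {x : PauliPath n L.length × ℕ × ℂ} {s : State} (hs : Follows γ L ℓ V (u + 1) A x s)
    (hu : u < L.length) (hA : ∀ i ∈ A, u < i ∧ i ≤ L.length) :
    Halts I τ (bwdProg stepAmpProg) s (layerTime n τ V + 3)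
      (Follows γ L ℓ V u (insert u A) (stageStep x (bwdStage γ ℓ L u))) := by
  have hr := hs.running
  obtain ⟨y, hy⟩ : ∃ y, (gatesAt L u).reverse.foldl (gateStep false)
    (x.1 (Fin.ofNat _ (u + 1)), x.2) = y := ⟨_, rfl⟩
  have hstep : stageStep x (bwdStage γ ℓ L u) = (Function.update x.1 (Fin.ofNat _ u) y.1, y.2.1,
      y.2.2 * (noiseFactor γ y.1 * if IsLow L.length ℓ y.1 then 0 else 1)) := by
    rw [← hy]; rfl
  refine Halts.le (Halts.seq (B := 1) (B' := layerTime n τ V + (0 + 1 + 1))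
    (R := fun s' => s'.reg 24 = u) (Halts.block ?_ ?_)
    fun s1 a1 h1 => Halts.seq ((layerProg_spec hI false hu (s := s1)
      ⟨hr.env.of_agree a1 rfl, hr.string.of_arr_eq (a1.arr 1 rfl), (a1.reg 20 rfl).trans hr.tape,
        (a1.sreg 9 rfl).trans hr.amp⟩ h1 hy).mono (layerTime_mono hs.tape_le) fun s2 a2 h =>
        (⟨h, ?_⟩ : _ ∧ s2.reg 24 = u)) fun s2 a2 hs2 =>
      (Halts.branch (Q := fun s' => s'.sreg 9 = (stageStep x (bwdStage γ ℓ L u)).2.2)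
        (fun hb => Halts.skip ?_)
        fun hb => Halts.block ?_ ?_).mono le_rfl fun s3 a3 h3 => ?_) (by omega)
  · simp [execs, Instr.exec, hs.position, hr.env.one]
  · simp [costs, Instr.cost]
  · exact ((a2.congr (layerProg_sameTargets (stepAmpProg_sameTargets false) false)).reg 24
      rfl).trans h1
  all_goals
    obtain ⟨⟨r, hW, hlow⟩, h24⟩ := hs2
    have hz := r.amp
  -- Register `22` holds d + 1 times the weight, so lowness is decided by comparison with the
  -- threshold, without division.
  · have hb' : s2.reg 4 < s2.reg 22 := hb
    rw [r.env.threshold, hlow] at hb'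
    rw [hz, hstep, if_neg (show ¬ IsLow _ _ _ from not_le.2 hb'), mul_one]
  · have hb' : ¬ s2.reg 4 < s2.reg 22 := hb
    rw [r.env.threshold, hlow] at hb'
    rw [hstep, if_pos (show IsLow _ _ _ from not_lt.1 hb'), mul_zero, mul_zero]
    simp [execs, Instr.exec, r.env.szero]
  · simp [costs, Instr.cost]
  · have htape : y.2.1 ≤ x.2.1 := hy ▸ foldl_gateStep_tape_le _ _ _
    rw [hstep] at h3 ⊢
    refine ⟨⟨r.env.of_agree a3 rfl, ?_, (a3.reg 20 rfl).trans r.tape, h3⟩,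
      (a3.reg 24 rfl).trans h24, ?_, htape.trans hs.tape_le⟩
    · simpa using r.string.of_arr_eq (a3.arr 1 rfl)
    · rw [a3.reg 21 rfl, hW, a1.reg 21 rfl, hs.weight]
      exact (sum_weight_update x.1 _ (fun i hi => (hA i hi).2) hu.le
        fun h => absurd (hA _ h) (by omega)).symm

/-- The path after the stages before number `t + k`. -/
def forwardRun (γ : ℝ) (L : Circuit n) (t : ℕ) (x : PauliPath n L.length × ℕ × ℂ) (k : ℕ) :
    PauliPath n L.length × ℕ × ℂ :=
  ((List.range' t k).map (fwdStage γ L)).foldl stageStep x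

theorem forwardRun_succ (t : ℕ) (x : PauliPath n L.length × ℕ × ℂ) (k : ℕ) :
    forwardRun γ L t x (k + 1) = stageStep (forwardRun γ L t x k) (fwdStage γ L (t + k)) := by
  rw [forwardRun, List.range'_1_concat, List.map_append, List.foldl_append]
  rfl

/-- The path after `k` stages towards the beginning. -/
def backwardRun (γ : ℝ) (L : Circuit n) (ℓ t : ℕ) (x : PauliPath n L.length × ℕ × ℂ) (k : ℕ) :
    PauliPath n L.length × ℕ × ℂ :=
  ((List.range' (t - k) k).reverse.map (bwdStage γ ℓ L)).foldl stageStep x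

theorem backwardRun_succ {t k : ℕ} (x : PauliPath n L.length × ℕ × ℂ) (hk : k < t) :
    backwardRun γ L ℓ t x (k + 1) =
      stageStep (backwardRun γ L ℓ t x k) (bwdStage γ ℓ L (t - (k + 1))) := by
  rw [backwardRun, List.range'_succ, List.reverse_cons, List.map_append, List.foldl_append,
    show t - (k + 1) + 1 = t - k by omega]
  rfl

theorem foldl_pathStages (t : ℕ) (x : PauliPath n L.length × ℕ × ℂ) :
    (pathStages γ ℓ L t).foldl stageStep x =
      backwardRun γ L ℓ t (forwardRun γ L t x (L.length - t)) t := by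
  rw [pathStages, List.foldl_append, backwardRun, Nat.sub_self, ← List.range_eq_range']
  rfl

theorem forwardRun_apply {t i k : ℕ} (x : PauliPath n L.length × ℕ × ℂ) (hi : i ≤ t)
    (hk : t + k ≤ L.length) :
    (forwardRun γ L t x k).1 (Fin.ofNat _ i) = x.1 (Fin.ofNat _ i) := by
  induction k with
  | zero => rfl
  | succ k ih =>
    rw [forwardRun_succ, ← ih (by omega)]
    refine Function.update_of_ne ?_ _ _
    rw [fwdStage, Ne, ofNat_inj (by omega) (by omega)]
    omega

theorem backwardRun_apply {t i k : ℕ} (x : PauliPath n L.length × ℕ × ℂ) (hi : t ≤ i)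
    (hi' : i ≤ L.length) (hk : k ≤ t) :
    (backwardRun γ L ℓ t x k).1 (Fin.ofNat _ i) = x.1 (Fin.ofNat _ i) := by
  induction k with
  | zero => rfl
  | succ k ih =>
    rw [backwardRun_succ x (by omega), ← ih (by omega)]
    refine Function.update_of_ne ?_ _ _
    rw [bwdStage, Ne, ofNat_inj (by omega) (by omega)]
    omega

/-- A bound for the time that is needed for a tape. -/
def coreTime (n d τ V : ℕ) : ℕ := d * (layerTime n τ V + 4) + 17 * n + 2 * τ + 40

/-- Between the forward and the backward pass only the current string is reset to the starting
string; tape, weight and amplitude run on. Excess weight and unread digits are detected at the very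
end, by setting the amplitude to zero. -/
theorem coreProg_spec (hI : Presents I L ρ) {F : Program} {c : PauliString n → ℂ}
    (hF : ∀ P s, Env γ L ℓ s → Stores 1 P s →
      Halts I τ F s (τ + n + 3) fun s' => s'.sreg 9 = s.sreg 9 * c P)
    (hF' : (F.envFree && F.avoids 0 20 && F.avoids 0 21 && F.avoids 2 0) = true)
    {P : PauliString n} {s : State} (he : Env γ L ℓ s) (h0 : Stores 0 P s) {t v : ℕ}
    (ht : t ≤ L.length) (h16 : s.reg 16 = t) (h18 : s.reg 18 = v) :
    Halts I τ (coreProg stepAmpProg F) s (coreTime n L.length τ v) fun s' =>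
      s'.sreg 0 = s.sreg 0 + tapeValue γ ℓ L ρ c t P (s.sreg 8) v := by
  obtain ⟨x, hx⟩ : ∃ x : PauliPath n L.length × ℕ × ℂ,
    (fun _ => P, v, s.sreg 8 * noiseFactor γ P) = x := ⟨_, rfl⟩
  obtain ⟨y, hy⟩ : ∃ y, forwardRun γ L t x (L.length - t) = y := ⟨_, rfl⟩
  obtain ⟨z, hz⟩ : ∃ z, backwardRun γ L ℓ t y t = z := ⟨_, rfl⟩
  have hFt : SameTargets (.loop (.lt 24 3) (fwdProg stepAmpProg))
      (.loop (.lt 24 3) (fwdProg fun _ => ampTargets)) :=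
    fun c k => fwdProg_sameTargets stepAmpProg_sameTargets c k
  have hBt : SameTargets (.loop (.lt 0 24) (bwdProg stepAmpProg))
      (.loop (.lt 0 24) (bwdProg fun _ => ampTargets)) :=
    fun c k => bwdProg_sameTargets stepAmpProg_sameTargets c k
  simp only [Bool.and_eq_true] at hF'
  obtain ⟨⟨⟨hFe, hF20⟩, hF21⟩, hF0⟩ := hF'
  have htime : (L.length - t) * (layerTime n τ v + 1 + 1) + t * (layerTime n τ v + 3 + 1) ≤
      L.length * (layerTime n τ v + 4) := by
    calc _ ≤ (L.length - t) * (layerTime n τ v + 4) + t * (layerTime n τ v + 4) := by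
          exact Nat.add_le_add (Nat.mul_le_mul_left _ (by omega)) (Nat.mul_le_mul_left _ (by omega))
      _ = _ := by rw [← add_mul, Nat.sub_add_cancel ht]
  have hlast : Fin.ofNat (L.length + 1) L.length = Fin.last _ :=
    Fin.ext (Nat.mod_eq_of_lt (Nat.lt_succ_self _))
  -- The backward pass leaves the last entry alone, so the coefficient of the state can be read
  -- before it.
  have hzlast : z.1 (Fin.last _) = y.1 (Fin.last _) := by
    rw [← hlast, ← hz, backwardRun_apply y ht le_rfl le_rfl]
  -- The forward pass leaves entry `t` alone, so the backward pass can start from the saved copy.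
  have hyt : y.1 (Fin.ofNat _ t) = P := by
    rw [← hy, forwardRun_apply x le_rfl (by omega), ← hx]
  have htv : tapeValue γ ℓ L ρ c t P (s.sreg 8) v = if z.2.1 = 0 then z.2.2 *
      (if PauliPath.weight z.1 ≤ ℓ then Matrix.trace (ρ * (y.1 (Fin.last _)).toOp) * c (z.1 0)
        else 0) else 0 := by
    rw [tapeValue, foldl_pathStages, hx, hy, hz, hzlast]
  refine Halts.le (Halts.seq (B := 4) (R := fun s' => s'.reg 20 = v ∧ s'.reg 21 = 0 ∧
      s'.sreg 9 = s.sreg 8 ∧ s'.reg 24 = t) (Halts.block ?_ ?_) fun s1 a1 h1 =>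
    Halts.seq (copyProg_spec (P := P) (he.of_agree a1 rfl) (h0.of_arr_eq (a1.arr 0 rfl)))
    fun s2 a2 h2 => Halts.seq (R := Follows γ L ℓ v t {t} x) ((weighProg_spec (x := (P, v, s.sreg
        8))
      ⟨(he.of_agree a1 rfl).of_agree a2 rfl, h2, (a2.reg 20 rfl).trans h1.1,
        (a2.sreg 9 rfl).trans h1.2.2.1⟩).mono le_rfl ?_) fun s3 a3 h3 =>
    Halts.seq (R := Follows γ L ℓ v L.length (Finset.Icc t L.length) y)
      (Halts.loop (L.length - t) (B := layerTime n τ v + 1) (fun k => Follows γ L ℓ v (t + k)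
        (Finset.Icc t (t + k)) (forwardRun γ L t x k)) ?_ ?_ ?_) fun s4 a4 h4 =>
    Halts.seq (B := τ + n + 3) (R := fun s' => s'.reg 24 = t ∧
      s'.sreg 7 = Matrix.trace (ρ * (y.1 (Fin.last _)).toOp)) (Halts.block ?_ ?_) fun s5 a5 h5 =>
    Halts.seq (copyProg_spec (P := P) (h4.running.env.of_agree a5 rfl) ?_) fun s6 a6 h6 =>
    Halts.seq (R := Follows γ L ℓ v 0 (Finset.Icc 0 L.length) z)
      (Halts.loop t (B := layerTime n τ v + 3) (fun k => Follows γ L ℓ v (t - k)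
        (Finset.Icc (t - k) L.length) (backwardRun γ L ℓ t y k)) ?_ ?_ ?_) fun s7 a7 h7 =>
    Halts.seq (B := 1) (R := fun s' => s'.sreg 9 = z.2.2 * Matrix.trace (ρ * (y.1 (Fin.last
        _)).toOp))
      (Halts.block ?_ ?_) fun s8 a8 h8 =>
    Halts.seq (hF (z.1 0) s8 (h7.running.env.of_agree a8 rfl)
      (h7.running.string.of_arr_eq (a8.arr 1 rfl))) fun s9 a9 h9 =>
    Halts.seq (R := fun s' => s'.sreg 9 = if PauliPath.weight z.1 ≤ ℓ then
        z.2.2 * Matrix.trace (ρ * (y.1 (Fin.last _)).toOp) * c (z.1 0) else 0)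
      (Halts.branch (B := 1) (fun hb => Halts.block ?_ ?_) fun hb => Halts.skip ?_)
      fun s10 a10 h10 =>
    Halts.seq (R := fun s' => s'.sreg 9 = tapeValue γ ℓ L ρ c t P (s.sreg 8) v)
      (Halts.branch (B := 1) (fun hb => Halts.block ?_ ?_) fun hb => Halts.skip ?_)
      fun s11 a11 h11 => Halts.block (B := 1) ?_ ?_) ?_
  · simp [execs, Instr.exec, he.zero, he.szero, h16, h18]
  · simp [costs, Instr.cost]
  · rintro s3 a3 ⟨r, hW, -⟩
    refine ⟨?_, ?_, ?_, hx ▸ le_rfl⟩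
    · rw [← hx]; exact r
    · rw [a3.reg 24 rfl, a2.reg 24 rfl, h1.2.2.2]
    · rw [hW, a2.reg 21 rfl, h1.2.1, zero_add, Finset.sum_singleton, ← hx]
  · simpa [forwardRun] using h3
  · intro k hk s' _ hf
    refine ⟨?_, ?_⟩
    · have hp : s'.reg 24 = t + k := hf.position
      show s'.reg 24 < s'.reg 3
      rw [hp, hf.running.env.depth]
      omega
    · have hA : Finset.Icc t (t + (k + 1)) = insert (t + k + 1) (Finset.Icc t (t + k)) := by
        ext i; simp only [Finset.mem_Icc, Finset.mem_insert]; omega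
      rw [hA, forwardRun_succ]
      exact fwdProg_spec (u := t + k) hI hf (by omega) fun i hi => (Finset.mem_Icc.1 hi).2
  · intro s' _ hf
    rw [hy, Nat.add_sub_cancel' ht] at hf
    refine ⟨?_, hf⟩
    show ¬ s'.reg 24 < s'.reg 3
    rw [hf.position, hf.running.env.depth]
    exact lt_irrefl _
  · have e4 := h4.running.env
    have h16' : s4.reg 16 = t := by
      rw [(a4.congr hFt).reg 16 rfl, a3.reg 16 rfl, a2.reg 16 rfl, a1.reg 16 rfl, h16]
    obtain ⟨w, hw, hw'⟩ := word_of_stores (s := s4.setArr 1 0 4) (k := 1)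
      (P := y.1 (Fin.ofNat _ L.length)) fun j => by simpa using h4.running.string j
    simp only [State.setArr_arr, if_true, Function.update_self] at hw
    rw [← hlast, ← hw']
    simp [execs, Instr.exec, e4.zero, e4.four, e4.qubits_succ, h16', hw, hI.state]
  · simp [costs, Instr.cost, Instr.exec, h4.running.env.qubits_succ]
    omega
  · intro j
    rw [a5.arr 0 rfl, (a4.congr hFt).arr 0 rfl, a3.arr 0 rfl, a2.arr 0 rfl, a1.arr 0 rfl]
    exact h0 j
  · refine ⟨⟨(h4.running.env.of_agree a5 rfl).of_agree a6 rfl, ?_, ?_, ?_⟩, ?_, ?_, h4.tape_le⟩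
    · show Stores 1 (y.1 (Fin.ofNat _ (t - 0))) s6
      rwa [Nat.sub_zero, hyt]
    · rw [a6.reg 20 rfl, a5.reg 20 rfl]; exact h4.running.tape
    · rw [a6.sreg 9 rfl, a5.sreg 9 rfl]; exact h4.running.amp
    · rw [a6.reg 24 rfl]; exact h5.1
    · rw [a6.reg 21 rfl, a5.reg 21 rfl]; exact h4.weight
  · intro k hk s' _ hf
    refine ⟨?_, ?_⟩
    · show s'.reg 0 < s'.reg 24
      rw [hf.position, hf.running.env.zero]
      omega
    · have hA : Finset.Icc (t - (k + 1)) L.length =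
          insert (t - (k + 1)) (Finset.Icc (t - k) L.length) := by
        ext i; simp only [Finset.mem_Icc, Finset.mem_insert]; omega
      rw [show t - k = t - (k + 1) + 1 by omega] at hf hA
      rw [hA, backwardRun_succ y hk]
      exact bwdProg_spec hI hf (by omega) fun i hi => by
        rw [Finset.mem_Icc] at hi; omega
  · intro s' _ hf
    rw [hz, Nat.sub_self] at hf
    refine ⟨?_, hf⟩
    show ¬ s'.reg 0 < s'.reg 24
    rw [hf.position, hf.running.env.zero]
    exact lt_irrefl _
  · have h7' : s7.sreg 7 = Matrix.trace (ρ * (y.1 (Fin.last _)).toOp) := by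
      rw [(a7.congr hBt).sreg 7 rfl, a6.sreg 7 rfl, h5.2]
    simp [execs, Instr.exec, h7', h7.running.amp]
  · simp [costs, Instr.cost]
  pick_goal -1
  · rw [coreTime]
    linarith
  all_goals
    have e9 : Env γ L ℓ s9 := (h7.running.env.of_agree a8 rfl).of_agree a9 hFe
    have hW : s9.reg 21 = PauliPath.weight z.1 := by
      rw [a9.reg 21 hF21, a8.reg 21 rfl, h7.weight, PauliPath.weight, Finset.sum_fin_eq_sum_range]
      refine Finset.sum_congr (by ext i; simp) fun i hi => ?_
      rw [Finset.mem_range] at hi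
      rw [dif_pos hi]
      exact congrArg (fun i => PauliString.weight (z.1 i)) (Fin.ext (Nat.mod_eq_of_lt hi))
    have htape : s9.reg 20 = z.2.1 := by
      rw [a9.reg 20 hF20, a8.reg 20 rfl]; exact h7.running.tape
  · have hb' : s9.reg 4 < s9.reg 21 := hb
    rw [e9.threshold, hW] at hb'
    rw [if_neg (not_le.2 hb')]
    simp [execs, Instr.exec, e9.szero]
  · simp [costs, Instr.cost]
  · have hb' : ¬ s9.reg 4 < s9.reg 21 := hb
    rw [e9.threshold, hW] at hb'
    rw [if_pos (not_lt.1 hb'), h9, h8]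
  all_goals
    have e10 : Env γ L ℓ s10 := e9.of_agree a10 rfl
    have htape' : s10.reg 20 = z.2.1 := by rw [a10.reg 20 rfl, htape]
  · have hb' : s10.reg 0 < s10.reg 20 := hb
    rw [e10.zero, htape'] at hb'
    rw [htv, if_neg hb'.ne']
    simp [execs, Instr.exec, e10.szero]
  · simp [costs, Instr.cost]
  · have hb' : ¬ s10.reg 0 < s10.reg 20 := hb
    rw [e10.zero, htape', Nat.pos_iff_ne_zero, not_not] at hb'
    rw [htv, if_pos hb', h10]
    split_ifs <;> ring
  · have h0' : s11.sreg 0 = s.sreg 0 := by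
      rw [a11.sreg 0 rfl, a10.sreg 0 rfl, a9.sreg 0 hF0, a8.sreg 0 rfl, (a7.congr hBt).sreg 0 rfl,
        a6.sreg 0 rfl, a5.sreg 0 rfl, (a4.congr hFt).sreg 0 rfl, a3.sreg 0 rfl, a2.sreg 0 rfl,
        a1.sreg 0 rfl]
    simp [execs, Instr.exec, h11, h0']
  · simp [costs, Instr.cost]

end

/-! ## The main loop -/

/-- Decode register `17` to a Pauli string in array `0`. The weight `1` or `0` in scalar register
`8`
tells if the code is valid and the string has low weight. -/
def decodeProg : Program :=
  .seq (block [.add 40 17 0, .sconst 8 1 0, .add 22 0 0, .add 37 0 0])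
  (.seq (.loop (.lt 37 2)
    (.seq (divMod 40 2) (.seq (block [.add 39 37 1, .store 0 39 0])
      (.seq (.branch (.eq 34 37) (.branch (.eq 40 0) .skip
        (.seq (divMod 35 13) (.seq (block [.store 0 39 34, .add 40 35 0])
          (.branch (.eq 34 0) (block [.sconst 8 0 0]) (block [.add 22 22 7]))))) .skip)
        (block [.add 37 39 0])))))
  (.seq (.branch (.eq 40 0) .skip (block [.sconst 8 0 0]))
    (.branch (.lt 4 22) (block [.sconst 8 0 0]) .skip)))

/-- Load term number `17` of the observable. -/
def termProg : Program :=
  .seq (block [.store 2 0 15, .store 2 1 17, .add 37 0 0])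
  (.seq (.loop (.lt 37 2) (block [.store 2 10 37, .query 38 2 11, .add 37 37 1, .store 0 37 38]))
    (block [.store 2 0 14, .squery 8 2 10]))

/-- Add up the values of all tapes, for all starting points. The program `S` loads a starting
point. -/
def mainProg (S C : Program) : Program :=
  .seq (block [.add 16 0 0]) (.loop (.lt 16 8)
    (.seq (block [.add 17 0 0]) (.seq (.loop (.lt 17 6)
      (.seq S (.seq (block [.add 18 0 0]) (.seq (.loop (.lt 18 5) (.seq C (block [.add 18 18 1])))
        (block [.add 17 17 1])))))
      (block [.add 16 16 1]))))

theorem startStep_fst_le {n : ℕ} (x : ℕ × PauliString n × ℂ) (j : Fin n) :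
    (startStep x j).1 ≤ x.1 := by
  rw [startStep]
  by_cases h : x.1 ≠ 0 ∧ x.1 % n = j
  · rw [if_pos h]
    exact (Nat.div_le_self (x.1 / n) 4).trans (Nat.div_le_self x.1 n)
  · rw [if_neg h]

theorem startStep_of_ne {n : ℕ} (x : ℕ × PauliString n × ℂ) {i j : Fin n} (h : i ≠ j) :
    (startStep x j).2.1 i = x.2.1 i := by
  rw [startStep]
  split_ifs <;> exact Function.update_of_ne h _ _

theorem PauliString.weightBelow_congr {n : ℕ} {P Q : PauliString n} {i : ℕ}
    (h : ∀ j : Fin n, (j : ℕ) < i → P j = Q j) : P.weightBelow i = Q.weightBelow i := by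
  refine Finset.sum_congr rfl fun j hj => ?_
  rw [Finset.mem_range] at hj
  split_ifs with h1 h2 h3 h3 <;> first | rfl | exact absurd ((h _ hj).symm.trans h2) h3 |
    exact absurd ((h _ hj).trans h3) h2

section
variable {n : ℕ} {γ : ℝ} {L : Circuit n} {ℓ : ℕ} {I : Input} {τ : ℕ} {ρ : Op n}

/-- The state of `decodeProg` after `i` qubits. -/
structure Decoding (γ : ℝ) (L : Circuit n) (ℓ U i : ℕ) (x : ℕ × PauliString n × ℂ) (s : State) :
    Prop where
  env : Env γ L ℓ s
  position : s.reg 37 = i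
  code : s.reg 40 = x.1
  code_le : x.1 ≤ U
  letters : ∀ j : Fin n, (j : ℕ) < i → s.arr 0 (j + 1) = x.2.1 j
  factor : s.sreg 8 = x.2.2
  weight : s.reg 22 = (L.length + 1) * x.2.1.weightBelow i

theorem termProg_spec {P : PauliString n} {z : ℂ} {u : ℕ} (hP : ∀ j : Fin n, I.nat [6, u, j] = P j)
    (hz : I.scalar [5, u] = z) {s : State} (he : Env γ L ℓ s) (h17 : s.reg 17 = u) :
    Halts I τ termProg s (n * (τ + 7) + τ + 7) fun s' => Stores 0 P s' ∧ s'.sreg 8 = z := by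
  refine Halts.le (Halts.seq (B := 3) (B' := (n * ((τ + 6) + 1) + 1) + (τ + 3))
    (R := fun s' => s'.arr 2 0 = 6 ∧ s'.arr 2 1 = u ∧ s'.reg 37 = 0) (Halts.block ?_ ?_)
    fun s1 a1 h1 => Halts.seq (R := fun s' => Stores 0 P s' ∧ s'.arr 2 1 = u)
    (Halts.loop n (fun i s' => s'.arr 2 0 = 6 ∧ s'.arr 2 1 = u ∧ s'.reg 37 = i ∧
      ∀ j : Fin n, (j : ℕ) < i → s'.arr 0 (j + 1) = P j)
      ⟨h1.1, h1.2.1, h1.2.2, fun j hj => absurd hj (Nat.not_lt_zero _)⟩ ?_ ?_)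
    fun s2 a2 h2 => Halts.block ?_ ?_) (by linarith)
  · simp [execs, Instr.exec, he.zero, he.one, he.six, h17]
  · simp [costs, Instr.cost]
  · rintro i hi s2 a2 ⟨h20, h21, h37, hst⟩
    have e2 : Env γ L ℓ s2 := (he.of_agree a1 rfl).of_agree a2 rfl
    have hq := hP ⟨i, hi⟩
    refine ⟨?_, Halts.block ⟨?_, ?_, ?_, fun j hj => ?_⟩ ?_⟩
    · show s2.reg 37 < s2.reg 2
      rw [h37, e2.qubits]; exact hi
    · simp [execs, Instr.exec, e2.two, h20]
    · simp [execs, Instr.exec, e2.two, h21]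
    · simp [execs, Instr.exec, h37, e2.one]
    · simp [execs, Instr.exec, h37, e2.one, e2.two, e2.three, State.word, List.range_succ, h20, h21]
      rw [Function.update_apply]
      by_cases hji : (j : ℕ) = i
      · rw [if_pos (by omega), hq]
        exact congrArg _ (congrArg _ (Fin.ext hji.symm))
      · rw [if_neg (by omega)]
        exact hst j (by omega)
    · simp [costs, Instr.cost, Instr.exec, e2.three]
      omega
  · rintro s2 a2 ⟨h20, h21, h37, hst⟩
    have e2 : Env γ L ℓ s2 := (he.of_agree a1 rfl).of_agree a2 rfl
    refine ⟨?_, fun j => hst j j.2, h21⟩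
    show ¬ s2.reg 37 < s2.reg 2
    rw [h37, e2.qubits]
    exact lt_irrefl _
  · have e2 : Env γ L ℓ s2 := (he.of_agree a1 rfl).of_agree a2 rfl
    refine ⟨fun j => by simpa [execs, Instr.exec] using h2.1 j, ?_⟩
    simp [execs, Instr.exec, e2.two, e2.zero, e2.five, State.word, List.range_succ, h2.2, hz]
  · have e2 : Env γ L ℓ s2 := (he.of_agree a1 rfl).of_agree a2 rfl
    simp [costs, Instr.cost, Instr.exec, e2.two]
    omega

theorem decodeStep_spec (hn : 1 ≤ n) {U : ℕ} {i : Fin n} {x : ℕ × PauliString n × ℂ}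
    {s : State} (hs : Decoding γ L ℓ U i x s) :
    Halts I τ (.seq (divMod 40 2) (.seq (block [.add 39 37 1, .store 0 39 0])
      (.seq (.branch (.eq 34 37) (.branch (.eq 40 0) .skip
        (.seq (divMod 35 13) (.seq (block [.store 0 39 34, .add 40 35 0])
          (.branch (.eq 34 0) (block [.sconst 8 0 0]) (block [.add 22 22 7]))))) .skip)
        (block [.add 37 39 0])))) s (6 * U + 18) (Decoding γ L ℓ U (i + 1) (startStep x i)) := by
  have he := hs.env
  have hle := hs.code_le
  have hdiv : x.1 / n ≤ U := (Nat.div_le_self _ _).trans hle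
  have hw := (startStep x i).2.1.weightBelow_succ i.2
  have hw' : (startStep x i).2.1.weightBelow i = x.2.1.weightBelow i :=
    PauliString.weightBelow_congr fun j hj => startStep_of_ne x (fun h => by
      rw [h] at hj; exact lt_irrefl _ hj)
  rw [hw'] at hw
  obtain ⟨y, hy⟩ : ∃ y, startStep x i = y := ⟨_, rfl⟩
  have hyi : ∀ j : Fin n, (j : ℕ) < i → y.2.1 j = x.2.1 j := fun j hj => by
    rw [← hy]
    exact startStep_of_ne x fun h => by rw [h] at hj; exact lt_irrefl _ hj
  have hmiss : ¬ (x.1 ≠ 0 ∧ x.1 % n = i) → y = (x.1, Function.update x.2.1 i 0, x.2.2) := fun h =>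
      by
    rw [← hy, startStep, if_neg h]
  have hhit : x.1 ≠ 0 ∧ x.1 % n = i → y = (x.1 / n / 4,
      Function.update x.2.1 i (Fin.ofNat 4 (x.1 / n)),
      if Fin.ofNat 4 (x.1 / n) = 0 then 0 else x.2.2) := fun h => by
    rw [← hy, startStep, if_pos h]
  have hyle : y.1 ≤ x.1 := hy ▸ startStep_fst_le x i
  rw [hy] at hw ⊢
  refine Halts.le (Halts.seq (B := 3 * U + 4) (B' := 2 + ((0 + ((3 * U + 4) + (2 + (1 + 1 + 1))) +
      1 +
      0 + 1) + 1)) (R := fun s' => s'.reg 34 = x.1 % n ∧ s'.reg 35 = x.1 / n) ?_ fun s1 a1 h1 =>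
    Halts.seq (R := fun s' => s'.reg 39 = i + 1 ∧ s'.arr 0 (i + 1) = 0 ∧
      ∀ j : Fin n, (j : ℕ) < i → s'.arr 0 (j + 1) = x.2.1 j)
      (Halts.block ?_ ?_) fun s2 a2 h2 =>
    Halts.seq (R := fun s' => s'.reg 40 = y.1 ∧ s'.arr 0 (i + 1) = y.2.1 i ∧
      (∀ j : Fin n, (j : ℕ) < i → s'.arr 0 (j + 1) = x.2.1 j) ∧ s'.sreg 8 = y.2.2 ∧
      s'.reg 22 = (L.length + 1) * y.2.1.weightBelow (i + 1))
      (Halts.branch (fun hb => Halts.branch (fun hb' => Halts.skip ?_) fun hb' =>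
        Halts.seq (R := fun s' => s'.reg 34 = x.1 / n % 4 ∧ s'.reg 35 = x.1 / n / 4) ?_
          fun s3 a3 h3 => Halts.seq (R := fun s' => s'.reg 40 = x.1 / n / 4 ∧
            s'.arr 0 (i + 1) = x.1 / n % 4 ∧ s'.reg 34 = x.1 / n % 4 ∧
            ∀ j : Fin n, (j : ℕ) < i → s'.arr 0 (j + 1) = x.2.1 j) (Halts.block ?_ ?_)
          fun s4 a4 h4 => Halts.branch (fun hc => Halts.block ?_ ?_) fun hc => Halts.block ?_ ?_)
        fun hb => Halts.skip ?_)
      fun s5 a5 h5 => (Halts.block (Q := fun s' => s'.reg 37 = i + 1) ?_ ?_).mono le_rfl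
        fun s6 a6 h6 => ?_) (by omega)
  · refine (divMod_spec he.one (by rw [he.qubits]; exact hn) (by norm_num)
      (by norm_num)).mono (by rw [hs.code]; omega) fun s' _ h => ?_
    rwa [he.qubits, hs.code] at h
  all_goals have e1 : Env γ L ℓ s1 := he.of_agree a1 rfl
  · have k37 : s1.reg 37 = i := (a1.reg 37 rfl).trans hs.position
    refine ⟨by simp [execs, Instr.exec, k37, e1.one],
      by simp [execs, Instr.exec, k37, e1.one, e1.zero], fun j hj => ?_⟩
    have := hs.letters j hj
    rw [← congrFun (a1.arr 0 rfl)] at this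
    have hne : (j : ℕ) ≠ i := hj.ne
    simpa [execs, Instr.exec, k37, e1.one, e1.zero, Function.update_apply, hne] using this
  · simp [costs, Instr.cost]
  all_goals
    have e2 : Env γ L ℓ s2 := e1.of_agree a2 rfl
    have k34 : s2.reg 34 = x.1 % n := (a2.reg 34 rfl).trans h1.1
    have k37 : s2.reg 37 = i := by rw [a2.reg 37 rfl, a1.reg 37 rfl, hs.position]
    have k40 : s2.reg 40 = x.1 := by rw [a2.reg 40 rfl, a1.reg 40 rfl, hs.code]
    have k22 : s2.reg 22 = (L.length + 1) * x.2.1.weightBelow i := by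
      rw [a2.reg 22 rfl, a1.reg 22 rfl, hs.weight]
    have k8 : s2.sreg 8 = x.2.2 := by rw [a2.sreg 8 rfl, a1.sreg 8 rfl, hs.factor]
    have hskip : ¬ (x.1 ≠ 0 ∧ x.1 % n = i) → s2.reg 40 = y.1 ∧ s2.arr 0 (i + 1) = y.2.1 i ∧
        (∀ j : Fin n, (j : ℕ) < i → s2.arr 0 (j + 1) = x.2.1 j) ∧ s2.sreg 8 = y.2.2 ∧
        s2.reg 22 = (L.length + 1) * y.2.1.weightBelow (i + 1) := fun h => by
      rw [hw, hmiss h]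
      simp [k40, h2.2.1, k8, k22]
      exact h2.2.2
  · refine hskip fun h => h.1 ?_
    have hb'' : s2.reg 40 = s2.reg 0 := hb'
    rw [← k40, hb'', e2.zero]
  · have k35 : s2.reg 35 = x.1 / n := (a2.reg 35 rfl).trans h1.2
    refine (divMod_spec e2.one (by rw [e2.four]; norm_num) (by norm_num)
      (by norm_num)).mono (by rw [k35]; omega) fun s' _ h => ?_
    rwa [e2.four, k35] at h
  · have e3 : Env γ L ℓ s3 := e2.of_agree a3 rfl
    have k39 : s3.reg 39 = i + 1 := (a3.reg 39 rfl).trans h2.1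
    refine ⟨by simp [execs, Instr.exec, h3.2, e3.zero], by simp [execs, Instr.exec, h3.1, k39],
      by simp [execs, Instr.exec, h3.1], fun j hj => ?_⟩
    have := h2.2.2 j hj
    rw [← congrFun (a3.arr 0 rfl)] at this
    have hne : (j : ℕ) ≠ i := hj.ne
    simpa [execs, Instr.exec, k39, Function.update_apply, hne] using this
  · simp [costs, Instr.cost]
  pick_goal 5
  · refine hskip fun h => hb ?_
    show s2.reg 34 = s2.reg 37
    rw [k34, k37, h.2]
  pick_goal 2
  · simp [costs, Instr.cost]
  pick_goal 3
  · simp [costs, Instr.cost]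
  pick_goal 4
  · simp [costs, Instr.cost]
  pick_goal 3
  · have e5 : Env γ L ℓ s5 := by
      refine e2.of_agree a5 rfl
    have k39 : s5.reg 39 = i + 1 := (a5.reg 39 rfl).trans h2.1
    simp [execs, Instr.exec, k39, e5.zero]
  pick_goal 3
  · refine ⟨(e2.of_agree a5 rfl).of_agree a6 rfl, h6, (a6.reg 40 rfl).trans h5.1,
      hyle.trans hle, fun j hj => ?_, (a6.sreg 8 rfl).trans h5.2.2.2.1,
      (a6.reg 22 rfl).trans h5.2.2.2.2⟩
    rw [a6.arr 0 rfl]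
    rcases Nat.lt_succ_iff_lt_or_eq.1 hj with hj | hj
    · rw [h5.2.2.1 j hj, hyi j hj]
    · rw [Fin.ext hj]
      exact h5.2.1
  all_goals
    have e4 : Env γ L ℓ s4 := (e2.of_agree a3 rfl).of_agree a4 rfl
    have hx : x.1 ≠ 0 ∧ x.1 % n = i := by
      refine ⟨fun h => hb' ?_, ?_⟩
      · show s2.reg 40 = s2.reg 0
        rw [k40, h, e2.zero]
      · rw [← k34, ← k37]; exact hb
    have q22 : s4.reg 22 = (L.length + 1) * x.2.1.weightBelow i := by
      rw [a4.reg 22 rfl, a3.reg 22 rfl, k22]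
    have q8 : s4.sreg 8 = x.2.2 := by
      rw [a4.sreg 8 rfl, a3.sreg 8 rfl, k8]
    rw [hw, hhit hx]
  · have hc' : s4.reg 34 = s4.reg 0 := hc
    rw [h4.2.2.1, e4.zero] at hc'
    have h0 : Fin.ofNat 4 (x.1 / n) = 0 := Fin.ext hc'
    simp only [Function.update_self, if_pos h0]
    refine ⟨by simp [execs, Instr.exec, h4.1], by simp [execs, Instr.exec, h4.2.1],
      by simpa [execs, Instr.exec] using h4.2.2.2, by simp [execs, Instr.exec], ?_⟩
    simp [execs, Instr.exec, q22]
  · have h0 : Fin.ofNat 4 (x.1 / n) ≠ 0 := fun h0 => hc (by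
      show s4.reg 34 = s4.reg 0
      rw [h4.2.2.1, e4.zero]
      exact congrArg Fin.val h0)
    simp only [Function.update_self, if_neg h0]
    refine ⟨by simp [execs, Instr.exec, h4.1], by simp [execs, Instr.exec, h4.2.1],
      by simpa [execs, Instr.exec] using h4.2.2.2, by simp [execs, Instr.exec, q8], ?_⟩
    simp [execs, Instr.exec, q22, e4.depth_succ, mul_add]

/-- Unusable codes are not skipped but get the initial amplitude zero, so that the main loop runs
over a plain interval of numbers. -/
theorem decodeProg_spec (hn : 1 ≤ n) {u : ℕ} {x : ℕ × PauliString n × ℂ}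
    (hx : (List.finRange n).foldl startStep (u, 0, 1) = x) {s : State} (he : Env γ L ℓ s)
    (h17 : s.reg 17 = u) :
    Halts I τ decodeProg s (n * (6 * u + 19) + 9) fun s' => Stores 0 x.2.1 s' ∧
      s'.sreg 8 = if x.1 = 0 ∧ IsLow L.length ℓ x.2.1 then x.2.2 else 0 := by
  have hlen : (List.finRange n).length = n := List.length_finRange
  refine Halts.le (Halts.seq (B := 4) (B' := (n * ((6 * u + 18) + 1) + 1) + ((0 + 1 + 1) + (1 + 0 +
      1)))
    (R := Decoding γ L ℓ u 0 (u, 0, 1)) ?_ fun s1 a1 h1 =>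
    Halts.seq (R := Decoding γ L ℓ u n x)
      (Halts.loop n (fun i => Decoding γ L ℓ u i (((List.finRange n).take i).foldl startStep (u, 0,
          1)))
        h1 ?_ ?_) fun s2 a2 h2 =>
    Halts.seq (R := fun s' => s'.sreg 8 = if x.1 = 0 then x.2.2 else 0)
      (Halts.branch (fun hb => Halts.skip ?_) fun hb => Halts.block ?_ ?_) fun s3 a3 h3 =>
    (Halts.branch (Q := fun s' => s'.sreg 8 = if x.1 = 0 ∧ IsLow L.length ℓ x.2.1 then x.2.2 else 0)
      (fun hb => Halts.block ?_ ?_) fun hb => Halts.skip ?_).mono le_rfl fun s4 a4 h4 =>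
      ⟨fun j => ?_, h4⟩) (by linarith)
  · refine (Halts.block (Q := fun s' => s'.reg 40 = u ∧ s'.sreg 8 = 1 ∧ s'.reg 22 = 0 ∧
      s'.reg 37 = 0) ?_ ?_).mono le_rfl fun s' ha h => ⟨he.of_agree ha rfl, h.2.2.2, h.1, le_rfl,
        fun j hj => absurd hj (Nat.not_lt_zero _), h.2.1, ?_⟩
    · simp [execs, Instr.exec, h17, he.zero]
    · simp [costs, Instr.cost]
    · rw [h.2.2.1]; simp [PauliString.weightBelow]
  · intro i hi s' _ hd
    refine ⟨?_, ?_⟩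
    · show s'.reg 37 < s'.reg 2
      rw [hd.position, hd.env.qubits]; exact hi
    · rw [List.take_succ_eq_append_getElem (by rw [hlen]; exact hi), List.foldl_append,
        List.getElem_finRange]
      exact decodeStep_spec (i := ⟨i, hi⟩) hn hd
  · intro s' _ hd
    rw [List.take_of_length_le hlen.le, hx] at hd
    refine ⟨?_, hd⟩
    show ¬ s'.reg 37 < s'.reg 2
    rw [hd.position, hd.env.qubits]
    exact lt_irrefl _
  · have hb' : s2.reg 40 = s2.reg 0 := hb
    rw [h2.code, h2.env.zero] at hb'
    rw [if_pos hb', h2.factor]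
  · have hb' : ¬ s2.reg 40 = s2.reg 0 := hb
    rw [h2.code, h2.env.zero] at hb'
    rw [if_neg hb']
    simp [execs, Instr.exec]
  · simp [costs, Instr.cost]
  all_goals
    have e3 : Env γ L ℓ s3 := h2.env.of_agree a3 rfl
    have hw : s3.reg 22 = (L.length + 1) * x.2.1.weight := by
      rw [a3.reg 22 rfl, h2.weight, PauliString.weightBelow_eq]
  · have hb' : s3.reg 4 < s3.reg 22 := hb
    rw [e3.threshold, hw] at hb'
    rw [if_neg fun h => absurd h.2 (not_le.2 hb')]
    simp [execs, Instr.exec]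
  · simp [costs, Instr.cost]
  · have hb' : ¬ s3.reg 4 < s3.reg 22 := hb
    rw [e3.threshold, hw] at hb'
    rw [h3]
    exact if_congr ⟨fun h => ⟨h, not_lt.1 hb'⟩, And.left⟩ rfl rfl
  · rw [a4.arr 0 rfl, a3.arr 0 rfl]
    exact h2.letters j j.2

/-- The sizes of the loops. -/
structure Sized (γ : ℝ) (L : Circuit n) (ℓ T U V : ℕ) (s : State) : Prop where
  env : Env γ L ℓ s
  layers : s.reg 8 = T
  starts : s.reg 6 = U
  tapes : s.reg 5 = V

/-- The program does not overwrite the constants and the sizes of the loops. -/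
def Program.sizedFree (p : Program) : Bool :=
  p.envFree && p.avoids 0 8 && p.avoids 0 6 && p.avoids 0 5

theorem Sized.of_agree {T U V : ℕ} {p : Program} {s s' : State} (h : Sized γ L ℓ T U V s)
    (ha : Agree p s s') (hp : p.sizedFree = true) : Sized γ L ℓ T U V s' := by
  simp only [Program.sizedFree, Bool.and_eq_true] at hp
  exact ⟨h.env.of_agree ha hp.1.1.1, (ha.reg _ hp.1.1.2).trans h.layers,
    (ha.reg _ hp.1.2).trans h.starts, (ha.reg _ hp.2).trans h.tapes⟩

theorem coreTime_mono {n d τ V W : ℕ} (h : V ≤ W) : coreTime n d τ V ≤ coreTime n d τ W := by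
  unfold coreTime layerTime
  gcongr

/-- A bound for the time of the main loop. -/
def mainTime (n d τ B T U V : ℕ) : ℕ :=
  T * (U * (B + V * (coreTime n d τ V + 2) + 4) + 4) + 2

/-- The loader `S` of starting strings and the final factor `F` are kept abstract, since the two
programs differ only there and in the sizes of the loops. -/
theorem mainProg_spec (hI : Presents I L ρ) {F : Program} {c : PauliString n → ℂ}
    (hF : ∀ P s, Env γ L ℓ s → Stores 1 P s →
      Halts I τ F s (τ + n + 3) fun s' => s'.sreg 9 = s.sreg 9 * c P)
    (hF' : (F.envFree && F.avoids 0 20 && F.avoids 0 21 && F.avoids 2 0) = true)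
    (hF'' : ((coreProg (fun _ => ampTargets) F).sizedFree &&
      [16, 17, 18].all (fun i => (coreProg (fun _ => ampTargets) F).avoids 0 i) &&
      (coreProg (fun _ => ampTargets) F).avoids 1 0 &&
      (coreProg (fun _ => ampTargets) F).avoids 2 8) = true)
    {S : Program} {B T U V : ℕ} {P : ℕ → PauliString n} {z : ℕ → ℂ}
    (hS : ∀ u < U, ∀ s, Env γ L ℓ s → s.reg 17 = u →
      Halts I τ S s B fun s' => Stores 0 (P u) s' ∧ s'.sreg 8 = z u)
    (hS' : (S.sizedFree && S.avoids 0 16 && S.avoids 0 17 && S.avoids 2 0) = true)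
    {s : State} (hs : Sized γ L ℓ T U V s) (hT : T ≤ L.length + 1) :
    Halts I τ (mainProg S (coreProg stepAmpProg F)) s (mainTime n L.length τ B T U V) fun s' =>
      s'.sreg 0 = s.sreg 0 + ∑ t ∈ Finset.range T, ∑ u ∈ Finset.range U, ∑ v ∈ Finset.range V,
        tapeValue γ ℓ L ρ c t (P u) (z u) v := by
  have hC := coreProg_sameTargets stepAmpProg_sameTargets F
  simp only [Bool.and_eq_true, List.all_cons, List.all_nil, Bool.and_true] at hF'' hS'
  obtain ⟨⟨⟨hCs, hC16, hC17, hC18⟩, hCarr⟩, hC8⟩ := hF''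
  obtain ⟨⟨⟨hSs, hS16⟩, hS17⟩, hS0⟩ := hS'
  refine Halts.le (Halts.seq (B := 1) (B' := T * ((1 + ((U * ((B + (1 + ((V * ((coreTime n L.length
      τ V
      + 1) + 1) + 1) + 1))) + 1) + 1) + 1)) + 1) + 1)
    (R := fun s' => Sized γ L ℓ T U V s' ∧ s'.reg 16 = 0 ∧ s'.sreg 0 = s.sreg 0) ?_
    fun s1 a1 h1 => Halts.loop T (fun t s' => Sized γ L ℓ T U V s' ∧ s'.reg 16 = t ∧
      s'.sreg 0 = s.sreg 0 + ∑ t ∈ Finset.range t, ∑ u ∈ Finset.range U, ∑ v ∈ Finset.range V,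
        tapeValue γ ℓ L ρ c t (P u) (z u) v) ⟨h1.1, h1.2.1, ?_⟩ ?_ ?_) ?_
  · refine (Halts.block (Q := fun s' => s'.reg 16 = 0) ?_ ?_).mono le_rfl fun s' ha h =>
      ⟨hs.of_agree ha rfl, h, ha.sreg 0 rfl⟩
    · simp [execs, Instr.exec, hs.env.zero]
    · simp [costs, Instr.cost]
  · rw [h1.2.2]; simp
  · rintro t ht s2 _ ⟨z2, h16, h0⟩
    refine ⟨?_, Halts.seq (R := fun s' => Sized γ L ℓ T U V s' ∧ s'.reg 16 = t ∧ s'.reg 17 = 0 ∧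
        s'.sreg 0 = s2.sreg 0) ?_ fun s3 a3 h3 => Halts.seq (R := fun s' => Sized γ L ℓ T U V s' ∧
        s'.reg 16 = t ∧ s'.sreg 0 = s2.sreg 0 + ∑ u ∈ Finset.range U, ∑ v ∈ Finset.range V,
        tapeValue γ ℓ L ρ c t (P u) (z u) v)
      (Halts.loop U (fun u s' => Sized γ L ℓ T U V s' ∧ s'.reg 16 = t ∧ s'.reg 17 = u ∧
        s'.sreg 0 = s2.sreg 0 + ∑ u ∈ Finset.range u, ∑ v ∈ Finset.range V,
          tapeValue γ ℓ L ρ c t (P u) (z u) v) ⟨h3.1, h3.2.1, h3.2.2.1, ?_⟩ ?_ ?_)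
      fun s4 a4 h4 => (Halts.block (Q := fun s' => s'.reg 16 = t + 1) ?_ ?_).mono le_rfl
        fun s5 a5 h5 => ⟨h4.1.of_agree a5 rfl, h5, ?_⟩⟩
    · show s2.reg 16 < s2.reg 8
      rw [h16, z2.layers]; exact ht
    · refine (Halts.block (Q := fun s' => s'.reg 17 = 0) ?_ ?_).mono le_rfl fun s' ha h =>
        ⟨z2.of_agree ha rfl, (ha.reg 16 rfl).trans h16, h, ha.sreg 0 rfl⟩
      · simp [execs, Instr.exec, z2.env.zero]
      · simp [costs, Instr.cost]
    · rw [h3.2.2.2]; simp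
    · rintro u hu s4 _ ⟨z4, g16, g17, g0⟩
      refine ⟨?_, Halts.seq (R := fun s' => Sized γ L ℓ T U V s' ∧ s'.reg 16 = t ∧ s'.reg 17 = u ∧
          s'.sreg 0 = s4.sreg 0 ∧ Stores 0 (P u) s' ∧ s'.sreg 8 = z u)
          ((hS u hu s4 z4.env g17).mono le_rfl fun s' ha h => ⟨z4.of_agree ha hSs,
            (ha.reg 16 hS16).trans g16, (ha.reg 17 hS17).trans g17, ha.sreg 0 hS0, h⟩)
        fun s5 a5 ⟨z5, k16, k17, k0, kst, k8⟩ =>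
        Halts.seq (R := fun s' => s'.reg 18 = 0) (Halts.block ?_ ?_) fun s6 a6 h6 =>
        Halts.seq (R := fun s' => Sized γ L ℓ T U V s' ∧ s'.reg 16 = t ∧ s'.reg 17 = u ∧
          s'.sreg 0 = s4.sreg 0 + ∑ v ∈ Finset.range V, tapeValue γ ℓ L ρ c t (P u) (z u) v)
        (Halts.loop V (fun v s' => Sized γ L ℓ T U V s' ∧ s'.reg 16 = t ∧ s'.reg 17 = u ∧
          s'.reg 18 = v ∧ Stores 0 (P u) s' ∧ s'.sreg 8 = z u ∧
          s'.sreg 0 = s4.sreg 0 + ∑ v ∈ Finset.range v, tapeValue γ ℓ L ρ c t (P u) (z u) v)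
          ⟨z5.of_agree a6 rfl, (a6.reg 16 rfl).trans k16, (a6.reg 17 rfl).trans k17, h6,
            kst.of_arr_eq (a6.arr 0 rfl), (a6.sreg 8 rfl).trans k8, ?_⟩ ?_ ?_)
        fun s7 a7 h7 => (Halts.block (Q := fun s' => s'.reg 17 = u + 1) ?_ ?_).mono le_rfl
          fun s8 a8 h8 => ⟨h7.1.of_agree a8 rfl, (a8.reg 16 rfl).trans h7.2.1, h8, ?_⟩⟩
      · show s4.reg 17 < s4.reg 6
        rw [g17, z4.starts]; exact hu
      · simp [execs, Instr.exec, z5.env.zero]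
      · simp [costs, Instr.cost]
      · rw [a6.sreg 0 rfl, k0]; simp
      · rintro v hv s7 _ ⟨z7, l16, l17, l18, lst, l8, l0⟩
        refine ⟨?_, Halts.seq ((coreProg_spec (P := P u) hI hF hF' z7.env lst (by omega) l16
          l18).mono (coreTime_mono hv.le) fun s8 a8 h8 => (⟨a8.congr hC, h8⟩ :
            Agree (coreProg (fun _ => ampTargets) F) s7 s8 ∧ _))
          fun s8 _ ⟨a8, h8⟩ => (Halts.block (Q := fun s' => s'.reg 18 = v + 1) ?_ ?_).mono le_rfl
          fun s9 a9 h9 => ⟨(z7.of_agree a8 hCs).of_agree a9 rfl,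
            (a9.reg 16 rfl).trans ((a8.reg 16 hC16).trans l16),
            (a9.reg 17 rfl).trans ((a8.reg 17 hC17).trans l17), h9,
            (lst.of_arr_eq (a8.arr 0 hCarr)).of_arr_eq (a9.arr 0 rfl),
            (a9.sreg 8 rfl).trans ((a8.sreg 8 hC8).trans l8), ?_⟩⟩
        · show s7.reg 18 < s7.reg 5
          rw [l18, z7.tapes]; exact hv
        · simp [execs, Instr.exec, (z7.of_agree a8 hCs).env.one, (a8.reg 18 hC18).trans l18]
        · simp [costs, Instr.cost]
        · rw [a9.sreg 0 rfl, h8, l0, l8, Finset.sum_range_succ, add_assoc]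
      · rintro s7 _ ⟨z7, l16, l17, l18, -, -, l0⟩
        refine ⟨?_, z7, l16, l17, l0⟩
        show ¬ s7.reg 18 < s7.reg 5
        rw [l18, z7.tapes]; exact lt_irrefl _
      · simp [execs, Instr.exec, h7.1.env.one, h7.2.2.1]
      · simp [costs, Instr.cost]
      · rw [a8.sreg 0 rfl, h7.2.2.2, g0, Finset.sum_range_succ, add_assoc]
    · rintro s4 _ ⟨z4, g16, g17, g0⟩
      refine ⟨?_, z4, g16, g0⟩
      show ¬ s4.reg 17 < s4.reg 6
      rw [g17, z4.starts]; exact lt_irrefl _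
    · simp [execs, Instr.exec, h4.1.env.one, h4.2.1]
    · simp [costs, Instr.cost]
    · rw [a5.sreg 0 rfl, h4.2.2, h0, Finset.sum_range_succ, add_assoc]
  · rintro s2 _ ⟨z2, h16, h0⟩
    refine ⟨?_, h0⟩
    show ¬ s2.reg 16 < s2.reg 8
    rw [h16, z2.layers]; exact lt_irrefl _
  · rw [mainTime]
    exact le_of_eq (by ring)

end

/-! ## Preparations -/

/-- The least `k` with `a * x ^ (k + 1) ≤ b`. -/
def powIndex (x a b : ℝ) : ℕ := sInf {k : ℕ | a * x ^ (k + 1) ≤ b}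

/-- The powers of `x` tend to zero, so the infimum is over a nonempty set and hence attained. -/
theorem powIndex_spec {x a b : ℝ} (hx : 0 < x) (hx1 : x < 1) (ha : 0 < a) (hb : 0 < b) :
    a * x ^ (powIndex x a b + 1) ≤ b := by
  have h : {k : ℕ | a * x ^ (k + 1) ≤ b}.Nonempty := by
    obtain ⟨k, hk⟩ := exists_pow_lt_of_lt_one (div_pos hb ha) hx1
    refine ⟨k, ?_⟩
    have h1 : x ^ (k + 1) ≤ x ^ k := pow_le_pow_of_le_one hx.le hx1.le (Nat.le_succ k)
    rw [lt_div_iff₀' ha] at hk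
    exact (mul_le_mul_of_nonneg_left h1 ha.le).trans hk.le
  exact Nat.sInf_mem h

theorem lt_of_lt_powIndex {x a b : ℝ} {i : ℕ} (h : i < powIndex x a b) : b < a * x ^ (i + 1) :=
  not_le.1 (Nat.notMem_of_lt_sInf h)

theorem powIndex_le_iff {x a b : ℝ} (hx : 0 < x) (hx1 : x < 1) (ha : 0 < a) (hb : 0 < b) {i : ℕ} :
    powIndex x a b ≤ i ↔ a * x ^ (i + 1) ≤ b := by
  constructor
  · intro h
    exact (mul_le_mul_of_nonneg_left (pow_le_pow_of_le_one hx.le hx1.le (Nat.succ_le_succ h))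
      ha.le).trans (powIndex_spec hx hx1 ha hb)
  · intro h
    by_contra hlt
    exact absurd h (not_le.2 (lt_of_lt_powIndex (not_le.1 hlt)))

/-- The truncation threshold. -/
def threshold (d : ℕ) (γ ε : ℝ) : ℕ :=
  if powIndex (Real.exp (-γ)) 1 ε ≤ d then 0
  else powIndex (Real.exp (-γ)) ((1 / (1 - Real.exp (-γ))) ^ (d + 1)) (ε ^ 2)

/-- The circuit to which the algorithm is applied: nothing remains to be done if the noise damps all
non-identity operators sufficiently. -/
def effective {n : ℕ} (γ ε : ℝ) (L : Circuit n) : Circuit n :=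
  if powIndex (Real.exp (-γ)) 1 ε ≤ L.length then [] else L

/-- The circuit is dropped only when the threshold is zero, where the truncation does not depend on
it. The machine is thereby spared the layers of a very deep circuit. -/
theorem truncated_effective {n : ℕ} (γ ε : ℝ) (L : Circuit n) (O : Op n) :
    truncated γ (threshold L.length γ ε) (effective γ ε L) O =
      truncated γ (threshold L.length γ ε) L O := by
  rw [effective, threshold]
  split_ifs
  · rw [truncated_zero, truncated_zero]
  · rfl

/-- Load the constants. -/
def constProg : Program :=
  block [.const 1 1, .const 10 2, .const 11 3, .const 12 7, .const 13 4, .const 14 5, .const 15 6,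
    .sconst 3 (1 / 4) 0]

/-- Load the table of Pauli matrices. -/
def tableProg : Program :=
  block [.sconst 5 1 0, .sconst 6 0 (-1), .sconst 7 0 1, .sconst 8 (-1) 0, .sstore 0 0 5,
    .sstore 3 0 5, .sstore 1 1 5, .sstore 2 1 5, .sstore 1 10 6, .sstore 2 10 7, .sstore 0 11 5,
    .sstore 3 11 8]

/-- Read the number of qubits, the depth, the noise and the accuracy. -/
def readProg : Program :=
  block [.query 2 2 1, .store 2 0 1, .query 3 2 1, .squery 1 2 1, .store 2 0 10, .squery 2 2 1,
    .add 9 2 1, .add 7 3 1]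

/-- Multiply scalar register `11` with `e^{-γ}` until it is at most scalar register `12`, and count
the number of times in register `i`. -/
def searchProg (i : ℕ) : Program :=
  .seq (block [.add i 0 0]) (.loop (.slt 12 11) (block [.smul 11 11 1, .add i i 1]))

/-- Compute the threshold. -/
def thresholdProg : Program :=
  .seq (block [.sadd 11 1 4, .sadd 12 2 4]) (.seq (searchProg 19)
    (.branch (.lt 3 19)
      (.seq (block [.sconst 13 1 0, .ssub 14 13 1, .sdiv 14 13 14, .sadd 11 1 4, .add 37 0 0])
        (.seq (.loop (.lt 37 7) (block [.smul 11 11 14, .add 37 37 1]))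
          (.seq (block [.smul 12 2 2]) (.seq (searchProg 36) (block [.add 4 36 0])))))
      (block [.add 3 0 0, .add 7 0 1])))

/-- Compute the number of tapes. -/
def tapesProg : Program :=
  .seq (block [.add 5 1 0, .add 37 0 0]) (.loop (.lt 37 4)
    (block [.add 5 5 5, .add 5 5 5, .add 5 5 5, .add 5 5 5, .add 5 5 5, .add 5 5 5, .add 5 5 5,
      .add 5 5 5, .add 37 37 1]))

/-- The preparations that do not depend on the observable. -/
def setupProg : Program :=
  .seq (.seq constProg (.seq tableProg readProg)) (.seq thresholdProg tapesProg)

/-- Compute the number of codes of Pauli strings, and the number of starting layers. -/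
def codesProg : Program :=
  .seq (divMod 4 7) (.seq (block [.add 6 1 0, .add 42 2 2, .add 42 42 42, .add 37 0 0, .add 8 7 0])
    (.loop (.lt 37 35) (.seq (block [.add 43 0 0, .add 44 0 0])
      (.seq (.loop (.lt 43 42) (block [.add 44 44 6, .add 43 43 1]))
        (block [.add 6 44 0, .add 37 37 1])))))

/-- Read the number of terms of the observable. -/
def termsProg : Program := block [.store 2 0 14, .query 6 2 1, .add 8 1 0]

/-- The input contains the parameters. -/
structure Reads {n : ℕ} (γ ε : ℝ) (L : Circuit n) (I : Input) : Prop where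
  qubits : I.nat [0] = n
  depth : I.nat [1] = L.length
  damping : I.scalar [1] = (Real.exp (-γ) : ℂ)
  accuracy : I.scalar [2] = (ε : ℂ)

section
variable {n : ℕ} {γ : ℝ} {L : Circuit n} {ℓ : ℕ} {I : Input} {τ : ℕ}

theorem initial_spec {ε : ℝ} (hI : Reads γ ε L I) :
    Halts I τ (.seq constProg (.seq tableProg readProg)) State.blank (4 * τ + 28) fun s' =>
      Env γ L 0 s' ∧ s'.sreg 2 = ε := by
  refine Halts.le (Halts.seq (B := 8) (B' := 12 + (4 * τ + 8)) (R := fun s' => s'.reg 1 = 1 ∧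
      s'.reg 10 = 2 ∧ s'.reg 11 = 3 ∧ s'.reg 12 = 7 ∧ s'.reg 13 = 4 ∧ s'.reg 14 = 5 ∧ s'.reg 15 = 6
          ∧
      s'.sreg 3 = 1 / 4) (Halts.block ?_ ?_) fun s1 a1 ⟨h1, h10, h11, h12, h13, h14, h15, h3⟩ =>
    Halts.seq (R := fun s' => ∀ (a : Fin 4) (x y : Fin 2), s'.sarr (2 * x + y) a = pauli1 a x y)
      (Halts.block ?_ ?_) fun s2 a2 h2 => (Halts.block (Q := fun s' => s'.reg 2 = n ∧
        s'.reg 3 = L.length ∧ s'.sreg 1 = (Real.exp (-γ) : ℂ) ∧ s'.sreg 2 = ε ∧ s'.reg 9 = n + 1 ∧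
        s'.reg 7 = L.length + 1) ?_ ?_).mono le_rfl fun s3 a3 h => ?_) (by omega)
  · simp [execs, Instr.exec]
  · simp [costs, Instr.cost]
  · have h0 : s1.reg 0 = 0 := a1.reg 0 rfl
    have hk : ∀ k, s1.sarr k = fun _ => 0 := fun k => a1.sarr k rfl
    intro a x y
    fin_cases a <;> fin_cases x <;> fin_cases y <;>
      simp [execs, Instr.exec, h0, h1, h10, h11, hk, pauli1]
  · simp [costs, Instr.cost]
  · have h0 : s2.reg 0 = 0 := (a2.reg 0 rfl).trans (a1.reg 0 rfl)
    have g1 : s2.reg 1 = 1 := (a2.reg 1 rfl).trans h1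
    have g10 : s2.reg 10 = 2 := (a2.reg 10 rfl).trans h10
    have ha : s2.arr 2 = fun _ => 0 := (a2.arr 2 rfl).trans (a1.arr 2 rfl)
    -- All these query words have length one. The blank array gives the word 0 first; cell 0 is then
    -- set to 1 and to 2.
    simp [execs, Instr.exec, h0, g1, g10, ha, State.word, hI.qubits, hI.depth, hI.damping,
        hI.accuracy]
  · have g1 : s2.reg 1 = 1 := (a2.reg 1 rfl).trans h1
    simp [costs, Instr.cost, Instr.exec, g1]
    omega
  · obtain ⟨k2, k3, l1, l2, k9, k7⟩ := h
    refine ⟨⟨?_, ?_, k2, k3, ?_, k7, k9, ?_, ?_, ?_, ?_, ?_, ?_, l1, ?_, ?_, fun a x y => ?_⟩, l2⟩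
    · rw [a3.reg _ rfl, a2.reg _ rfl, a1.reg _ rfl]; rfl
    · rw [a3.reg _ rfl, a2.reg _ rfl, h1]
    · rw [a3.reg _ rfl, a2.reg _ rfl, a1.reg _ rfl]; rfl
    · rw [a3.reg _ rfl, a2.reg _ rfl, h10]
    · rw [a3.reg _ rfl, a2.reg _ rfl, h11]
    · rw [a3.reg _ rfl, a2.reg _ rfl, h12]
    · rw [a3.reg _ rfl, a2.reg _ rfl, h13]
    · rw [a3.reg _ rfl, a2.reg _ rfl, h14]
    · rw [a3.reg _ rfl, a2.reg _ rfl, h15]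
    · rw [a3.sreg _ rfl, a2.sreg _ rfl, h3]
    · rw [a3.sreg _ rfl, a2.sreg _ rfl, a1.sreg _ rfl]; rfl
    · rw [← h2 a x y, a3.sarr _ rfl]

/-- Scalar register `11` starts one power ahead, at a e^{-γ}, in accordance with the exponent k + 1
in `powIndex`. -/
theorem searchProg_spec {i : ℕ} (hi1 : i ≠ 1) {s : State} (he : Env γ L ℓ s)
    (hγ : 0 < γ) {a b : ℝ} (ha : 0 < a) (hb : 0 < b) (h11 : s.sreg 11 = (a * Real.exp (-γ) : ℝ))
    (h12 : s.sreg 12 = (b : ℝ)) :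
    Halts I τ (searchProg i) s (3 * powIndex (Real.exp (-γ)) a b + 2) fun s' =>
      s'.reg i = powIndex (Real.exp (-γ)) a b := by
  have hx1 : Real.exp (-γ) < 1 := by rw [Real.exp_lt_one_iff]; linarith
  have hx := powIndex_spec (Real.exp_pos (-γ)) hx1 ha hb
  set K := powIndex (Real.exp (-γ)) a b with hK
  refine Halts.le (Halts.seq (B := 1) (B' := K * (2 + 1) + 1) (R := fun s' => s'.reg i = 0 ∧
    s'.reg 1 = 1 ∧ s'.sreg 1 = (Real.exp (-γ) : ℝ) ∧ s'.sreg 11 = (a * Real.exp (-γ) : ℝ) ∧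
    s'.sreg 12 = (b : ℝ))
    (Halts.block ?_ ?_) fun s1 a1 h1 => Halts.loop K (fun k s' => s'.reg i = k ∧ s'.reg 1 = 1 ∧
      s'.sreg 1 = (Real.exp (-γ) : ℝ) ∧ s'.sreg 11 = (a * Real.exp (-γ) ^ (k + 1) : ℝ) ∧
      s'.sreg 12 = (b : ℝ)) ?_ ?_ ?_) (by omega)
  · simp [execs, Instr.exec, he.zero, he.one, he.damping, h11, h12, hi1.symm]
  · simp [costs, Instr.cost]
  · simpa using h1
  · rintro k hk s2 a2 ⟨g, g1, k1, k11, k12⟩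
    refine ⟨?_, Halts.block ?_ ?_⟩
    · show (s2.sreg 12).re < (s2.sreg 11).re
      rw [k11, k12, Complex.ofReal_re, Complex.ofReal_re]
      exact lt_of_lt_powIndex hk
    · simp [execs, Instr.exec, g, g1, k1, k11, k12, hi1.symm, pow_succ, mul_assoc]
    · simp [costs, Instr.cost]
  · rintro s2 a2 ⟨g, g1, k1, k11, k12⟩
    refine ⟨?_, g⟩
    show ¬ (s2.sreg 12).re < (s2.sreg 11).re
    rw [k11, k12, Complex.ofReal_re, Complex.ofReal_re]
    exact not_lt.2 hx

theorem thresholdProg_spec {ε : ℝ} (hγ : 0 < γ) (hε : 0 < ε) {s : State} (he : Env γ L 0 s)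
    (hs : s.sreg 2 = ε) :
    Halts I τ thresholdProg s
      (6 * powIndex (Real.exp (-γ)) 1 ε + 3 * threshold L.length γ ε + 20) fun s' =>
      Env γ (effective γ ε L) (threshold L.length γ ε) s' := by
  set K := powIndex (Real.exp (-γ)) 1 ε with hK
  set r := 1 / (1 - Real.exp (-γ)) with hr
  have hx1 : Real.exp (-γ) < 1 := by rw [Real.exp_lt_one_iff]; linarith
  have hr0 : 0 < r := one_div_pos.2 (sub_pos.2 hx1)
  refine Halts.le (Halts.seq (B := 2) (B' := (3 * K + 2) +
      ((3 * K + 3 * threshold L.length γ ε + 10) + 2 + 1))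
    (R := fun s' => s'.sreg 11 = (1 * Real.exp (-γ) : ℝ) ∧ s'.sreg 12 = ε) (Halts.block ?_ ?_)
    fun s1 a1 h1 => Halts.seq (searchProg_spec (by norm_num) (he.of_agree a1 rfl) hγ
      one_pos hε h1.1 h1.2) fun s2 a2 h2 => Halts.branch (fun hb => ?_) fun hb => ?_) (by omega)
  · simp [execs, Instr.exec, he.szero, he.damping, hs]
  · simp [costs, Instr.cost]
  all_goals
    have e2 : Env γ L 0 s2 := (he.of_agree a1 rfl).of_agree a2 rfl
    have k2 : s2.sreg 2 = ε := by rw [a2.sreg 2 rfl, a1.sreg 2 rfl, hs]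
  · have hb' : s2.reg 3 < s2.reg 19 := hb
    rw [e2.depth, h2] at hb'
    have hthr : threshold L.length γ ε = powIndex (Real.exp (-γ)) (r ^ (L.length + 1)) (ε ^ 2) := by
      rw [threshold, if_neg (not_le.2 hb')]
    have heff : effective γ ε L = L := by rw [effective, if_neg (not_le.2 hb')]
    rw [hthr, heff]
    refine Halts.le (Halts.seq (B := 5) (B' := ((L.length + 1) * (2 + 1) + 1) + (1 +
        ((3 * powIndex (Real.exp (-γ)) (r ^ (L.length + 1)) (ε ^ 2) + 2) + 1)))
      (R := fun s' => s'.sreg 14 = (r : ℝ) ∧ s'.sreg 11 = (Real.exp (-γ) : ℝ) ∧ s'.reg 37 = 0)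
      (Halts.block ?_ ?_) fun s3 a3 h3 => Halts.seq
        (R := fun s' => s'.sreg 11 = (r ^ (L.length + 1) * Real.exp (-γ) : ℝ))
        (Halts.loop (L.length + 1) (fun k s' => s'.sreg 14 = (r : ℝ) ∧
          s'.sreg 11 = (r ^ k * Real.exp (-γ) : ℝ) ∧ s'.reg 37 = k)
          (by simpa using h3) ?_ ?_) fun s4 a4 h4 =>
      Halts.seq (R := fun s' => s'.sreg 12 = (ε ^ 2 : ℝ)) (Halts.block ?_ ?_) fun s5 a5 h5 =>
      Halts.seq (searchProg_spec (a := r ^ (L.length + 1)) (b := ε ^ 2) (by norm_num)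
        (((e2.of_agree a3 rfl).of_agree a4 rfl).of_agree a5 rfl)
        hγ (pow_pos hr0 _) (pow_pos hε _) ((a5.sreg 11 rfl).trans h4) h5) fun s6 a6 h6 =>
      Halts.block ?_ ?_) (by omega)
    · simp [execs, Instr.exec, e2.zero, e2.damping, e2.szero, hr]
    · simp [costs, Instr.cost]
    · rintro k hk s4 a4 ⟨g14, g11, g37⟩
      have e4 := (e2.of_agree a3 rfl).of_agree a4 rfl
      refine ⟨?_, Halts.block ?_ ?_⟩
      · show s4.reg 37 < s4.reg 7
        rw [g37, e4.depth_succ]; exact hk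
      · simp [execs, Instr.exec, g14, g11, g37, e4.one, pow_succ]
        ring
      · simp [costs, Instr.cost]
    · rintro s4 a4 ⟨g14, g11, g37⟩
      have e4 := (e2.of_agree a3 rfl).of_agree a4 rfl
      refine ⟨?_, g11⟩
      show ¬ s4.reg 37 < s4.reg 7
      rw [g37, e4.depth_succ]; exact lt_irrefl _
    · have k2' : s4.sreg 2 = ε := by rw [a4.sreg 2 rfl, a3.sreg 2 rfl, k2]
      simp [execs, Instr.exec, k2', sq]
    · simp [costs, Instr.cost]
    · have e6 := (((e2.of_agree a3 rfl).of_agree a4 rfl).of_agree a5 rfl).of_agree a6 rfl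
      constructor <;>
        simp [execs, Instr.exec, h6, e6.zero, e6.one, e6.qubits, e6.depth, e6.depth_succ,
          e6.qubits_succ, e6.two, e6.three, e6.four, e6.five, e6.six, e6.seven, e6.damping,
          e6.quarter, e6.szero, e6.table]
    · simp [costs, Instr.cost]
  · have hb' : ¬ s2.reg 3 < s2.reg 19 := hb
    rw [e2.depth, h2] at hb'
    have hthr : threshold L.length γ ε = 0 := by
      rw [threshold, if_pos (not_lt.1 hb')]
    have heff : effective γ ε L = [] := by rw [effective, if_pos (not_lt.1 hb')]
    rw [hthr, heff]
    -- Setting the depth to 0 and its successor to 1 describes the empty circuit; the threshold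
    -- register still holds its initial value 0.
    refine Halts.block ?_ ?_
    · constructor <;>
        simp [execs, Instr.exec, e2.zero, e2.one, e2.qubits, e2.threshold,
          e2.qubits_succ, e2.two, e2.three, e2.four, e2.five, e2.six, e2.seven, e2.damping,
          e2.quarter, e2.szero, e2.table]
    · simp [costs, Instr.cost]

theorem tapesProg_spec {s : State} (he : Env γ L ℓ s) :
    Halts I τ tapesProg s (10 * ℓ + 3) fun s' => Env γ L ℓ s' ∧ s'.reg 5 = 256 ^ ℓ := by
  refine Halts.mono (B := 2 + (ℓ * (9 + 1) + 1)) (Halts.seq (R := fun s' => s'.reg 5 = 1 ∧ s'.reg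
      37 = 0)
    (Halts.block ?_ ?_) fun s1 a1 h1 => Halts.loop (Q := fun s' => s'.reg 5 = 256 ^ ℓ) ℓ (fun k s'
        =>
      s'.reg 5 = 256 ^ k ∧ s'.reg 37 = k)
      (by simpa using h1) ?_ ?_) (by omega) fun s' ha h => ⟨he.of_agree ha rfl, h⟩
  · simp [execs, Instr.exec, he.zero, he.one]
  · simp [costs, Instr.cost]
  · rintro k hk s2 a2 ⟨g5, g37⟩
    have e2 : Env γ L ℓ s2 := (he.of_agree a1 rfl).of_agree a2 rfl
    refine ⟨?_, Halts.block ?_ ?_⟩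
    · show s2.reg 37 < s2.reg 4
      rw [g37, e2.threshold]; exact hk
    -- Eight doublings multiply by 256.
    · simp [execs, Instr.exec, g5, g37, e2.one, pow_succ]
      omega
    · simp [costs, Instr.cost]
  · rintro s2 a2 ⟨g5, g37⟩
    have e2 : Env γ L ℓ s2 := (he.of_agree a1 rfl).of_agree a2 rfl
    refine ⟨?_, g5⟩
    show ¬ s2.reg 37 < s2.reg 4
    rw [g37, e2.threshold]; exact lt_irrefl _

/-- Natural numbers cannot be multiplied directly, so each new power of 4n is formed by 4n
additions. -/
theorem codesProg_spec {V : ℕ} {s : State} (he : Env γ L ℓ s) (h5 : s.reg 5 = V) :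
    Halts I τ codesProg s (3 * ℓ + ℓ / (L.length + 1) * (12 * n + 6) + 10)
      (Sized γ L ℓ (L.length + 1) ((4 * n) ^ (ℓ / (L.length + 1))) V) := by
  set q := ℓ / (L.length + 1) with hq
  refine Halts.mono (B := (3 * ℓ + 4) + (5 + (q * ((2 + ((4 * n * (2 + 1) + 1) + 2)) + 1) + 1)))
    (Q := fun s' => s'.reg 6 = (4 * n) ^ q ∧ s'.reg 8 = L.length + 1)
    (Halts.seq (R := fun s' => s'.reg 35 = q) ?_ fun s1 a1 h1 =>
      Halts.seq (R := fun s' => s'.reg 6 = 1 ∧ s'.reg 42 = 4 * n ∧ s'.reg 37 = 0 ∧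
        s'.reg 8 = L.length + 1) (Halts.block ?_ ?_) fun s2 a2 h2 =>
      Halts.loop q (fun k s' => s'.reg 6 = (4 * n) ^ k ∧ s'.reg 37 = k)
        ⟨by rw [h2.1, pow_zero], h2.2.2.1⟩ ?_ ?_) (by rw [mul_assoc 4 n]; linarith) fun s' ha h =>
        ⟨he.of_agree ha rfl, h.2, h.1, (ha.reg 5 rfl).trans h5⟩
  · refine (divMod_spec he.one (by rw [he.depth_succ]; omega) (by norm_num)
      (by norm_num)).mono (by rw [he.threshold]) fun s' _ h => ?_
    rw [h.2, he.threshold, he.depth_succ]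
  all_goals have e1 : Env γ L ℓ s1 := he.of_agree a1 rfl
  · simp [execs, Instr.exec, e1.zero, e1.one, e1.qubits, e1.depth_succ]
    omega
  · simp [costs, Instr.cost]
  · rintro k hk s3 a3 ⟨g6, g37⟩
    have e3 : Env γ L ℓ s3 := (e1.of_agree a2 rfl).of_agree a3 rfl
    have g35 : s3.reg 35 = q := by rw [a3.reg 35 rfl, a2.reg 35 rfl, h1]
    have g42 : s3.reg 42 = 4 * n := (a3.reg 42 rfl).trans h2.2.1
    refine ⟨?_, Halts.seq (R := fun s' => s'.reg 43 = 0 ∧ s'.reg 44 = 0) (Halts.block ?_ ?_)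
      fun s4 a4 h4 => Halts.seq (R := fun s' => s'.reg 44 = (4 * n) ^ (k + 1))
      (Halts.loop (4 * n) (fun i s' => s'.reg 43 = i ∧ s'.reg 44 = i * (4 * n) ^ k)
        (by simpa using h4) ?_ ?_) fun s5 a5 h5 => Halts.block ?_ ?_⟩
    · show s3.reg 37 < s3.reg 35
      rw [g37, g35]; exact hk
    · simp [execs, Instr.exec, e3.zero]
    · simp [costs, Instr.cost]
    · rintro i hi s5 a5 ⟨k43, k44⟩
      have e5 : Env γ L ℓ s5 := (e3.of_agree a4 rfl).of_agree a5 rfl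
      have k6 : s5.reg 6 = (4 * n) ^ k := by rw [a5.reg 6 rfl, a4.reg 6 rfl, g6]
      refine ⟨?_, Halts.block ?_ ?_⟩
      · show s5.reg 43 < s5.reg 42
        rw [k43, a5.reg 42 rfl, a4.reg 42 rfl, g42]; exact hi
      · simp [execs, Instr.exec, k43, k44, k6, e5.one, add_mul]
      · simp [costs, Instr.cost]
    · rintro s5 a5 ⟨k43, k44⟩
      refine ⟨?_, by rw [k44, pow_succ, mul_comm]⟩
      show ¬ s5.reg 43 < s5.reg 42
      rw [k43, a5.reg 42 rfl, a4.reg 42 rfl, g42]; exact lt_irrefl _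
    · have e5 : Env γ L ℓ s5 := (e3.of_agree a4 rfl).of_agree a5 rfl
      have k37 : s5.reg 37 = k := by rw [a5.reg 37 rfl, a4.reg 37 rfl, g37]
      simp [execs, Instr.exec, h5, e5.zero, e5.one, k37]
    · simp [costs, Instr.cost]
  · rintro s3 a3 ⟨g6, g37⟩
    refine ⟨?_, g6, (a3.reg 8 rfl).trans h2.2.2.2⟩
    show ¬ s3.reg 37 < s3.reg 35
    rw [g37, a3.reg 35 rfl, a2.reg 35 rfl, h1]
    exact lt_irrefl _

theorem termsProg_spec {V m : ℕ} {s : State} (hm : I.nat [5] = m) (he : Env γ L ℓ s)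
    (h5 : s.reg 5 = V) : Halts I τ termsProg s (τ + 3) (Sized γ L ℓ 1 m V) := by
  refine (Halts.block (Q := fun s' => s'.reg 6 = m ∧ s'.reg 8 = 1) ?_ ?_).mono le_rfl fun s' ha h =>
    ⟨he.of_agree ha rfl, h.2, h.1, (ha.reg 5 rfl).trans h5⟩
  · simp [execs, Instr.exec, he.zero, he.one, he.five, State.word, hm]
  · simp [costs, Instr.cost, Instr.exec, he.one]
    omega

end

/-! ## The programs -/

/-- The program for observables given as sums of Pauli operators. -/
def sparseProg : Program :=
  .seq setupProg (.seq termsProg (mainProg termProg (coreProg stepAmpProg .skip)))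

/-- The program for observables given by their Pauli coefficients. -/
def generalProg : Program :=
  .seq setupProg (.seq codesProg (mainProg decodeProg (coreProg stepAmpProg coeffProg)))

section
variable {n : ℕ} {γ ε : ℝ} {L : Circuit n} {I : Input} {τ : ℕ} {ρ O : Op n}

theorem gateAt_eq (L : Circuit n) (u g : ℕ) : gateAt L u g = (gatesAt L u)[g]? := by
  rw [gateAt, gatesAt]
  cases L[u]? <;> simp

theorem ofNat_two_val (a : Fin 2) : Fin.ofNat 2 (a : ℕ) = a := Fin.ext (Nat.mod_eq_of_lt a.2)

/-- Inputs that are described like `generalInput` and `sparseInput` present the circuit. -/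
theorem presents_of_eq (hnat : ∀ w, 2 ≤ w.length → w.length ≤ 3 → w.head? ≠ some 6 →
      I.nat w = circuitNat L w)
    (hscalar : ∀ w, w.head? ≠ some 5 → I.scalar w = circuitScalar γ ε L ρ w) : Presents I L ρ where
  size u hu := by
    rw [hnat _ (by simp) (by simp) (by simp), gatesAt, circuitNat]
    cases L[u]? <;> simp
  left u g G hG := by
    rw [hnat _ (by simp) (by simp) (by simp), circuitNat, gateAt_eq, hG]
    rfl
  right u g G hG := by
    rw [hnat _ (by simp) (by simp) (by simp), circuitNat, gateAt_eq, hG]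
    rfl
  entry u g G a b hG := by
    rw [hscalar _ (by simp), circuitScalar, gateAt_eq, hG]
    simp only [Option.map_some, Option.getD_some, ofNat_two_val]
  state w := by
    rw [hscalar _ (by simp), circuitScalar]

theorem Presents.effective (h : Presents I L ρ) : Presents I (effective γ ε L) ρ := by
  rw [NoisyCircuit.effective]
  split_ifs
  · exact ⟨fun u hu => absurd hu (Nat.not_lt_zero _), fun u g G h => by simp [gatesAt] at h,
      fun u g G h => by simp [gatesAt] at h, fun u g G a b h => by simp [gatesAt] at h, h.state⟩
  · exact h

theorem presents_generalInput : Presents (generalInput γ ε L ρ O) L ρ := by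
  refine presents_of_eq (γ := γ) (ε := ε) (fun w _ _ _ => rfl) fun w hw => ?_
  simp only [generalInput]
  split
  · simp at hw
  · rfl

theorem presents_sparseInput (terms : List (PauliString n × ℂ)) :
    Presents (sparseInput γ ε L ρ terms) L ρ := by
  refine presents_of_eq (γ := γ) (ε := ε) (fun w h1 _ hw => ?_) fun w hw => ?_
  · simp only [sparseInput]
    split
    · simp at h1
    · simp at hw
    · rfl
  · simp only [sparseInput]
    split
    · simp at hw
    · rfl

theorem reads_generalInput : Reads γ ε L (generalInput γ ε L ρ O) := ⟨rfl, rfl, rfl, rfl⟩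

theorem reads_sparseInput (terms : List (PauliString n × ℂ)) :
    Reads γ ε L (sparseInput γ ε L ρ terms) := ⟨rfl, rfl, rfl, rfl⟩

/-- A bound for the time of the preparations. -/
def setupTime (d τ : ℕ) (γ ε : ℝ) : ℕ :=
  4 * τ + 6 * powIndex (Real.exp (-γ)) 1 ε + 13 * threshold d γ ε + 51

theorem setupProg_spec (hI : Reads γ ε L I) (hγ : 0 < γ) (hε : 0 < ε) :
    Halts I τ setupProg State.blank (setupTime L.length τ γ ε) fun s' =>
      Env γ (effective γ ε L) (threshold L.length γ ε) s' ∧ s'.reg 5 = 256 ^ threshold L.length γ ε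
          ∧
        s'.sreg 0 = 0 := by
  refine Halts.mono (Halts.seq (initial_spec hI) fun s1 a1 h1 =>
    Halts.seq (thresholdProg_spec hγ hε h1.1 h1.2) fun s2 a2 h2 => tapesProg_spec h2)
    (by rw [setupTime]; omega) fun s' ha h => ⟨h.1, h.2, ha.sreg 0 rfl⟩

/-- The fold is linear in the amplitude. This makes invalid codes harmless, as `sum_decode`
requires. -/
theorem tapeValue_zero (ℓ : ℕ) (L : Circuit n) (c : PauliString n → ℂ) (t : ℕ) (P : PauliString n)
    (v : ℕ) : tapeValue γ ℓ L ρ c t P 0 v = 0 := by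
  rw [tapeValue, zero_mul, foldl_stageStep_smul]
  simp

/-- A bound for the time of the program for general observables. -/
def generalTime (n d τ ℓ : ℕ) : ℕ :=
  3 * ℓ + ℓ / (d + 1) * (12 * n + 6) + 10 + mainTime n d τ
    (n * (6 * (4 * n) ^ (ℓ / (d + 1)) + 19) + 9) (d + 1) ((4 * n) ^ (ℓ / (d + 1))) (256 ^ ℓ)

/-- A bound for the time of the program for sums of Pauli operators. -/
def sparseTime (n d τ ℓ m : ℕ) : ℕ :=
  τ + 3 + mainTime n d τ (n * (τ + 7) + τ + 7) 1 m (256 ^ ℓ)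

theorem setupProg_effective_spec (hI : Reads γ ε L I) (hγ : 0 < γ) (hε : 0 < ε) {ℓ : ℕ}
    {L' : Circuit n} (hℓ : threshold L.length γ ε = ℓ) (hL : effective γ ε L = L') :
    Halts I τ setupProg State.blank (setupTime L.length τ γ ε) fun s' =>
      Env γ L' ℓ s' ∧ s'.reg 5 = 256 ^ ℓ ∧ s'.sreg 0 = 0 := by
  rw [← hL, ← hℓ]
  exact setupProg_spec hI hγ hε

theorem generalProg_outputs (hn : 1 ≤ n) (hγ : 0 < γ) (hε : 0 < ε) :
    ∃ T, generalProg.Outputs (generalInput γ ε L ρ O) τ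
      (Matrix.trace (ρ * truncated γ (threshold L.length γ ε) L O)) T ∧
      T ≤ setupTime L.length τ γ ε +
        generalTime n (effective γ ε L).length τ (threshold L.length γ ε) := by
  rw [← truncated_effective]
  generalize hℓ : threshold L.length γ ε = ℓ
  generalize hL : effective γ ε L = L'
  have hI : Presents (generalInput γ ε L ρ O) L' ρ := hL ▸ presents_generalInput.effective
  generalize hU : (4 * n) ^ (ℓ / (L'.length + 1)) = U
  set x : ℕ → ℕ × PauliString n × ℂ :=
    fun u => (List.finRange n).foldl startStep (u, 0, 1) with hx
  obtain ⟨s', T, hT, hle, h0⟩ : Halts (generalInput γ ε L ρ O) τ generalProg State.blank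
      (setupTime L.length τ γ ε + generalTime n L'.length τ ℓ)
      fun s' => s'.sreg 0 = Matrix.trace (ρ * truncated γ ℓ L' O) := by
    refine Halts.le (Halts.seq (setupProg_effective_spec reads_generalInput hγ hε hℓ hL)
      fun s1 a1 h1 => Halts.seq
        (R := fun s' => Sized γ L' ℓ (L'.length + 1) U (256 ^ ℓ) s' ∧ s'.sreg 0 = 0)
        ((codesProg_spec h1.1 h1.2.1).mono le_rfl
          fun s2 a2 h2 => ⟨hU ▸ h2, (a2.sreg 0 rfl).trans h1.2.2⟩)
      fun s2 a2 h2 => (mainProg_spec (F := coeffProg) (c := pauliCoeff O)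
        (S := decodeProg) (B := n * (6 * U + 19) + 9) (P := fun u => (x u).2.1)
        (z := fun u => if (x u).1 = 0 ∧ IsLow L'.length ℓ (x u).2.1 then (x u).2.2 else 0)
        hI (fun P s he hs => coeffProg_spec (fun _ => rfl) he hs) rfl rfl
        (fun u hu s he h17 => (decodeProg_spec hn rfl he h17).mono (by gcongr) fun _ _ h => h)
        rfl h2.1 le_rfl).mono le_rfl fun s3 a3 h3 => ?_)
      (by rw [generalTime, hU])
    rw [h3, h2.2, zero_add, ← sum_tapeValue_low]
    refine Finset.sum_congr rfl fun t _ => ?_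
    exact sum_decode L'.length ℓ U hn hU.le
      (fun P c => ∑ v ∈ Finset.range (256 ^ ℓ), tapeValue γ ℓ L' ρ (pauliCoeff O) t P c v)
      fun P => Finset.sum_eq_zero fun v _ => tapeValue_zero ℓ L' _ t P v
  exact ⟨T, ⟨s', hT, h0⟩, hle⟩

theorem sparseProg_outputs (terms : List (PauliString n × ℂ)) (hγ : 0 < γ) (hε : 0 < ε) :
    ∃ T, sparseProg.Outputs (sparseInput γ ε L ρ terms) τ
      (Matrix.trace (ρ * truncated γ (threshold L.length γ ε) L (sumOfPaulis terms))) T ∧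
      T ≤ setupTime L.length τ γ ε +
        sparseTime n (effective γ ε L).length τ (threshold L.length γ ε) terms.length := by
  rw [← truncated_effective]
  generalize hℓ : threshold L.length γ ε = ℓ
  generalize hL : effective γ ε L = L'
  have hI : Presents (sparseInput γ ε L ρ terms) L' ρ :=
    hL ▸ (presents_sparseInput terms).effective
  obtain ⟨s', T, hT, hle, h0⟩ : Halts (sparseInput γ ε L ρ terms) τ sparseProg State.blank
      (setupTime L.length τ γ ε + sparseTime n L'.length τ ℓ terms.length)
      fun s' => s'.sreg 0 = Matrix.trace (ρ * truncated γ ℓ L' (sumOfPaulis terms)) := by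
    refine Halts.le (Halts.seq (setupProg_effective_spec (reads_sparseInput terms) hγ hε hℓ hL)
      fun s1 a1 h1 => Halts.seq
        (R := fun s' => Sized γ L' ℓ 1 terms.length (256 ^ ℓ) s' ∧ s'.sreg 0 = 0)
        ((termsProg_spec rfl h1.1 h1.2.1).mono le_rfl
          fun s2 a2 h2 => ⟨h2, (a2.sreg 0 rfl).trans h1.2.2⟩)
      -- The coefficients of the terms are the initial amplitudes, so no factor is left for the end.
      -- The default `(0, 0)` is never used, as the loop stays below the number of terms.
      fun s2 a2 h2 => (mainProg_spec (F := .skip) (c := fun _ => 1)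
        (S := termProg) (B := n * (τ + 7) + τ + 7) (P := fun u => (terms.getD u (0, 0)).1)
        (z := fun u => (terms.getD u (0, 0)).2)
        hI (fun P s he hs => (Halts.skip (Q := fun s' => s'.sreg 9 = s.sreg 9 * 1)
          (mul_one _).symm).le (Nat.zero_le _)) rfl rfl
        (fun u hu s he h17 => termProg_spec (fun j => ?_) ?_ he h17)
        rfl h2.1 (by omega)).mono le_rfl fun s3 a3 h3 => ?_)
      (by rw [sparseTime])
    · simp [sparseInput, List.getElem?_eq_getElem hu]
    · simp [sparseInput, List.getElem?_eq_getElem hu]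
    · rw [h3, h2.2, zero_add, ← sum_tapeValue_terms, Finset.sum_range_one, Finset.sum_range,
        ← Fin.sum_univ_fun_getElem]
      refine Finset.sum_congr rfl fun i _ => ?_
      simp
  exact ⟨T, ⟨s', hT, h0⟩, hle⟩

end

/-! ## Accuracy of the threshold -/

/-- A single term of the binomial expansion of (x + (1 - x))^ℓ = 1 is at most one. -/
theorem choose_mul_pow_le {x : ℝ} (hx : 0 < x) (hx1 : x < 1) {d ℓ : ℕ} (h : d ≤ ℓ) :
    (ℓ.choose d : ℝ) * x ^ (ℓ + 1) ≤ (1 / (1 - x)) ^ (d + 1) := by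
  have hy : 0 < 1 - x := sub_pos.2 hx1
  have h1 : x ^ (ℓ - d) * (1 - x) ^ (ℓ - (ℓ - d)) * (ℓ.choose (ℓ - d) : ℝ) ≤ 1 := by
    have := add_pow x (1 - x) ℓ
    rw [add_sub_cancel, one_pow] at this
    refine le_of_le_of_eq ?_ this.symm
    exact Finset.single_le_sum (f := fun m => x ^ m * (1 - x) ^ (ℓ - m) * (ℓ.choose m : ℝ))
      (fun i _ => by positivity) 
      (show ℓ - d ∈ Finset.range (ℓ + 1) from Finset.mem_range.2 (by omega))
  rw [Nat.choose_symm h, Nat.sub_sub_self h] at h1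
  rw [div_pow, one_pow, le_div_iff₀ (pow_pos hy _)]
  have h2 : x ^ (ℓ + 1) = x ^ (ℓ - d) * x ^ (d + 1) := by
    rw [← pow_add]; congr 1; omega
  calc (ℓ.choose d : ℝ) * x ^ (ℓ + 1) * (1 - x) ^ (d + 1)
      = (x ^ (ℓ - d) * (1 - x) ^ d * (ℓ.choose d : ℝ)) * (x ^ (d + 1) * (1 - x)) := by
        rw [h2, pow_succ (1 - x)]; ring
    _ ≤ 1 * (1 * 1) := by
        refine mul_le_mul h1 (mul_le_mul (pow_le_one₀ hx.le hx1.le) (by linarith) hy.le one_pos.le)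
          (by positivity) one_pos.le
    _ = 1 := by norm_num

theorem exp_neg_two_mul (γ : ℝ) (k : ℕ) :
    Real.exp (-2 * γ * (k + 1 : ℕ)) = Real.exp (-γ) ^ (k + 1) * Real.exp (-γ) ^ (k + 1) := by
  rw [← Real.exp_nat_mul, ← Real.exp_add]
  congr 1
  push_cast
  ring

section
variable {n : ℕ} {γ ε : ℝ}

/-- The error bound contains e^{-γ(ℓ+1)} twice. One copy absorbs the binomial coefficient, and the
threshold is chosen such that the other compensates the resulting constant down to ε². -/
theorem frobSq_errorLin_threshold_le (hγ : 0 < γ) (hε : 0 < ε) (L : Circuit n) (O : Op n) :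
    frobSq (errorLin γ (threshold L.length γ ε) L O) ≤ ε ^ 2 * frobSq O := by
  have hx := Real.exp_pos (-γ)
  have hx1 : Real.exp (-γ) < 1 := by rw [Real.exp_lt_one_iff]; linarith
  have hr : 1 ≤ 1 / (1 - Real.exp (-γ)) := by
    rw [le_div_iff₀ (sub_pos.2 hx1)]; linarith
  by_cases hK : powIndex (Real.exp (-γ)) 1 ε ≤ L.length
  · rw [threshold, if_pos hK]
    refine (frobSq_errorLin_zero_le hγ.le L O).trans ?_
    rw [powIndex_le_iff hx hx1 one_pos hε, one_mul] at hK
    rw [exp_neg_two_mul, ← sq]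
    gcongr
    exact frobSq_nonneg O
  · rw [threshold, if_neg hK]
    set ℓ := powIndex (Real.exp (-γ)) ((1 / (1 - Real.exp (-γ))) ^ (L.length + 1)) (ε ^ 2) with hℓ
    have hspec := powIndex_spec hx hx1 (pow_pos (one_pos.trans_le hr) (L.length + 1)) (pow_pos hε 2)
    rw [← hℓ] at hspec
    have hlt := lt_of_lt_powIndex (not_le.1 hK)
    rw [one_mul] at hlt
    -- Otherwise ε < x^{d+1} ≤ x^{ℓ+1} ≤ ε² for x = e^{-γ}, although ε < x^{d+1} ≤ 1.
    have hle : L.length ≤ ℓ := by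
      by_contra h
      have h1 : Real.exp (-γ) ^ (L.length + 1) ≤ Real.exp (-γ) ^ (ℓ + 1) :=
        pow_le_pow_of_le_one hx.le hx1.le (by omega)
      have h2 : Real.exp (-γ) ^ (L.length + 1) ≤ 1 := pow_le_one₀ hx.le hx1.le
      have h3 : (1 : ℝ) ≤ (1 / (1 - Real.exp (-γ))) ^ (L.length + 1) := one_le_pow₀ hr
      have h4 : Real.exp (-γ) ^ (ℓ + 1) ≤
          (1 / (1 - Real.exp (-γ))) ^ (L.length + 1) * Real.exp (-γ) ^ (ℓ + 1) :=
        le_mul_of_one_le_left (by positivity) h3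
      nlinarith
    have h5 := frobSq_errorLin_le hγ.le L ℓ hle O
    refine h5.trans (mul_le_mul_of_nonneg_right ?_ (frobSq_nonneg O))
    have h6 := exp_neg_two_mul γ ℓ
    push_cast at h6
    rw [h6, ← mul_assoc]
    exact (mul_le_mul_of_nonneg_right (choose_mul_pow_le hx hx1 hle) (by positivity)).trans hspec

/-! ## Running time -/

/-- By minimality the index one below fails, and taking logarithms there gives the bound; index 0 is
covered by b ≤ a. -/
theorem powIndex_mul_le {a b : ℝ} (ha : 0 < a) (hb : 0 < b) (hab : b ≤ a) :
    γ * powIndex (Real.exp (-γ)) a b ≤ Real.log a - Real.log b := by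
  set K := powIndex (Real.exp (-γ)) a b with hK
  rcases Nat.eq_zero_or_pos K with h0 | h0
  · rw [h0, Nat.cast_zero, mul_zero, sub_nonneg]
    exact Real.log_le_log hb hab
  · have h1 := lt_of_lt_powIndex (x := Real.exp (-γ)) (a := a) (b := b) (i := K - 1)
      (Nat.sub_lt h0 one_pos)
    rw [Nat.sub_add_cancel (show 1 ≤ K from h0), ← Real.exp_nat_mul] at h1
    have h2 := Real.log_le_log hb h1.le
    rw [Real.log_mul ha.ne' (Real.exp_pos _).ne', Real.log_exp] at h2
    linarith

/-- From e^{-g}(1 + g) ≤ 1 one gets 1 - e^{-γ} ≥ g/(1 + g), which is at least g² for g ≤ 1/2. -/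
theorem log_inv_one_sub_exp_le {g : ℝ} (hg : 0 < g) (hg2 : g ≤ 1 / 2) (hgγ : g ≤ γ) :
    Real.log (1 / (1 - Real.exp (-γ))) ≤ 2 * Real.log (1 / g) := by
  have h1 : g ^ 2 ≤ 1 - Real.exp (-γ) := by
    have h2 : Real.exp (-γ) ≤ Real.exp (-g) := Real.exp_le_exp.2 (by linarith)
    have h3 : Real.exp (-g) * (1 + g) ≤ 1 := by
      have := Real.add_one_le_exp g
      calc Real.exp (-g) * (1 + g) ≤ Real.exp (-g) * Real.exp g := by
            refine mul_le_mul_of_nonneg_left (by linarith) (Real.exp_pos _).le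
        _ = 1 := by rw [← Real.exp_add]; simp
    have h4 : 1 ≤ (1 - g ^ 2) * (1 + g) := by nlinarith [mul_pos hg hg]
    have h5 : Real.exp (-g) ≤ 1 - g ^ 2 := by
      by_contra h
      nlinarith
    linarith
  have h6 : 1 / (1 - Real.exp (-γ)) ≤ (1 / g) ^ 2 := by
    rw [div_pow, one_pow]
    exact one_div_le_one_div_of_le (pow_pos hg 2) h1
  have h7 : 0 < 1 / (1 - Real.exp (-γ)) := one_div_pos.2 ((pow_pos hg 2).trans_le h1)
  calc Real.log (1 / (1 - Real.exp (-γ))) ≤ Real.log ((1 / g) ^ 2) := Real.log_le_log h7 h6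
    _ = 2 * Real.log (1 / g) := by rw [Real.log_pow]; norm_num

/-- The quantities that determine the running time. -/
structure TimeBounds (n : ℕ) (γ ε : ℝ) (L : Circuit n) (g A : ℝ) : Prop where
  index : (powIndex (Real.exp (-γ)) 1 ε : ℝ) ≤ A
  cutoff : (threshold L.length γ ε : ℝ) ≤ 4 * A
  depth : ((effective γ ε L).length + 1 : ℝ) ≤ Real.exp A
  low : ((threshold L.length γ ε / ((effective γ ε L).length + 1) : ℕ) : ℝ) ≤
    2 * (Real.log (1 / g) / g) + 2 * (Real.log (1 / ε) / (g * L.length))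

/-- Indeed log(1/g) ≥ log 2 > 1/2 ≥ g. This lets additive terms be absorbed into the exponents. -/
theorem one_le_log_div {g : ℝ} (hg : 0 < g) (hg2 : g ≤ 1 / 2) : 1 ≤ Real.log (1 / g) / g := by
  rw [le_div_iff₀ hg, one_mul]
  have h1 : Real.log 2 ≤ Real.log (1 / g) := by
    refine Real.log_le_log two_pos ?_
    rw [le_div_iff₀ hg]
    linarith
  linarith [Real.log_two_gt_d9]

/-- Write E = log(1/ε) and Λ = log(1/g)/g, so that A = (E/g)Λ. The minimality of the threshold gives
ℓ ≤ 2(d+1)Λ + 2E/g. A circuit that is not dropped has d + 1 ≤ E/g, whence ℓ ≤ 4A; dividing by d + 1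
instead bounds the weight of the starting strings. -/
theorem timeBounds (hγ : 0 < γ) (hε : 0 < ε) (hε1 : ε ≤ 1) (L : Circuit n) (hL : 1 ≤ L.length)
    {g : ℝ} (hg : 0 < g) (hg2 : g ≤ 1 / 2) (hgγ : g ≤ γ) :
    TimeBounds n γ ε L g (Real.log (1 / ε) * (Real.log (1 / g) / g ^ 2)) := by
  have hd : (1 : ℝ) ≤ L.length := by exact_mod_cast hL
  have hΛ := one_le_log_div hg hg2
  have hE : 0 ≤ Real.log (1 / ε) := Real.log_nonneg (by rw [le_div_iff₀ hε]; linarith)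
  set E := Real.log (1 / ε) with hEdef
  set Λ := Real.log (1 / g) / g with hΛdef
  set K := powIndex (Real.exp (-γ)) 1 ε with hK
  have hA : E * (Real.log (1 / g) / g ^ 2) = E / g * Λ := by
    rw [hΛdef]; field_simp
  rw [hA]
  have hEg : 0 ≤ E / g := div_nonneg hE hg.le
  have hEA : E / g ≤ E / g * Λ := le_mul_of_one_le_right hEg hΛ
  have hlogε : Real.log ε = -E := by rw [hEdef, one_div, Real.log_inv, neg_neg]
  have hKE : γ * K ≤ E := by
    have := powIndex_mul_le (γ := γ) one_pos hε hε1
    rw [Real.log_one, hlogε] at this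
    linarith
  have hKg : (K : ℝ) ≤ E / g := by
    rw [le_div_iff₀ hg]
    nlinarith [mul_le_mul_of_nonneg_right hgγ (Nat.cast_nonneg (α := ℝ) K)]
  have hexp : (1 : ℝ) ≤ Real.exp (E / g * Λ) := Real.one_le_exp (by linarith)
  have hrhs : 0 ≤ 2 * Λ + 2 * (E / (g * L.length)) := by positivity
  by_cases hKd : K ≤ L.length
  · have h1 : threshold L.length γ ε = 0 := by
      rw [threshold, if_pos hKd]
    have h2 : effective γ ε L = [] := by rw [effective, if_pos hKd]
    refine ⟨hKg.trans hEA, ?_, ?_, ?_⟩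
    · rw [h1]
      push_cast
      linarith
    · rw [h2]
      simpa using hexp
    · rw [h1, Nat.zero_div, Nat.cast_zero]
      exact hrhs
  · have h1 : threshold L.length γ ε =
        powIndex (Real.exp (-γ)) ((1 / (1 - Real.exp (-γ))) ^ (L.length + 1)) (ε ^ 2) := by
      rw [threshold, if_neg hKd]
    have h2 : effective γ ε L = L := by rw [effective, if_neg hKd]
    have hdK : (L.length + 1 : ℝ) ≤ K := by exact_mod_cast not_le.1 hKd
    have hx1 : Real.exp (-γ) < 1 := by rw [Real.exp_lt_one_iff]; linarith
    have hr : 1 ≤ 1 / (1 - Real.exp (-γ)) := by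
      rw [le_div_iff₀ (sub_pos.2 hx1)]; linarith [Real.exp_pos (-γ)]
    have hr1 : (1 : ℝ) ≤ (1 / (1 - Real.exp (-γ))) ^ (L.length + 1) := one_le_pow₀ hr
    have hlog := log_inv_one_sub_exp_le hg hg2 hgγ
    have hlog' : Real.log (1 / g) = g * Λ := by rw [hΛdef]; field_simp
    rw [hlog'] at hlog
    have hmul := powIndex_mul_le (γ := γ) (one_pos.trans_le hr1) (pow_pos hε 2)
      ((pow_le_one₀ hε.le hε1).trans hr1)
    rw [← h1, Real.log_pow, Real.log_pow, hlogε] at hmul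
    push_cast at hmul
    set ℓ := threshold L.length γ ε with hℓ
    have hgℓ : g * ℓ ≤ (L.length + 1) * (2 * (g * Λ)) + 2 * E := by
      have h3 : g * ℓ ≤ γ * ℓ := mul_le_mul_of_nonneg_right hgγ (Nat.cast_nonneg _)
      have h4 := mul_le_mul_of_nonneg_left hlog (show (0 : ℝ) ≤ L.length + 1 by positivity)
      linarith
    have hℓle : (ℓ : ℝ) ≤ (L.length + 1) * (2 * Λ) + 2 * (E / g) := by
      have h3 : g * ((L.length + 1) * (2 * Λ) + 2 * (E / g)) =
          (L.length + 1) * (2 * (g * Λ)) + 2 * E := by field_simp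
      rw [← h3] at hgℓ
      exact le_of_mul_le_mul_left hgℓ hg
    refine ⟨hKg.trans hEA, ?_, ?_, ?_⟩
    · have h3 : (L.length + 1 : ℝ) * (2 * Λ) ≤ E / g * (2 * Λ) :=
        mul_le_mul_of_nonneg_right (hdK.trans hKg) (by linarith)
      linarith
    · rw [h2]
      linarith [Real.add_one_le_exp (E / g * Λ)]
    · rw [h2]
      refine Nat.cast_div_le.trans ?_
      push_cast
      rw [div_le_iff₀ (by positivity)]
      have h3 : E / g ≤ E / (g * L.length) * (L.length + 1) := by
        rw [div_mul_eq_mul_div, div_le_div_iff₀ hg (by positivity)]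
        nlinarith [mul_nonneg hE hg.le]
      linarith

end

/-! ## The bounds of the theorem -/

theorem layerTime_le {n τ V : ℕ} (hn : 1 ≤ n) (hτ : 1 ≤ τ) (hV : 1 ≤ V) :
    layerTime n τ V ≤ 9028 * (n * τ * V) := by
  have h1 : n * τ ≤ n * τ * V := Nat.le_mul_of_pos_right _ hV
  have h2 : n * V ≤ n * τ * V := Nat.mul_le_mul_right _ (Nat.le_mul_of_pos_right _ hτ)
  have h3 : n ≤ n * τ := Nat.le_mul_of_pos_right _ hτ
  have h4 : τ ≤ n * τ := Nat.le_mul_of_pos_left _ hn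
  rw [layerTime]
  linarith

theorem coreTime_le {n d τ V : ℕ} (hn : 1 ≤ n) (hτ : 1 ≤ τ) (hV : 1 ≤ V) :
    coreTime n d τ V ≤ 9091 * ((d + 1) * (n * τ * V)) := by
  have h0 := layerTime_le hn hτ hV
  have h1 : n * τ ≤ n * τ * V := Nat.le_mul_of_pos_right _ hV
  have h3 : n ≤ n * τ := Nat.le_mul_of_pos_right _ hτ
  have h4 : τ ≤ n * τ := Nat.le_mul_of_pos_left _ hn
  rw [coreTime]
  generalize n * τ * V = X at *
  have h5 : d * (layerTime n τ V + 4) ≤ d * (9032 * X) := Nat.mul_le_mul_left _ (by omega)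
  have h6 : 0 ≤ d * X := Nat.zero_le _
  linarith

/-- The square of `V` arises because each of the `V` tapes may take time proportional to its value.
-/
theorem mainTime_le {n d τ B T U V : ℕ} (hn : 1 ≤ n) (hτ : 1 ≤ τ) (hV : 1 ≤ V) (hT : 1 ≤ T)
    (hU : 1 ≤ U) :
    mainTime n d τ B T U V ≤ T * U * (B + 9103 * ((d + 1) * (n * τ * V ^ 2))) := by
  have h0 := coreTime_le (d := d) hn hτ hV
  have hY : 1 ≤ (d + 1) * (n * τ * V ^ 2) := Nat.mul_pos (Nat.succ_pos _)
    (Nat.mul_pos (Nat.mul_pos hn hτ) (pow_pos hV 2))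
  have h1 : V * (coreTime n d τ V + 2) ≤ 9093 * ((d + 1) * (n * τ * V ^ 2)) := by
    have h2 : 1 ≤ (d + 1) * (n * τ * V) := Nat.mul_pos (Nat.succ_pos _)
      (Nat.mul_pos (Nat.mul_pos hn hτ) hV)
    calc V * (coreTime n d τ V + 2) ≤ V * (9093 * ((d + 1) * (n * τ * V))) :=
          Nat.mul_le_mul_left _ (by omega)
      _ = _ := by ring
  have hTU : 1 ≤ T * U := Nat.mul_pos hT hU
  have hTU' : T ≤ T * U := Nat.le_mul_of_pos_right _ hU
  rw [mainTime]
  calc _ = T * U * (B + V * (coreTime n d τ V + 2) + 4) + 4 * T + 2 := by ring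
    _ ≤ T * U * (B + V * (coreTime n d τ V + 2) + 4) + 6 * (T * U) := by linarith
    _ = T * U * (B + V * (coreTime n d τ V + 2) + 10) := by ring
    _ ≤ _ := Nat.mul_le_mul_left _ (by omega)

theorem sparseTime_le {n d τ ℓ m : ℕ} (hn : 1 ≤ n) (hτ : 1 ≤ τ) (hm : 1 ≤ m) :
    sparseTime n d τ ℓ m ≤ 10000 * (τ * m * n * ((d + 1) * (256 ^ ℓ) ^ 2)) := by
  have hV : 1 ≤ 256 ^ ℓ := Nat.one_le_pow _ _ (by norm_num)
  have h0 := mainTime_le (d := d) (B := n * (τ + 7) + τ + 7) hn hτ hV le_rfl hm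
  rw [sparseTime]
  generalize 256 ^ ℓ = V at *
  have h3 : n ≤ n * τ := Nat.le_mul_of_pos_right _ hτ
  have h4 : τ ≤ n * τ := Nat.le_mul_of_pos_left _ hn
  have h1 : n * τ ≤ (d + 1) * (n * τ * V ^ 2) :=
    (Nat.le_mul_of_pos_right _ (pow_pos hV 2)).trans (Nat.le_mul_of_pos_left _ (Nat.succ_pos d))
  have h2 : (d + 1) * (n * τ * V ^ 2) ≤ m * ((d + 1) * (n * τ * V ^ 2)) :=
    Nat.le_mul_of_pos_left _ hm
  have h5 : m * (n * (τ + 7) + τ + 7 + 9103 * ((d + 1) * (n * τ * V ^ 2))) ≤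
      m * (9126 * ((d + 1) * (n * τ * V ^ 2))) := Nat.mul_le_mul_left _ (by linarith)
  have h6 : τ * m * n * ((d + 1) * V ^ 2) = m * ((d + 1) * (n * τ * V ^ 2)) := by ring
  rw [h6]
  rw [one_mul] at h0
  linarith

/-- The number of codes also enters squared, since decoding takes time linear in the code. -/
theorem generalTime_le {n d τ ℓ : ℕ} (hn : 1 ≤ n) (hτ : 1 ≤ τ) :
    generalTime n d τ ℓ ≤ 10000 * (τ * n * ((4 * n) ^ (ℓ / (d + 1))) ^ 2 *
      ((d + 1) ^ 2 * (256 ^ ℓ) ^ 2)) := by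
  have hV : 1 ≤ 256 ^ ℓ := Nat.one_le_pow _ _ (by norm_num)
  have hU : 1 ≤ (4 * n) ^ (ℓ / (d + 1)) := Nat.one_le_pow _ _ (by omega)
  have hℓV : ℓ ≤ 256 ^ ℓ := (Nat.lt_pow_self (by norm_num)).le
  have hq : ℓ / (d + 1) ≤ ℓ := Nat.div_le_self _ _
  rw [generalTime]
  have h0 := mainTime_le (d := d) (B := n * (6 * (4 * n) ^ (ℓ / (d + 1)) + 19) + 9) hn hτ hV
    (Nat.succ_pos d) hU
  have h7 : ℓ / (d + 1) * (12 * n + 6) ≤ 256 ^ ℓ * (18 * n) :=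
    Nat.mul_le_mul (hq.trans hℓV) (by omega)
  generalize 256 ^ ℓ = V at *
  generalize (4 * n) ^ (ℓ / (d + 1)) = U at *
  have h3 : n ≤ n * τ := Nat.le_mul_of_pos_right _ hτ
  have hVV : V ≤ V ^ 2 := Nat.le_self_pow two_ne_zero V
  set Y := (d + 1) * (n * τ * V ^ 2) with hY
  have h1 : n * V ≤ Y := by
    calc n * V ≤ n * τ * V ^ 2 := Nat.mul_le_mul h3 hVV
      _ ≤ Y := Nat.le_mul_of_pos_left _ (Nat.succ_pos d)
  have h1' : n ≤ n * V := Nat.le_mul_of_pos_right _ hV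
  have hVn : V ≤ n * V := Nat.le_mul_of_pos_left _ hn
  have hYU : Y ≤ Y * U := Nat.le_mul_of_pos_right _ hU
  have hnU : n * U ≤ Y * U := Nat.mul_le_mul_right _ (h1'.trans h1)
  have h5 : (d + 1) * U * (n * (6 * U + 19) + 9 + 9103 * Y) ≤ (d + 1) * U * (9137 * (Y * U)) :=
    Nat.mul_le_mul_left _ (by linarith)
  have h6 : τ * n * U ^ 2 * ((d + 1) ^ 2 * V ^ 2) = (d + 1) * U * (Y * U) := by rw [hY]; ring
  have h8 : Y * U ≤ (d + 1) * U * (Y * U) :=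
    Nat.le_mul_of_pos_left _ (Nat.mul_pos (Nat.succ_pos d) hU)
  rw [h6]
  have h9 : (d + 1) * U * (9137 * (Y * U)) = 9137 * ((d + 1) * U * (Y * U)) := by ring
  linarith

section
variable {n : ℕ} {γ ε : ℝ} {L : Circuit n} {g A : ℝ} {τ : ℕ}

theorem natCast_pow_le_exp {b k : ℕ} {c x : ℝ} (hb : (b : ℝ) ≤ Real.exp c) (hc : 0 ≤ c)
    (hk : (k : ℝ) ≤ x) : ((b ^ k : ℕ) : ℝ) ≤ Real.exp (c * x) := by
  push_cast
  calc (b : ℝ) ^ k ≤ Real.exp c ^ k := pow_le_pow_left₀ (Nat.cast_nonneg _) hb k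
    _ = Real.exp (c * k) := by rw [← Real.exp_nat_mul, mul_comm]
    _ ≤ Real.exp (c * x) := Real.exp_le_exp.2 (mul_le_mul_of_nonneg_left hk hc)

theorem two_pow_le_exp (k : ℕ) : (2 : ℝ) ^ k ≤ Real.exp k := by
  have h : (2 : ℝ) ≤ Real.exp 1 := by linarith [Real.add_one_le_exp (1 : ℝ)]
  calc (2 : ℝ) ^ k ≤ Real.exp 1 ^ k := pow_le_pow_left₀ two_pos.le h k
    _ = Real.exp k := by rw [← Real.exp_nat_mul, mul_one]

/-- Here 256 = 2⁸ ≤ e⁸, and the threshold is at most 4A. -/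
theorem TimeBounds.tapes_le (h : TimeBounds n γ ε L g A) :
    ((256 ^ threshold L.length γ ε : ℕ) : ℝ) ≤ Real.exp (32 * A) := by
  have h8 := two_pow_le_exp 8
  refine (natCast_pow_le_exp (c := 8) (by norm_num at h8 ⊢; exact h8) (by norm_num)
    h.cutoff).trans_eq ?_
  congr 1
  ring

theorem TimeBounds.setupTime_le (h : TimeBounds n γ ε L g A) (hτ : 1 ≤ τ) :
    (setupTime L.length τ γ ε : ℝ) ≤ τ * (113 * Real.exp A) := by
  have hτ' : (1 : ℝ) ≤ τ := by exact_mod_cast hτ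
  have hA : 0 ≤ A := (Nat.cast_nonneg _).trans h.index
  have h1 := Real.add_one_le_exp A
  rw [setupTime]
  push_cast
  have h2 := h.index
  have h3 := h.cutoff
  have h4 : 6 * (powIndex (Real.exp (-γ)) 1 ε : ℝ) + 13 * (threshold L.length γ ε : ℝ) + 51 ≤
      109 * Real.exp A := by nlinarith [Real.one_le_exp hA]
  have h5 : 109 * Real.exp A ≤ τ * (109 * Real.exp A) :=
    le_mul_of_one_le_left (by positivity) hτ'
  have h6 : (τ : ℝ) * 4 ≤ τ * (4 * Real.exp A) :=
    mul_le_mul_of_nonneg_left (by linarith) (by positivity)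
  linarith

theorem TimeBounds.sparse_le (h : TimeBounds n γ ε L g A) (hn : 1 ≤ n) (hτ : 1 ≤ τ) {m : ℕ}
    (hm : 1 ≤ m) :
    ((setupTime L.length τ γ ε + sparseTime n (effective γ ε L).length τ
      (threshold L.length γ ε) m : ℕ) : ℝ) ≤ τ * (20000 * m * n * Real.exp (65 * A)) := by
  have hA : 0 ≤ A := (Nat.cast_nonneg _).trans h.index
  have hn' : (1 : ℝ) ≤ n := by exact_mod_cast hn
  have hm' : (1 : ℝ) ≤ m := by exact_mod_cast hm
  have hmn : (1 : ℝ) ≤ m * n := one_le_mul_of_one_le_of_one_le hm' hn'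
  have h1 := h.setupTime_le hτ
  have h2 : (sparseTime n (effective γ ε L).length τ (threshold L.length γ ε) m : ℝ) ≤ _ :=
    Nat.cast_le.2 (sparseTime_le hn hτ hm)
  have h3 := h.tapes_le
  have h4 := h.depth
  push_cast at h2 h3 ⊢
  -- The exponent is 65 = 1 + 2 · 32: the depth once and the number of tapes squared.
  have h5 : (((effective γ ε L).length : ℝ) + 1) * ((256 : ℝ) ^ threshold L.length γ ε) ^ 2 ≤
      Real.exp (65 * A) := by
    calc _ ≤ Real.exp A * Real.exp (32 * A) ^ 2 := by gcongr
      _ = Real.exp (65 * A) := by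
        rw [← Real.exp_nat_mul, ← Real.exp_add]; congr 1; push_cast; ring
  have h6 : Real.exp A ≤ Real.exp (65 * A) := Real.exp_le_exp.2 (by linarith)
  have h7 : (τ : ℝ) * (113 * Real.exp A) ≤ τ * (113 * (m * n * Real.exp (65 * A))) := by
    gcongr
    exact h6.trans (le_mul_of_one_le_left (Real.exp_pos _).le hmn)
  have h8 : (10000 : ℝ) * (τ * m * n * ((((effective γ ε L).length : ℝ) + 1) *
      ((256 : ℝ) ^ threshold L.length γ ε) ^ 2)) ≤
      10000 * (τ * m * n * Real.exp (65 * A)) := by gcongr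
  have h9 : (0 : ℝ) ≤ τ * m * n * Real.exp (65 * A) := by positivity
  linarith

theorem TimeBounds.general_le (h : TimeBounds n γ ε L g A) (hn : 1 ≤ n) (hτ : 1 ≤ τ)
    (hg : 1 ≤ Real.log (1 / g) / g) :
    ((setupTime L.length τ γ ε + generalTime n (effective γ ε L).length τ
      (threshold L.length γ ε) : ℕ) : ℝ) ≤ τ * (20000 *
        (n : ℝ) ^ (5 * (Real.log (1 / g) / g) + 4 * (Real.log (1 / ε) / (g * L.length))) *
          Real.exp (82 * A)) := by
  have hA : 0 ≤ A := (Nat.cast_nonneg _).trans h.index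
  have hn' : (1 : ℝ) ≤ n := by exact_mod_cast hn
  have h1 := h.setupTime_le hτ
  have h2 : (generalTime n (effective γ ε L).length τ (threshold L.length γ ε) : ℝ) ≤ _ :=
    Nat.cast_le.2 (generalTime_le hn hτ)
  have h3 := h.tapes_le
  have h4 := h.depth
  have hq := h.low
  have hqℓ : ((threshold L.length γ ε / ((effective γ ε L).length + 1) : ℕ) : ℝ) ≤ 4 * A :=
    (Nat.cast_le.2 (Nat.div_le_self _ _)).trans h.cutoff
  generalize threshold L.length γ ε / ((effective γ ε L).length + 1) = q at *
  set N := (n : ℝ) ^ (5 * (Real.log (1 / g) / g) + 4 * (Real.log (1 / ε) / (g * L.length))) with hN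
  -- The exponent 1 + 2q is at most 1 + 4Λ + 4E/(gd), and Λ ≥ 1 absorbs the summand 1.
  have hnq : (n : ℝ) * ((n : ℝ) ^ q) ^ 2 ≤ N := by
    rw [hN, ← pow_mul, ← pow_succ', ← Real.rpow_natCast]
    refine Real.rpow_le_rpow_of_exponent_le hn' ?_
    push_cast
    linarith
  have hN1 : 1 ≤ N := le_trans (one_le_mul_of_one_le_of_one_le hn'
    (one_le_pow₀ (one_le_pow₀ hn'))) hnq
  have h4q : ((4 : ℝ) ^ q) ≤ Real.exp (8 * A) := by
    have h2' := two_pow_le_exp 2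
    have := natCast_pow_le_exp (b := 4) (c := 2) (by norm_num at h2' ⊢; exact h2') (by norm_num) hqℓ
    push_cast at this
    refine this.trans_eq ?_
    congr 1
    ring
  push_cast at h2 h3 ⊢
  -- The exponent is 82 = 2 · 8 + 2 + 2 · 32: the factors 4 of the codes, the depth and the tapes,
  -- all squared.
  have h5 : ((4 : ℝ) ^ q) ^ 2 * ((((effective γ ε L).length : ℝ) + 1) ^ 2 *
      ((256 : ℝ) ^ threshold L.length γ ε) ^ 2) ≤ Real.exp (82 * A) := by
    calc _ ≤ Real.exp (8 * A) ^ 2 * (Real.exp A ^ 2 * Real.exp (32 * A) ^ 2) := by gcongr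
      _ = Real.exp (82 * A) := by
        rw [← Real.exp_nat_mul, ← Real.exp_nat_mul, ← Real.exp_nat_mul, ← Real.exp_add,
          ← Real.exp_add]
        congr 1; push_cast; ring
  have h6 : Real.exp A ≤ Real.exp (82 * A) := Real.exp_le_exp.2 (by linarith)
  have h7 : (τ : ℝ) * (113 * Real.exp A) ≤ τ * (113 * (N * Real.exp (82 * A))) := by
    gcongr
    exact h6.trans (le_mul_of_one_le_left (Real.exp_pos _).le hN1)
  have h8 : (10000 : ℝ) * (τ * n * ((4 * n) ^ q) ^ 2 * ((((effective γ ε L).length : ℝ) + 1) ^ 2 *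
      ((256 : ℝ) ^ threshold L.length γ ε) ^ 2)) ≤ 10000 * (τ * (N * Real.exp (82 * A))) := by
    calc _ = 10000 * (τ * ((n * (n ^ q) ^ 2) * ((4 ^ q) ^ 2 *
          ((((effective γ ε L).length : ℝ) + 1) ^ 2 * ((256 : ℝ) ^ threshold L.length γ ε) ^ 2))))
              := by
          rw [mul_pow]; ring
      _ ≤ _ := by gcongr
  have h9 : (0 : ℝ) ≤ τ * (N * Real.exp (82 * A)) := by positivity
  linarith

theorem rpow_eq_exp (hε : 0 < ε) (C x : ℝ) :
    (1 / ε) ^ (C * x) = Real.exp (C * (Real.log (1 / ε) * x)) := by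
  rw [Real.rpow_def_of_pos (one_div_pos.2 hε)]
  congr 1
  ring

end

end NoisyCircuit

end

/-! ### The theorem -/

open NoisyCircuit in
theorem theorem1 :
    -- accuracy of the truncation
    (∀ (n : ℕ) (γ : ℝ) (L : Circuit n) (O : Op n) (ℓ : ℕ),
      0 < γ → O.IsHermitian → L.length ≤ ℓ →
        frobSq (heisenberg γ L O - truncated γ ℓ L O) ≤
          (ℓ.choose L.length : ℝ) * Real.exp (-2 * γ * (ℓ + 1)) * frobSq O) ∧
    -- the algorithm: a truncation threshold, two programs (one for each way in which the
    -- observable can be given), and an absolute constant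
    ∃ (thr : ℕ → ℝ → ℝ → ℕ) (sparse general : Program) (C : ℕ),
      ∀ (n : ℕ) (γ ε : ℝ) (L : Circuit n) (O : Op n),
        1 ≤ n → 1 ≤ L.length → 0 < γ → 0 < ε → ε ≤ 1 → O.IsHermitian → frobSq O = 1 →
        -- root-mean-square error over every low-average ensemble
        (∀ (c : ℝ) (N : ℕ) (ρ : Fin N → Op n),
          0 < N → (∀ i, IsDensity (ρ i)) → IsLowAverage c ρ →
            Real.sqrt ((∑ i, ‖Matrix.trace (channel γ L (ρ i) * O) -
                Matrix.trace (ρ i * truncated γ (thr L.length γ ε) L O)‖ ^ 2) / N) ≤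
              Real.sqrt c * ε) ∧
        -- running time when `O` is given as a sum of `m` Pauli operators
        (∀ (ρ : Op n) (terms : List (PauliString n × ℂ)) (τ : ℕ),
          IsDensity ρ → O = sumOfPaulis terms → 1 ≤ τ →
            ∃ T : ℕ,
              sparse.Outputs (sparseInput γ ε L ρ terms) τ
                (Matrix.trace (ρ * truncated γ (thr L.length γ ε) L O)) T ∧
              (T : ℝ) ≤ τ * (C * terms.length * (n : ℝ) ^ C *
                (1 / ε) ^ (C * (Real.log (1 / min γ (1 / 2)) / min γ (1 / 2) ^ 2)))) ∧
        -- running time for general `O`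
        (∀ (ρ : Op n) (τ : ℕ),
          IsDensity ρ → 1 ≤ τ →
            ∃ T : ℕ,
              general.Outputs (generalInput γ ε L ρ O) τ
                (Matrix.trace (ρ * truncated γ (thr L.length γ ε) L O)) T ∧
              (T : ℝ) ≤ τ * (C *
                (n : ℝ) ^ (C * (Real.log (1 / min γ (1 / 2)) / min γ (1 / 2)) +
                  C * (Real.log (1 / ε) / (min γ (1 / 2) * L.length))) *
                (1 / ε) ^ (C * (Real.log (1 / min γ (1 / 2)) / min γ (1 / 2) ^ 2)))) := by
  -- The single constant 20000 dominates both the prefactors and all the exponents (at most 82) in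
  -- the time bounds.
  refine ⟨fun n γ L O ℓ hγ _ hℓ => ?_, threshold, sparseProg, generalProg, 20000,
    fun n γ ε L O hn hL hγ hε hε1 _ hO => ?_⟩
  · rw [← errorLin_apply]
    exact frobSq_errorLin_le hγ.le L ℓ hℓ O
  have hg : 0 < min γ (1 / 2) := lt_min hγ (by norm_num)
  have hg2 : min γ (1 / 2) ≤ 1 / 2 := min_le_right _ _
  have hΛ := one_le_log_div hg hg2
  have hb := timeBounds (n := n) hγ hε hε1 L hL hg hg2 (min_le_left _ _)
  have hA : 0 ≤ Real.log (1 / ε) * (Real.log (1 / min γ (1 / 2)) / min γ (1 / 2) ^ 2) :=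
    (Nat.cast_nonneg _).trans hb.index
  have hE : 0 ≤ Real.log (1 / ε) := Real.log_nonneg (by rw [le_div_iff₀ hε]; linarith)
  have hn' : (1 : ℝ) ≤ n := by exact_mod_cast hn
  refine ⟨fun c N ρ _ hρ hc => ?_, fun ρ terms τ _ hterms hτ => ?_, fun ρ τ _ hτ => ?_⟩
  · refine rms_error_le hε.le ?_ hρ hc
    rw [← mul_one (ε ^ 2), ← hO]
    exact frobSq_errorLin_threshold_le hγ hε L O
  · subst hterms
    obtain ⟨T, hT, hle⟩ := sparseProg_outputs (L := L) (ρ := ρ) (τ := τ) terms hγ hε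
    refine ⟨T, hT, ?_⟩
    -- The normalization of the observable excludes the empty list, for which a bound proportional
    -- to the number of terms would fail.
    have hm : 1 ≤ terms.length := by
      rw [Nat.one_le_iff_ne_zero, Ne, List.length_eq_zero_iff]
      rintro rfl
      simp [sumOfPaulis, frobSq] at hO
    refine (Nat.cast_le.2 hle).trans ((hb.sparse_le hn hτ hm).trans ?_)
    rw [rpow_eq_exp hε]
    push_cast
    gcongr
    · exact le_self_pow₀ hn' (by norm_num)
    · norm_num
  · obtain ⟨T, hT, hle⟩ := generalProg_outputs (L := L) (ρ := ρ) (O := O) (τ := τ) hn hγ hε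
    refine ⟨T, hT, (Nat.cast_le.2 hle).trans ((hb.general_le hn hτ hΛ).trans ?_)⟩
    rw [rpow_eq_exp hε]
    have hd : 0 ≤ Real.log (1 / ε) / (min γ (1 / 2) * L.length) := by positivity
    push_cast
    gcongr
    · norm_num
    · norm_num
    · norm_num
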